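/- Let $M$ be a smooth manifold (Hausdorff, paracompact, without boundary) of dimension $p+q$, and let $\mathcal F$ be a regular foliation of $M$ of codimension $q$, given by a smooth Haefliger cocycle whose charts $f_\alpha\colon U_\alpha\to\mathbb R^q$ are submersions; so $T\mathcal F=\ker df_\alpha$ on $U_\alpha$. Let $\nu=TM/T\mathcal F$ be the normal bundle and $\mathrm p\colon TM\to\nu$ the projection. *Connections.* A connection $\nabla$ on $\nu$ is a Bott connection if $\nabla_X(\mathrm pY)=\mathrm p[X,Y]$ for all smooth vector fields $X,Y$ with $X$ tangent to $\mathcal F$. It is torsion-free if $\nabla_X(\mathrm pY)-\nabla_Y(\mathrm pX)-\mathrm p[X,Y]=0$ for all smooth vector fields $X,Y$. *Frames.* A transverse embedding through $x$ is a smooth embedding $u\colon\mathbb R^q\to M$ with $u(0)=x$ and $T_{u(s)}M=du_s(\mathbb R^q)\oplus T_{u(s)}\mathcal F$ for all $s$. The transverse $k$-jet $j^k_{0,t}(u)$ is the class of $u$ under the relation: $u\sim u'$ if $u(0)=u'(0)$ and $j^k_0(f_\alpha\circ u)=j^k_0(f_\alpha\circ u')$ for the Haefliger charts $f_\alpha$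 around $u(0)$. The set of these classes is the transverse $k$-frame bundle $\mathrm{Fr}_k(M/\mathcal F)\to M$; over $U_\alpha$, its smooth structure is given by the base point and the derivatives of orders $1,\dots,k$ of $f_\alpha\circ u$ at $0$. The group $\mathrm{GL}(q,\mathbb R)$ acts on it on the right by $j^k_{0,t}(u)\cdot A=j^k_{0,t}(u\circ A)$. A point of $\mathrm{Fr}_1(M/\mathcal F)$ is the same as a frame $\varepsilon=(\varepsilon_1,\dots,\varepsilon_q)$ of $\nu_x$. *Tautological form.* Let $\omega$ be the $\mathfrak{gl}(q,\mathbb R)$-valued $1$-form on $\mathrm{Fr}_2(M/\mathcal F)$ whose value on the velocity at $t=0$ of a curve $t\mapsto j^2_{0,t}(u_t)$ is the linear part of $\frac{d}{dt}\big|_0 j^1_0\big((f_\alpha\circ u_0)^{-1}\circ f_\alpha\circ u_t\big)$. **Theorem.** There is a bijection between the smooth $\mathrm{GL}(q,\mathbb R)$-equivariant sections $\sigma\colon \mathrm{Fr}_1(M/\mathcal F)\to\mathrm{Fr}_2(M/\mathcal F)$ of the natural projection and the torsion-free Bott connections $\nabla$ on $\nu$, such that, whenever $\sigma$ and $\nabla$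 correspond to each other: 1. $\sigma^*\omega$ is the connection form of $\nabla$ on the frame bundle $\mathrm{Fr}_1(M/\mathcal F)$ of $\nu$. That is, for every smooth curve $\varepsilon_t$ in $\mathrm{Fr}_1(M/\mathcal F)$ over a curve $x_t$ in $M$, and every smooth section $s$ of $\nu$, written $s(x_t)=\varepsilon_t\cdot c(t)$ with $c(t)\in\mathbb R^q$, one has $\nabla_{\dot x_0}s=\varepsilon_0\cdot\big(c'(0)+(\sigma^*\omega)(\dot\varepsilon_0)\,c(0)\big)$. 2. For every frame $\varepsilon$ of $\nu_x$, $\sigma(\varepsilon)$ is the transverse $2$-jet at $0$ of $s\mapsto\exp_x\big(\sum_i s^ie_i\big)$. Here $(x^i,y^a)$ are any local foliation coordinates about $x$ (that is, $T\mathcal F$ is spanned by the $f_a=\partial/\partial y^a$) such that $e_i=\partial/\partial x^i$ satisfies $\mathrm p(e_i)_x=\varepsilon_i$ (an adapted lift of $\varepsilon$; such coordinates exist). The exponential map is that of the local affine connection $\nabla^{\mathrm{aff}}_X(\iota v+w)=\iota\nabla_Xv+\nabla^{\mathcal F}_Xw$, where $\iota\colon\nu\to TM$ is the local splitting with $\iota(\mathrm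 p e_i)=e_i$, and $\nabla^{\mathcal F}$ is any connection on $T\mathcal F$. In particular this $2$-jet does not depend on the coordinates or on $\nabla^{\mathcal F}$. -/

import Mathlib

open scoped Manifold ContDiff Topology

noncomputable section

/-- The Euclidean space `ℝⁿ`. -/
abbrev Euc (n : ℕ) : Type := EuclideanSpace ℝ (Fin n)

section Connections

variable {n : ℕ} {M : Type*} [TopologicalSpace M] [ChartedSpace (Euc n) M]

/-- A vector field on `M` is smooth on the set `W`. -/
def SmoothFieldOn [IsManifold 𝓘(ℝ, Euc n) ∞ M]
    (Y : Π x : M, TangentSpace 𝓘(ℝ, Euc n) x) (W : Set M) : Prop :=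
  ContMDiffOn 𝓘(ℝ, Euc n) 𝓘(ℝ, Euc n).tangent ∞
    (fun x => (⟨x, Y x⟩ : TangentBundle 𝓘(ℝ, Euc n) M)) W

/-- The space `𝔛(M)` of smooth vector fields. -/
def smoothFields (n : ℕ) (M : Type*) [TopologicalSpace M] [ChartedSpace (Euc n) M]
    [IsManifold 𝓘(ℝ, Euc n) ∞ M] : Submodule ℝ (Π x : M, TangentSpace 𝓘(ℝ, Euc n) x) where
  carrier := {Y | SmoothFieldOn Y Set.univ}
  zero_mem' := by
    exact (Bundle.contMDiff_zeroSection ℝ (TangentSpace 𝓘(ℝ, Euc n) (M := M))).contMDiffOn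
  add_mem' := fun hX hY =>
    ContMDiffOn.add_section (V := TangentSpace 𝓘(ℝ, Euc n) (M := M)) hX hY
  smul_mem' := fun c _ hX =>
    ContMDiffOn.const_smul_section (V := TangentSpace 𝓘(ℝ, Euc n) (M := M)) (a := c) hX

/-- A (smooth, linear, Koszul) connection on a vector bundle `B → M`, where `Γ` is the space of
smooth sections of `B`; `toFun s x v` is `(∇_v s)(x)`. It acts on *smooth* sections only, so that
two connections are equal exactly when they agree on all smooth sections. -/
@[ext]
structure KoszulConnection [IsManifold 𝓘(ℝ, Euc n) ∞ M] {B : M → Type*}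
    [∀ x, AddCommGroup (B x)] [∀ x, Module ℝ (B x)] (Γ : Submodule ℝ (Π x, B x)) where
  toFun : Γ → Π x : M, TangentSpace 𝓘(ℝ, Euc n) x →ₗ[ℝ] B x
  map_add : ∀ s s' x, toFun (s + s') x = toFun s x + toFun s' x
  leibniz : ∀ g : M → ℝ, ContMDiff 𝓘(ℝ, Euc n) 𝓘(ℝ, ℝ) ∞ g →
    ∀ s s' : Γ, (∀ x, s'.1 x = g x • s.1 x) →
    ∀ x (v : TangentSpace 𝓘(ℝ, Euc n) x),
      toFun s' x v = g x • toFun s x v + mvfderiv 𝓘(ℝ, Euc n) g x v • s.1 x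
  smooth : ∀ X ∈ smoothFields n M, ∀ s, (fun x => toFun s x (X x)) ∈ Γ

end Connections

/-- A regular foliation of codimension `q` of a manifold of dimension `p + q` (so with leaves of
dimension `p`), given by a smooth Haefliger cocycle whose charts `f α : U α → ℝ^q` are submersions.
The germs of the transition diffeomorphisms are determined by the charts, because submersions are
open; therefore their cocycle identities hold automatically. -/
structure RegularFoliation (p q : ℕ) (M : Type*) [TopologicalSpace M]
    [ChartedSpace (Euc (p + q)) M] (ι : Type*) where
  U : ι → Set M
  f : ι → M → Euc q
  isOpen_U : ∀ α, IsOpen (U α)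
  cover : ∀ x, ∃ α, x ∈ U α
  smooth : ∀ α, ContMDiffOn 𝓘(ℝ, Euc (p + q)) 𝓘(ℝ, Euc q) ∞ (f α) (U α)
  submersive : ∀ α, ∀ x ∈ U α,
    Function.Surjective (mfderiv 𝓘(ℝ, Euc (p + q)) 𝓘(ℝ, Euc q) (f α) x)
  transition : ∀ α β, ∀ x ∈ U α ∩ U β, ∃ h : OpenPartialHomeomorph (Euc q) (Euc q),
    ContDiffOn ℝ ∞ h h.source ∧ ContDiffOn ℝ ∞ h.symm h.target ∧
    f β x ∈ h.source ∧ f α =ᶠ[𝓝 x] fun y => h (f β y)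

namespace RegularFoliation

variable {p q : ℕ} {M : Type*} [TopologicalSpace M] [ChartedSpace (Euc (p + q)) M] {ι : Type*}
  (F : RegularFoliation p q M ι)

/-! ### The tangent and normal bundles of the foliation -/

/-- The fibre over `x` of the tangent bundle `Tℱ`. -/
def tangent (x : M) : Submodule ℝ (TangentSpace 𝓘(ℝ, Euc (p + q)) x) :=
  ⨅ (α : ι) (_ : x ∈ F.U α),
    (mfderiv 𝓘(ℝ, Euc (p + q)) 𝓘(ℝ, Euc q) (F.f α) x).toLinearMap.ker

/-- The fibre over `x` of the normal bundle `ν = TM / Tℱ`. -/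
abbrev Normal (x : M) : Type := TangentSpace 𝓘(ℝ, Euc (p + q)) x ⧸ F.tangent x

/-- The projection `T_x M → ν_x`. -/
def proj (x : M) : TangentSpace 𝓘(ℝ, Euc (p + q)) x →ₗ[ℝ] F.Normal x := (F.tangent x).mkQ

/-- Smooth sections of `Tℱ`. -/
def tangentSections [IsManifold 𝓘(ℝ, Euc (p + q)) ∞ M] : Submodule ℝ (Π x, F.tangent x) where
  carrier := {s | (fun x => (s x : TangentSpace 𝓘(ℝ, Euc (p + q)) x)) ∈ smoothFields (p + q) M}
  zero_mem' := (smoothFields (p + q) M).zero_mem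
  add_mem' := fun {s s'} h h' => (smoothFields (p + q) M).add_mem
    (x := fun x => (s x : TangentSpace 𝓘(ℝ, Euc (p + q)) x))
    (y := fun x => (s' x : TangentSpace 𝓘(ℝ, Euc (p + q)) x)) h h'
  smul_mem' := fun c s h => (smoothFields (p + q) M).smul_mem
    (x := fun x => (s x : TangentSpace 𝓘(ℝ, Euc (p + q)) x)) c h

/-- Smooth sections of the quotient bundle `ν`: those that lift locally to smooth vector fields. -/
def normalSections [IsManifold 𝓘(ℝ, Euc (p + q)) ∞ M] : Submodule ℝ (Π x, F.Normal x) where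
  carrier := {s | ∀ x, ∃ W, IsOpen W ∧ x ∈ W ∧
    ∃ Y : Π y : M, TangentSpace 𝓘(ℝ, Euc (p + q)) y,
      SmoothFieldOn Y W ∧ ∀ y ∈ W, s y = F.proj y (Y y)}
  zero_mem' := fun x => ⟨Set.univ, isOpen_univ, trivial, 0, (smoothFields (p + q) M).zero_mem,
    fun y _ => (map_zero (F.proj y)).symm⟩
  add_mem' := by
    intro s s' hs hs' x
    obtain ⟨W, hW, hx, Y, hY, h⟩ := hs x
    obtain ⟨W', hW', hx', Y', hY', h'⟩ := hs' x
    refine ⟨W ∩ W', hW.inter hW', ⟨hx, hx'⟩, Y + Y',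
      ContMDiffOn.add_section (V := TangentSpace 𝓘(ℝ, Euc (p + q)) (M := M))
        (ContMDiffOn.mono hY Set.inter_subset_left)
        (ContMDiffOn.mono hY' Set.inter_subset_right), fun y hy => ?_⟩
    rw [Pi.add_apply, Pi.add_apply, map_add, h y hy.1, h' y hy.2]
  smul_mem' := by
    intro c s hs x
    obtain ⟨W, hW, hx, Y, hY, h⟩ := hs x
    refine ⟨W, hW, hx, c • Y, ContMDiffOn.const_smul_section
      (V := TangentSpace 𝓘(ℝ, Euc (p + q)) (M := M)) (a := c) hY, fun y hy => ?_⟩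
    rw [Pi.smul_apply, Pi.smul_apply, map_smul, h y hy]

/-- The section `pY` of `ν` defined by a smooth vector field `Y`. -/
def projSection [IsManifold 𝓘(ℝ, Euc (p + q)) ∞ M] (Y : smoothFields (p + q) M) : F.normalSections :=
  ⟨fun x => F.proj x (Y.1 x), fun _ => ⟨Set.univ, isOpen_univ, trivial, Y.1, Y.2, fun _ _ => rfl⟩⟩

/-- A connection on the normal bundle `ν`. -/
abbrev NormalConnection [IsManifold 𝓘(ℝ, Euc (p + q)) ∞ M] := KoszulConnection (n := p + q) F.normalSections

/-- A connection on `Tℱ`. -/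
abbrev TangentialConnection [IsManifold 𝓘(ℝ, Euc (p + q)) ∞ M] := KoszulConnection (n := p + q) F.tangentSections

/-- `∇` is a Bott connection: `∇_X (pY) = p[X, Y]` for leafwise `X`. -/
def IsBott [IsManifold 𝓘(ℝ, Euc (p + q)) ∞ M] (D : F.NormalConnection) : Prop :=
  ∀ X Y : smoothFields (p + q) M, (∀ x, X.1 x ∈ F.tangent x) → ∀ x,
    D.toFun (F.projSection Y) x (X.1 x) =
      F.proj x (VectorField.mlieBracket 𝓘(ℝ, Euc (p + q)) X.1 Y.1 x)

/-- The torsion `T(X, Y) = ∇_X (pY) - ∇_Y (pX) - p[X, Y]`. -/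
def torsion [IsManifold 𝓘(ℝ, Euc (p + q)) ∞ M] (D : F.NormalConnection) (X Y : smoothFields (p + q) M) (x : M) : F.Normal x :=
  D.toFun (F.projSection Y) x (X.1 x) - D.toFun (F.projSection X) x (Y.1 x) -
    F.proj x (VectorField.mlieBracket 𝓘(ℝ, Euc (p + q)) X.1 Y.1 x)

/-- The torsion-free Bott connections on `ν`. -/
abbrev TorsionFreeBottConnection [IsManifold 𝓘(ℝ, Euc (p + q)) ∞ M] :=
  {D : F.NormalConnection // F.IsBott D ∧ ∀ X Y x, F.torsion D X Y x = 0}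

/-! ### Transverse frame bundles -/

/-- A transverse embedding (through `u 0`). -/
structure TransverseEmbedding where
  toFun : Euc q → M
  smooth : ContMDiff 𝓘(ℝ, Euc q) 𝓘(ℝ, Euc (p + q)) ∞ toFun
  isEmbedding : Topology.IsEmbedding toFun
  immersive : ∀ s, Function.Injective (mfderiv 𝓘(ℝ, Euc q) 𝓘(ℝ, Euc (p + q)) toFun s)
  transverse : ∀ s, IsCompl
    (mfderiv 𝓘(ℝ, Euc q) 𝓘(ℝ, Euc (p + q)) toFun s).toLinearMap.range (F.tangent (toFun s))

instance : CoeFun F.TransverseEmbedding fun _ => Euc q → M := ⟨TransverseEmbedding.toFun⟩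

/-- Leaf space equivalence of the `k`-jets at `0` of two transverse embeddings through the same
point: in Haefliger charts, all derivatives at `0` of order at most `k` agree. -/
def jetSetoid (k : ℕ) : Setoid F.TransverseEmbedding where
  r u u' := u 0 = u' 0 ∧ ∀ α, u 0 ∈ F.U α → ∀ i ≤ k,
    iteratedFDeriv ℝ i (fun s => F.f α (u s)) 0 = iteratedFDeriv ℝ i (fun s => F.f α (u' s)) 0
  iseqv :=
    { refl := fun _ => ⟨rfl, fun _ _ _ _ => rfl⟩
      symm := fun h => ⟨h.1.symm, fun α hα i hi => (h.2 α (h.1 ▸ hα) i hi).symm⟩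
      trans := fun h h' => ⟨h.1.trans h'.1, fun α hα i hi =>
        (h.2 α hα i hi).trans (h'.2 α (h.1 ▸ hα) i hi)⟩ }

/-- The transverse `k`-frame bundle `Fr_k(M/ℱ)`, as a set. -/
def Fr (k : ℕ) : Type _ := Quotient (F.jetSetoid k)

variable {F}

/-- The transverse `k`-jet at `0` of a transverse embedding. -/
def TransverseEmbedding.jet (k : ℕ) (u : F.TransverseEmbedding) : F.Fr k :=
  Quotient.mk (F.jetSetoid k) u

/-- The first derivative of a transverse embedding at `0` in a Haefliger chart. -/
def TransverseEmbedding.deriv₁ (u : F.TransverseEmbedding) (α : ι) : Euc q →L[ℝ] Euc q :=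
  fderiv ℝ (fun s => F.f α (u s)) 0

/-- The second derivative of a transverse embedding at `0` in a Haefliger chart. -/
def TransverseEmbedding.deriv₂ (u : F.TransverseEmbedding) (α : ι) :
    Euc q →L[ℝ] Euc q →L[ℝ] Euc q :=
  fderiv ℝ (fderiv ℝ fun s => F.f α (u s)) 0

/-- The frame `v ↦ p (du_0 v)` of `ν` at `u 0` which is the transverse `1`-jet of `u`. -/
def TransverseEmbedding.frame (u : F.TransverseEmbedding) : Euc q →ₗ[ℝ] F.Normal (u 0) :=
  F.proj (u 0) ∘ₗ (mfderiv 𝓘(ℝ, Euc q) 𝓘(ℝ, Euc (p + q)) u.toFun 0).toLinearMap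

/-- Precomposition with a linear automorphism of `ℝ^q`. -/
def TransverseEmbedding.comp (u : F.TransverseEmbedding) (A : Euc q ≃L[ℝ] Euc q) :
    F.TransverseEmbedding :=
  have hd : ∀ s, mfderiv 𝓘(ℝ, Euc q) 𝓘(ℝ, Euc (p + q)) (fun s => u (A s)) s =
      (mfderiv 𝓘(ℝ, Euc q) 𝓘(ℝ, Euc (p + q)) u.toFun (A s)).comp
        (A : Euc q →L[ℝ] Euc q) := fun s => by
    have h := mfderiv_comp (I := 𝓘(ℝ, Euc q)) (I' := 𝓘(ℝ, Euc q)) (I'' := 𝓘(ℝ, Euc (p + q))) s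
      (u.smooth.mdifferentiable (by simp) (A s)) A.differentiableAt.mdifferentiableAt
    have hA : mfderiv 𝓘(ℝ, Euc q) 𝓘(ℝ, Euc q) A s = (A : Euc q →L[ℝ] Euc q) := by
      rw [mfderiv_eq_fderiv]; exact A.fderiv
    rw [hA] at h
    exact h
  { toFun := fun s => u (A s)
    smooth := u.smooth.comp A.contDiff.contMDiff
    isEmbedding := u.isEmbedding.comp A.toHomeomorph.isEmbedding
    immersive := fun s => by
      rw [hd s]; exact (u.immersive (A s)).comp A.injective
    transverse := fun s => by
      have h := u.transverse (A s)
      have : (mfderiv 𝓘(ℝ, Euc q) 𝓘(ℝ, Euc (p + q)) (fun s => u (A s)) s).toLinearMap.range =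
          (mfderiv 𝓘(ℝ, Euc q) 𝓘(ℝ, Euc (p + q)) u.toFun (A s)).toLinearMap.range := by
        rw [hd s]
        exact LinearMap.range_comp_of_range_eq_top _ (LinearMap.range_eq_top.2 A.surjective)
      rw [this]; exact h }

/-- The right action of `GL(q, ℝ)`, regarded as the group of the jets of linear automorphisms, on
`Fr_k(M/ℱ)`. -/
def Fr.act {k : ℕ} (ε : F.Fr k) (A : Euc q ≃L[ℝ] Euc q) : F.Fr k :=
  Quotient.map' (s₁ := F.jetSetoid k) (s₂ := F.jetSetoid k) (fun u => u.comp A) (by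
    rintro u u' ⟨h0, h⟩
    have e : ∀ w : F.TransverseEmbedding, (w.comp A) 0 = w 0 := fun w =>
      congrArg w.toFun (map_zero A)
    refine ⟨by rw [e, e, h0], fun α hα i hi => ?_⟩
    rw [e] at hα
    have key : ∀ w : F.TransverseEmbedding,
        iteratedFDeriv ℝ i (fun s => F.f α ((w.comp A) s)) 0 =
        (iteratedFDeriv ℝ i (fun s => F.f α (w s)) 0).compContinuousLinearMap
          fun _ => (A : Euc q →L[ℝ] Euc q) := fun w => by
      have := A.iteratedFDerivWithin_comp_right (fun s => F.f α (w s)) uniqueDiffOn_univ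
        (Set.mem_univ (A 0)) i
      simp only [Set.preimage_univ, iteratedFDerivWithin_univ, map_zero] at this
      exact this
    rw [key u, key u', h α hα i hi]) ε

/-- The natural projection `Fr_2(M/ℱ) → Fr_1(M/ℱ)`. -/
def Fr.truncate (η : F.Fr 2) : F.Fr 1 :=
  Quotient.map' (s₁ := F.jetSetoid 2) (s₂ := F.jetSetoid 1) id
    (fun _ _ h => ⟨h.1, fun α hα i hi => h.2 α hα i (hi.trans one_le_two)⟩) η

variable (F)

/-- A smooth `GL(q, ℝ)`-equivariant section `Fr_1(M/ℱ) → Fr_2(M/ℱ)`.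

Over `U α`, the charts of the two bundles are `ε ↦ (x, A) ∈ U α × GL(q, ℝ)` and
`η ↦ (x, A, B) ∈ U α × GL(q, ℝ) × Sym²(ℝ^q, ℝ^q)`, where `x` is the base point and `A`, `B` are the
first and second derivatives in the Haefliger chart `f α`. Smoothness of a section is smoothness of
the coordinate `B` of the image as a function of the coordinates `(x, A)`. -/
@[ext]
structure EquivariantSection where
  toFun : F.Fr 1 → F.Fr 2
  isSection : ∀ ε, (toFun ε).truncate = ε
  equivariant : ∀ ε A, toFun (ε.act A) = (toFun ε).act A
  smooth : ∀ α, ∃ b : M × (Euc q →L[ℝ] Euc q) → (Euc q →L[ℝ] Euc q →L[ℝ] Euc q),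
    ContMDiffOn (𝓘(ℝ, Euc (p + q)).prod 𝓘(ℝ, Euc q →L[ℝ] Euc q))
      𝓘(ℝ, Euc q →L[ℝ] Euc q →L[ℝ] Euc q) ∞ b {z | z.1 ∈ F.U α ∧ z.2.IsInvertible} ∧
    ∀ u v : F.TransverseEmbedding, u 0 ∈ F.U α → toFun (u.jet 1) = v.jet 2 →
      v.deriv₂ α = b (u 0, u.deriv₁ α)

/-! ### The tautological form and connection forms -/

/-- The curve `t ↦ j¹(u t)` in `Fr_1(M/ℱ)` is smooth (in the bundle charts over the `U α`). -/
def IsSmoothFrameCurve (u : ℝ → F.TransverseEmbedding) : Prop :=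
  ContMDiff 𝓘(ℝ, ℝ) 𝓘(ℝ, Euc (p + q)) ∞ (fun t => u t 0) ∧
  ∀ α t, u t 0 ∈ F.U α → ContDiffAt ℝ ∞ (fun τ => (u τ).deriv₁ α) t

/-- `Ω` is the value of the `𝔤𝔩(q, ℝ)`-valued tautological form `ω²` on the velocity at `t = 0` of
the curve `t ↦ j²(v t)` in `Fr_2(M/ℱ)`: the linear part of
`d/dt|₀ j¹ ((f ∘ v₀)⁻¹ ∘ (f ∘ v_t))`, for any Haefliger chart `f`; the map `g` below is a local
inverse of `f ∘ v₀`. -/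
def IsTautologicalValue (v : ℝ → F.TransverseEmbedding) (Ω : Euc q →L[ℝ] Euc q) : Prop :=
  ∀ α, v 0 0 ∈ F.U α → ∀ g : Euc q → Euc q, (∀ᶠ s in 𝓝 0, g (F.f α (v 0 s)) = s) →
    HasDerivAt (fun t => fderiv ℝ (fun s => g (F.f α (v t s))) 0) Ω 0

/-- `Ω` is the value of the connection form of `∇` (on the frame bundle `Fr_1(M/ℱ)` of `ν`) on the
velocity at `t = 0` of the curve `t ↦ ε_t = j¹(u t)`: if a section `s` of `ν` is `ε_t (c t)` along
the curve, then `∇ s`, in the direction of the base curve, is `ε₀ (c'(0) + Ω c(0))`. -/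
def IsConnectionFormValue [IsManifold 𝓘(ℝ, Euc (p + q)) ∞ M] (D : F.NormalConnection) (u : ℝ → F.TransverseEmbedding)
    (Ω : Euc q →L[ℝ] Euc q) : Prop :=
  ∀ (s : F.normalSections) (c : ℝ → Euc q), (∀ t, (u t).frame (c t) = s.1 (u t 0)) →
    ∃ c' : Euc q, HasDerivAt c c' 0 ∧
      D.toFun s (u 0 0) (mfderiv 𝓘(ℝ, ℝ) 𝓘(ℝ, Euc (p + q)) (fun t => u t 0) 0 (1 : ℝ)) =
        (u 0).frame (c' + Ω (c 0))

/-- The pullback by the section `σ` of the tautological form is the connection form of `∇`. -/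
def PullsBackToConnectionForm [IsManifold 𝓘(ℝ, Euc (p + q)) ∞ M] (σ : F.EquivariantSection) (D : F.NormalConnection) : Prop :=
  ∀ u v : ℝ → F.TransverseEmbedding, F.IsSmoothFrameCurve u →
    (∀ t, σ.toFun ((u t).jet 1) = (v t).jet 2) →
    ∃ Ω, F.IsTautologicalValue v Ω ∧ F.IsConnectionFormValue D u Ω

/-! ### Adapted lifts and the exponential map -/

/-- Foliation coordinates `φ = (x^i, y^a)`: smooth coordinates for which `Tℱ` is spanned by the
`∂/∂y^a`. -/
structure IsFoliationChart (φ : OpenPartialHomeomorph M (Euc q × Euc p)) : Prop where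
  smooth : ContMDiffOn 𝓘(ℝ, Euc (p + q)) 𝓘(ℝ, Euc q × Euc p) ∞ φ φ.source
  smooth_symm : ContMDiffOn 𝓘(ℝ, Euc q × Euc p) 𝓘(ℝ, Euc (p + q)) ∞ φ.symm φ.target
  tangent_eq : ∀ y ∈ φ.source, F.tangent y =
    (mfderiv 𝓘(ℝ, Euc (p + q)) 𝓘(ℝ, Euc q) (fun z => (φ z).1) y).toLinearMap.ker

/-- The vector field with constant components `b` in the coordinates `φ`; for `b` in the standard
basis these are the coordinate fields `e_i = ∂/∂x^i` and `f_a = ∂/∂y^a`. -/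
def coordField (φ : OpenPartialHomeomorph M (Euc q × Euc p)) (b : Euc q × Euc p) (y : M) :
    TangentSpace 𝓘(ℝ, Euc (p + q)) y :=
  mfderiv 𝓘(ℝ, Euc q × Euc p) 𝓘(ℝ, Euc (p + q)) φ.symm (φ y) b

/-- The coordinate framing `(e_i, f_a)` of `φ` is an adapted lift of the frame `ε = j¹(u)`:
`φ` are foliation coordinates about `u 0` and `p(e_i) = ε_i` at `u 0`. -/
def IsAdaptedLift (φ : OpenPartialHomeomorph M (Euc q × Euc p)) (u : F.TransverseEmbedding) :
    Prop :=
  F.IsFoliationChart φ ∧ u 0 ∈ φ.source ∧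
    ∀ e : Euc q, F.proj (u 0) (coordField φ (e, 0) (u 0)) = u.frame e

/-- `G` are the Christoffel symbols, `∇_{∂_b} ∂_c = ∂_{G(b, c)}` at each point `y` of the coordinate
domain, of the affine connection `∇ (ι(v) + w) = ι ∇^ν v + ∇^ℱ w`, where `ι : ν → TM` is the
splitting with `ι (p e_i) = e_i`. In other words `∇ e_i = ι ∇^ν (p e_i)` and `∇ f_a = ∇^ℱ f_a`. The
sections `s`, `S` extend the germs at `y` of the local sections `p e` and `f` to all of `M`. -/
def IsChristoffel [IsManifold 𝓘(ℝ, Euc (p + q)) ∞ M] (D : F.NormalConnection) (D' : F.TangentialConnection)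
    (φ : OpenPartialHomeomorph M (Euc q × Euc p))
    (G : M → (Euc q × Euc p) →ₗ[ℝ] (Euc q × Euc p) →ₗ[ℝ] (Euc q × Euc p)) : Prop :=
  ∀ y ∈ φ.source, ∀ b : Euc q × Euc p,
    (∀ e : Euc q, (G y b (e, 0)).2 = 0 ∧
      ∀ s : F.normalSections, (∀ᶠ z in 𝓝 y, s.1 z = F.proj z (coordField φ (e, 0) z)) →
        D.toFun s y (coordField φ b y) = F.proj y (coordField φ (G y b (e, 0)) y)) ∧
    (∀ k : Euc p, (G y b (0, k)).1 = 0 ∧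
      ∀ S : F.tangentSections,
        (∀ᶠ z in 𝓝 y, (S.1 z : TangentSpace 𝓘(ℝ, Euc (p + q)) z) = coordField φ (0, k) z) →
        (D'.toFun S y (coordField φ b y) : TangentSpace 𝓘(ℝ, Euc (p + q)) y) =
          coordField φ (G y b (0, k)) y)

/-- In the coordinates `φ`, the curve `z : [0, 1] → ℝ^q × ℝ^p` is a geodesic with Christoffel
symbols `G`, initial point `x` and initial coordinate velocity `b`. -/
def IsGeodesic (φ : OpenPartialHomeomorph M (Euc q × Euc p))
    (G : M → (Euc q × Euc p) →ₗ[ℝ] (Euc q × Euc p) →ₗ[ℝ] (Euc q × Euc p))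
    (x : M) (b : Euc q × Euc p) (z : ℝ → Euc q × Euc p) : Prop :=
  ∃ z' : ℝ → Euc q × Euc p, z 0 = φ x ∧ z' 0 = b ∧ ∀ t ∈ Set.Icc (0 : ℝ) 1,
    z t ∈ φ.target ∧ HasDerivWithinAt z (z' t) (Set.Icc 0 1) t ∧
    HasDerivWithinAt z' (-G (φ.symm (z t)) (z' t) (z' t)) (Set.Icc 0 1) t

/-- The germ at `0` of `w : ℝ^q → M` is that of `s ↦ exp(Σ s^i e_i)` at the point `x`, for the affine
connection `∇^ν ⊕ ∇^ℱ` of the coordinates `φ`: for small `s`, `w s = c(1)` for a geodesic `c` with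
`c(0) = x` and `c'(0) = Σ s^i e_i`. -/
def IsExponential [IsManifold 𝓘(ℝ, Euc (p + q)) ∞ M] (D : F.NormalConnection) (D' : F.TangentialConnection)
    (φ : OpenPartialHomeomorph M (Euc q × Euc p)) (x : M) (w : Euc q → M) : Prop :=
  ∃ G, F.IsChristoffel D D' φ G ∧
    ∀ᶠ s in 𝓝 (0 : Euc q), ∃ z, IsGeodesic φ G x (s, 0) z ∧ w s = φ.symm (z 1)

/-- The transverse `2`-jet at `0` of the map germ `w` is `η`: in Haefliger charts, `w` has contact
of second order at `0` with the representatives of `η`. For `w` smooth this is equality of all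
derivatives at `0` of order at most two. -/
def HasTransverseTwoJet (w : Euc q → M) (η : F.Fr 2) : Prop :=
  ∀ v : F.TransverseEmbedding, v.jet 2 = η → w 0 = v 0 ∧ ∀ α, v 0 ∈ F.U α →
    (fun s => F.f α (w s) - F.f α (v s)) =o[𝓝 0] fun s => ‖s‖ ^ 2

/-- The section `σ` takes every frame `ε` to the transverse `2`-jet of the exponential map through
any adapted lift of `ε`, for any connection on `Tℱ`. -/
def IsExponentialSection [IsManifold 𝓘(ℝ, Euc (p + q)) ∞ M] (D : F.NormalConnection) (σ : F.EquivariantSection) : Prop :=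
  ∀ u : F.TransverseEmbedding, (∃ φ, F.IsAdaptedLift φ u) ∧
    ∀ φ, F.IsAdaptedLift φ u → ∀ D' : F.TangentialConnection,
      (∃ w, F.IsExponential D D' φ (u 0) w) ∧
      ∀ w, F.IsExponential D D' φ (u 0) w → F.HasTransverseTwoJet w (σ.toFun (u.jet 1))

end RegularFoliation

end

/-!
Torsion-free Bott connections and equivariant sections of `Fr_2(M/ℱ) → Fr_1(M/ℱ)` are two
descriptions of the same local datum: a smooth symmetric bilinear map `Γ_α(x)` on `ℝ^q` for every
Haefliger chart `f_α`, with the transformation law of Christoffel symbols under a change of charts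
(`ChristoffelFamily`).

For a connection, `Γ_α` are the Christoffel symbols in the trivialization of `ν` by `df_α`
(`HasChristoffelAt`). They exist because a Bott connection differentiates the basic sections
`p ∂/∂x^i` trivially along the leaves, so that `∇_v s - dS(v)` depends on `df_α(v)` only; they are
symmetric because the torsion vanishes (`IsTransverseChart.exists_christoffel`). Conversely, the
expressions `dS(v) + Γ_α(df_α(v), S)` fit together to a connection
(`ChristoffelFamily.connection`). For a section `σ`, equivariance under `GL(q, ℝ)` implies that the
second derivative in `f_α` of `σ(ε)` is `-Γ_α(A·, A·)`, where `A` is the matrix of the frame `ε` in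
`f_α` (`EquivariantSection.exists_deriv₂_eq`), and the transformation law is the chain rule for
second derivatives. Conversely, every symmetric second derivative is realized by a transverse
embedding (`TransverseEmbedding.exists_deriv₂_eq`), so Christoffel symbols define a section
(`ChristoffelFamily.toSection`). The resulting relation `Corresponds` between sections and
connections is a bijection (`sectionEquivConnection`), and both assertions about it are computations
in charts.

For the connection form, let `A_t`, `B_t` be the first and second derivatives in `f_α` along a curve
of `2`-jets, and `ξ` the velocity of its base curve in `f_α`. The tautological form is
`A⁻¹ (A' - B(A⁻¹ ξ, ·))` (`hasDerivAt_tautological`), the connection form is `A⁻¹ (A' + Γ(ξ, A·))`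
(`isConnectionFormValue`), and `B = -Γ(A·, A·)` on the image of `σ`.

For the exponential map, the affine connection of an adapted lift has Christoffel symbols `G` in the
foliation coordinates, which are continuous (`IsChristoffel.continuousAt`). A geodesic with initial
velocity `b` stays within `O(‖b‖)` of its initial point, whence `exp(b) = a + b - ½ G(b, b) + o(‖b‖²)`
(`exists_forall_isGeodesicPath_expansion`). Composing with `f_α`, which in the coordinates is a
function `k` with `D²k - Dk ∘ G = -Γ_α(Dk·, Dk·)` on the transverse directions
(`IsChristoffel.fderiv_fderiv_eq`), gives the second-order expansion of any representative of `σ(ε)`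
(`Corresponds.hasTransverseTwoJet`). Existence of the exponential map follows by solving the geodesic
equation in a slice `y = const` (`IsFoliationChart.exists_isExponential`).
-/

noncomputable section

/-! ### Calculus of vector-valued functions and vector fields on manifolds -/

section ManifoldCalculus

variable {n : ℕ} {M : Type*} [TopologicalSpace M] [ChartedSpace (Euc n) M]
  {V : Type*} [NormedAddCommGroup V] [NormedSpace ℝ V]
  {V' : Type*} [NormedAddCommGroup V'] [NormedSpace ℝ V']

theorem two_le_infty : (2 : ℕ∞ω) ≤ ∞ := WithTop.coe_le_coe.2 le_top

theorem mvfderiv_congr {f g : M → V} {x : M} (h : f =ᶠ[𝓝 x] g) :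
    mvfderiv 𝓘(ℝ, Euc n) f x = mvfderiv 𝓘(ℝ, Euc n) g x := by
  ext v
  exact congrArg (fun L : Euc n →L[ℝ] V => L v) (h.mfderiv_eq (I := 𝓘(ℝ, Euc n)) (I' := 𝓘(ℝ, V)))

theorem MDifferentiableAt.hasMFDerivAt_mvfderiv {f : M → V} {x : M}
    (hf : MDifferentiableAt 𝓘(ℝ, Euc n) 𝓘(ℝ, V) f x) :
    HasMFDerivAt 𝓘(ℝ, Euc n) 𝓘(ℝ, V) f x (mvfderiv 𝓘(ℝ, Euc n) f x) :=
  hf.hasMFDerivAt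

theorem HasMFDerivAt.mvfderiv_eq {f : M → V} {x : M} {f' : TangentSpace 𝓘(ℝ, Euc n) x →L[ℝ] V}
    (hf : HasMFDerivAt 𝓘(ℝ, Euc n) 𝓘(ℝ, V) f x f') : mvfderiv 𝓘(ℝ, Euc n) f x = f' :=
  hf.mfderiv

/-- The product rule for the evaluation of a function with values in linear maps. -/
theorem mvfderiv_clm_apply {L : M → V →L[ℝ] V'} {g : M → V} {x : M}
    (hL : MDifferentiableAt 𝓘(ℝ, Euc n) 𝓘(ℝ, V →L[ℝ] V') L x)
    (hg : MDifferentiableAt 𝓘(ℝ, Euc n) 𝓘(ℝ, V) g x) (v : TangentSpace 𝓘(ℝ, Euc n) x) :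
    mvfderiv 𝓘(ℝ, Euc n) (fun y => L y (g y)) x v =
      mvfderiv 𝓘(ℝ, Euc n) L x v (g x) + L x (mvfderiv 𝓘(ℝ, Euc n) g x v) := by
  have h1 : HasFDerivWithinAt _ (mvfderiv 𝓘(ℝ, Euc n) L x : Euc n →L[ℝ] V →L[ℝ] V') _ _ :=
    hL.hasMFDerivAt_mvfderiv.2
  have h2 : HasFDerivWithinAt _ (mvfderiv 𝓘(ℝ, Euc n) g x : Euc n →L[ℝ] V) _ _ :=
    hg.hasMFDerivAt_mvfderiv.2
  have h : HasMFDerivAt 𝓘(ℝ, Euc n) 𝓘(ℝ, V') (fun y => L y (g y)) x _ :=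
    ⟨hL.continuousAt.clm_apply hg.continuousAt, h1.clm_apply h2⟩
  have h3 := congrArg (fun L : Euc n →L[ℝ] V' => L v) h.mvfderiv_eq
  refine h3.trans ((add_comm _ _).trans ?_)
  simp only [extChartAt, mfld_simps,
    OpenPartialHomeomorph.left_inv _ (mem_chart_source (Euc n) x)]
  rfl

/-- The chain rule for a map of vector spaces after a vector-valued function. -/
theorem mvfderiv_fderiv_comp {h : V → V'} {f : M → V} {x : M}
    (hh : DifferentiableAt ℝ h (f x)) (hf : MDifferentiableAt 𝓘(ℝ, Euc n) 𝓘(ℝ, V) f x)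
    (v : TangentSpace 𝓘(ℝ, Euc n) x) :
    mvfderiv 𝓘(ℝ, Euc n) (fun y => h (f y)) x v =
      fderiv ℝ h (f x) (mvfderiv 𝓘(ℝ, Euc n) f x v) := by
  have h1 := hh.hasFDerivAt.hasMFDerivAt.comp x hf.hasMFDerivAt_mvfderiv
  exact congrArg (fun L : Euc n →L[ℝ] V' => L v) (HasMFDerivAt.mvfderiv_eq h1)

/-- The chain rule for a vector-valued function after a map from a vector space. -/
theorem hasFDerivAt_comp_mvfderiv {f : M → V} {ψ : V' → M} {z : V'}
    (hf : MDifferentiableAt 𝓘(ℝ, Euc n) 𝓘(ℝ, V) f (ψ z))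
    (hψ : MDifferentiableAt 𝓘(ℝ, V') 𝓘(ℝ, Euc n) ψ z) :
    HasFDerivAt (fun s => f (ψ s))
      ((mvfderiv 𝓘(ℝ, Euc n) f (ψ z)).comp (mfderiv 𝓘(ℝ, V') 𝓘(ℝ, Euc n) ψ z) : V' →L[ℝ] V) z :=
  (hf.hasMFDerivAt_mvfderiv.comp z hψ.hasMFDerivAt).hasFDerivAt

theorem fderiv_comp_mvfderiv {f : M → V} {ψ : V' → M} {z : V'}
    (hf : MDifferentiableAt 𝓘(ℝ, Euc n) 𝓘(ℝ, V) f (ψ z))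
    (hψ : MDifferentiableAt 𝓘(ℝ, V') 𝓘(ℝ, Euc n) ψ z) (w : V') :
    fderiv ℝ (fun s => f (ψ s)) z w =
      mvfderiv 𝓘(ℝ, Euc n) f (ψ z) (mfderiv 𝓘(ℝ, V') 𝓘(ℝ, Euc n) ψ z w) := by
  rw [(hasFDerivAt_comp_mvfderiv hf hψ).fderiv]; rfl

theorem hasDerivAt_comp_mvfderiv {f : M → V} {γ : ℝ → M} {t : ℝ}
    (hf : MDifferentiableAt 𝓘(ℝ, Euc n) 𝓘(ℝ, V) f (γ t))
    (hγ : MDifferentiableAt 𝓘(ℝ, ℝ) 𝓘(ℝ, Euc n) γ t) :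
    HasDerivAt (fun s => f (γ s))
      (mvfderiv 𝓘(ℝ, Euc n) f (γ t) (mfderiv 𝓘(ℝ, ℝ) 𝓘(ℝ, Euc n) γ t (1 : ℝ))) t :=
  (hasFDerivAt_comp_mvfderiv hf hγ).hasDerivAt

section Smooth

variable [IsManifold 𝓘(ℝ, Euc n) ∞ M]

instance : IsManifold 𝓘(ℝ, Euc n) 1 M := IsManifold.of_le (n := ∞) (by simp)

instance : IsManifold 𝓘(ℝ, Euc n) (minSmoothness ℝ 2) M :=
  IsManifold.of_le (n := ∞) (by simpa using two_le_infty)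

/-- A vector field on `M` is smooth at `x`. -/
abbrev SmoothFieldAt (Y : Π x : M, TangentSpace 𝓘(ℝ, Euc n) x) (x : M) : Prop :=
  ContMDiffAt 𝓘(ℝ, Euc n) 𝓘(ℝ, Euc n).tangent ∞
    (fun x => (⟨x, Y x⟩ : TangentBundle 𝓘(ℝ, Euc n) M)) x

theorem SmoothFieldOn.smoothFieldAt {Y : Π x : M, TangentSpace 𝓘(ℝ, Euc n) x} {W : Set M}
    (hY : SmoothFieldOn Y W) (hW : IsOpen W) {x : M} (hx : x ∈ W) : SmoothFieldAt Y x :=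
  ContMDiffOn.contMDiffAt hY (hW.mem_nhds hx)

/-- The derivative of a smooth function in the direction of a smooth vector field is smooth. -/
theorem contMDiffOn_mvfderiv_apply {f : M → V} {Y : Π x : M, TangentSpace 𝓘(ℝ, Euc n) x}
    {W : Set M} (hW : IsOpen W) (hf : ContMDiffOn 𝓘(ℝ, Euc n) 𝓘(ℝ, V) ∞ f W)
    (hY : SmoothFieldOn Y W) :
    ContMDiffOn 𝓘(ℝ, Euc n) 𝓘(ℝ, V) ∞ (fun y => mvfderiv 𝓘(ℝ, Euc n) f y (Y y)) W := by
  have h1 := hf.contMDiffOn_tangentMapWithin (m := ∞) (by simp) hW.uniqueMDiffOn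
  have h3 := (contMDiff_snd_tangentBundle_modelSpace V 𝓘(ℝ, V) (n := ∞)).comp_contMDiffOn
    (h1.comp hY fun y hy => hy)
  refine h3.congr fun y hy => ?_
  simp only [Function.comp, tangentMapWithin, mfderivWithin_of_isOpen hW hy]
  rfl

/-- The bracket of vector fields is the commutator of the directional derivatives. -/
theorem mvfderiv_mlieBracket {f : M → V} {X Y : Π x : M, TangentSpace 𝓘(ℝ, Euc n) x} {W : Set M}
    (hW : IsOpen W) (hf : ContMDiffOn 𝓘(ℝ, Euc n) 𝓘(ℝ, V) ∞ f W) (hX : SmoothFieldOn X W)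
    (hY : SmoothFieldOn Y W) {x : M} (hx : x ∈ W) :
    mvfderiv 𝓘(ℝ, Euc n) f x (VectorField.mlieBracket 𝓘(ℝ, Euc n) X Y x) =
      mvfderiv 𝓘(ℝ, Euc n) (fun y => mvfderiv 𝓘(ℝ, Euc n) f y (Y y)) x (X x) -
        mvfderiv 𝓘(ℝ, Euc n) (fun y => mvfderiv 𝓘(ℝ, Euc n) f y (X y)) x (Y x) := by
  -- pull back everything to a vector space by the inverse `ψ` of a chart
  set ψ : Euc n → M := fun z => (extChartAt 𝓘(ℝ, Euc n) x).symm z with hψ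
  set z : Euc n := extChartAt 𝓘(ℝ, Euc n) x x with hz
  have hψz : ψ z = x := extChartAt_to_inv x
  have hψs : ∀ᶠ w in 𝓝 z, ContMDiffAt 𝓘(ℝ, Euc n) 𝓘(ℝ, Euc n) ∞ ψ w ∧
      (mfderiv 𝓘(ℝ, Euc n) 𝓘(ℝ, Euc n) ψ w).IsInvertible := by
    have hTo : IsOpen (extChartAt 𝓘(ℝ, Euc n) x).target := isOpen_extChartAt_target x
    filter_upwards [hTo.mem_nhds (mem_extChartAt_target x)] with w hw
    refine ⟨(contMDiffOn_extChartAt_symm x).contMDiffAt (hTo.mem_nhds hw), ?_⟩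
    have := isInvertible_mfderivWithin_extChartAt_symm (I := 𝓘(ℝ, Euc n)) hw
    rw [modelWithCornersSelf_coe, Set.range_id, mfderivWithin_univ] at this
    exact this
  obtain ⟨hψc, hψi⟩ := hψs.self_of_nhds
  have hmd : ∀ {g : M → V}, ContMDiffOn 𝓘(ℝ, Euc n) 𝓘(ℝ, V) ∞ g W → ∀ y ∈ W,
      MDifferentiableAt 𝓘(ℝ, Euc n) 𝓘(ℝ, V) g y := fun hg y hy =>
    (hg.contMDiffAt (hW.mem_nhds hy)).mdifferentiableAt (by simp)
  have hpull : ∀ Z : Π x : M, TangentSpace 𝓘(ℝ, Euc n) x, SmoothFieldOn Z W →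
      DifferentiableAt ℝ (VectorField.mpullback 𝓘(ℝ, Euc n) 𝓘(ℝ, Euc n) ψ Z : Euc n → Euc n) z := by
    intro Z hZ
    have hZ' : ContMDiffAt 𝓘(ℝ, Euc n) 𝓘(ℝ, Euc n).tangent ∞
      (fun x => (⟨x, Z x⟩ : TangentBundle 𝓘(ℝ, Euc n) M)) (ψ z) := by
      rw [hψz]; exact hZ.smoothFieldAt hW hx
    have h1 := ContMDiffAt.mpullback_vectorField_preimage hZ' hψc hψi (by simp)
    exact (contMDiffAt_vectorSpace_iff_contDiffAt.1 h1).differentiableAt (by simp)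
  have hfc : ContDiffAt ℝ ∞ (fun s => f (ψ s)) z := by
    have hf' : ContMDiffAt 𝓘(ℝ, Euc n) 𝓘(ℝ, V) ∞ f (ψ z) := by
      rw [hψz]; exact hf.contMDiffAt (hW.mem_nhds hx)
    exact (hf'.comp z hψc).contDiffAt
  -- the derivative of `f ∘ ψ` along a pulled back field
  have hdir : ∀ Z : Π x : M, TangentSpace 𝓘(ℝ, Euc n) x,
      (fun w => fderiv ℝ (fun s => f (ψ s)) w
        (VectorField.mpullback 𝓘(ℝ, Euc n) 𝓘(ℝ, Euc n) ψ Z w : Euc n)) =ᶠ[𝓝 z]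
      fun w => mvfderiv 𝓘(ℝ, Euc n) f (ψ w) (Z (ψ w)) := by
    intro Z
    have hfe : ∀ᶠ w in 𝓝 z, ψ w ∈ W :=
      hψc.continuousAt.preimage_mem_nhds (by rw [hψz]; exact hW.mem_nhds hx)
    filter_upwards [hψs, hfe] with w hw hfw
    exact (fderiv_comp_mvfderiv (hmd hf _ hfw) (hw.1.mdifferentiableAt (by simp)) _).trans <|
      congrArg (mvfderiv 𝓘(ℝ, Euc n) f (ψ w)) <| hw.2.self_apply_inverse (Z (ψ w))
  have hfund : ∀ (Z : Π x : M, TangentSpace 𝓘(ℝ, Euc n) x),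
      mfderiv 𝓘(ℝ, Euc n) 𝓘(ℝ, Euc n) ψ z
        (VectorField.mpullback 𝓘(ℝ, Euc n) 𝓘(ℝ, Euc n) ψ Z z) = Z (ψ z) := fun Z =>
    hψi.self_apply_inverse (Z (ψ z))
  have hbr := VectorField.mpullback_mlieBracket (I := 𝓘(ℝ, Euc n)) (I' := 𝓘(ℝ, Euc n)) (n := ∞)
    (f := ψ) (V := X) (W := Y) (x₀ := z)
    (by rw [hψz]; exact (hX.smoothFieldAt hW hx).mdifferentiableAt (by simp))
    (by rw [hψz]; exact (hY.smoothFieldAt hW hx).mdifferentiableAt (by simp)) hψc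
    (by simpa using two_le_infty)
  have hfx : MDifferentiableAt 𝓘(ℝ, Euc n) 𝓘(ℝ, V) f (ψ z) := by
    rw [hψz]; exact hmd hf x hx
  have hl : mvfderiv 𝓘(ℝ, Euc n) f (ψ z) (VectorField.mlieBracket 𝓘(ℝ, Euc n) X Y (ψ z)) =
      fderiv ℝ (fun s => f (ψ s)) z (VectorField.lieBracket ℝ
        (VectorField.mpullback 𝓘(ℝ, Euc n) 𝓘(ℝ, Euc n) ψ X : Euc n → Euc n)
        (VectorField.mpullback 𝓘(ℝ, Euc n) 𝓘(ℝ, Euc n) ψ Y : Euc n → Euc n) z) := by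
    have e : VectorField.mlieBracket 𝓘(ℝ, Euc n)
        (VectorField.mpullback 𝓘(ℝ, Euc n) 𝓘(ℝ, Euc n) ψ X)
        (VectorField.mpullback 𝓘(ℝ, Euc n) 𝓘(ℝ, Euc n) ψ Y) z =
        VectorField.lieBracket ℝ
        (VectorField.mpullback 𝓘(ℝ, Euc n) 𝓘(ℝ, Euc n) ψ X : Euc n → Euc n)
        (VectorField.mpullback 𝓘(ℝ, Euc n) 𝓘(ℝ, Euc n) ψ Y : Euc n → Euc n) z := by
      rw [← VectorField.mlieBracketWithin_univ,
        VectorField.mlieBracketWithin_eq_lieBracketWithin]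
      exact congrFun VectorField.lieBracketWithin_univ z
    refine ((fderiv_comp_mvfderiv hfx (hψc.mdifferentiableAt (by simp)) _).trans <|
      congrArg (mvfderiv 𝓘(ℝ, Euc n) f (ψ z)) ?_).symm
    rw [← e]
    exact (congrArg (mfderiv 𝓘(ℝ, Euc n) 𝓘(ℝ, Euc n) ψ z) hbr.symm).trans (hfund _)
  have hr : ∀ Z Z' : Π x : M, TangentSpace 𝓘(ℝ, Euc n) x, SmoothFieldOn Z' W →
      fderiv ℝ (fun w => fderiv ℝ (fun s => f (ψ s)) w
        (VectorField.mpullback 𝓘(ℝ, Euc n) 𝓘(ℝ, Euc n) ψ Z' w : Euc n)) z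
        (VectorField.mpullback 𝓘(ℝ, Euc n) 𝓘(ℝ, Euc n) ψ Z z : Euc n) =
      mvfderiv 𝓘(ℝ, Euc n) (fun y => mvfderiv 𝓘(ℝ, Euc n) f y (Z' y)) (ψ z) (Z (ψ z)) := by
    intro Z Z' hZ'
    rw [(hdir Z').fderiv_eq]
    exact (fderiv_comp_mvfderiv (f := fun y => mvfderiv 𝓘(ℝ, Euc n) f y (Z' y))
      (by rw [hψz]; exact hmd (contMDiffOn_mvfderiv_apply hW hf hZ') x hx)
      (hψc.mdifferentiableAt (by simp)) _).trans <|
      congrArg (mvfderiv 𝓘(ℝ, Euc n) (fun y => mvfderiv 𝓘(ℝ, Euc n) f y (Z' y)) (ψ z)) (hfund Z)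
  replace hl := hl.trans (VectorField.fderiv_apply_lieBracket hfc (by simpa using two_le_infty)
    (hpull Y hY) (hpull X hX))
  rw [hr X Y hY, hr Y X hX] at hl
  rw [hψz] at hl
  exact hl

end Smooth

end ManifoldCalculus

/-! ### Bump functions and cut-off vector fields -/

section Cutoff

variable {n : ℕ} {M : Type*} [TopologicalSpace M] [ChartedSpace (Euc n) M]
  [IsManifold 𝓘(ℝ, Euc n) ∞ M]

theorem exists_smooth_bump [T2Space M] {W : Set M} (hW : IsOpen W) {x : M} (hx : x ∈ W) :
    ∃ χ : M → ℝ, ContMDiff 𝓘(ℝ, Euc n) 𝓘(ℝ, ℝ) ∞ χ ∧ (∀ᶠ y in 𝓝 x, χ y = 1) ∧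
      tsupport χ ⊆ W := by
  obtain ⟨f, -, hf⟩ := (SmoothBumpFunction.nhds_basis_tsupport (I := 𝓘(ℝ, Euc n)) x).mem_iff.1
    (hW.mem_nhds hx)
  exact ⟨f, f.contMDiff, f.eventuallyEq_one, hf⟩

theorem smoothFields_cutoff {W : Set M} (hW : IsOpen W) {χ : M → ℝ}
    (hχ : ContMDiff 𝓘(ℝ, Euc n) 𝓘(ℝ, ℝ) ∞ χ) (hχW : tsupport χ ⊆ W)
    {Y : Π x : M, TangentSpace 𝓘(ℝ, Euc n) x} (hY : SmoothFieldOn Y W) :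
    (fun x => χ x • Y x) ∈ smoothFields n M :=
  (ContMDiffOn.smul_section_of_tsupport (V := TangentSpace 𝓘(ℝ, Euc n) (M := M))
    hχ.contMDiffOn hW hχW hY).contMDiffOn

end Cutoff

/-! ### Coordinate fields of smooth charts -/

/-- A family of linear maps on a finite-dimensional space is smooth if it is smooth pointwise. -/
theorem contMDiffOn_clm_of_apply {E₀ H M : Type*} [NormedAddCommGroup E₀] [NormedSpace ℝ E₀]
    [TopologicalSpace H] {I : ModelWithCorners ℝ E₀ H} [TopologicalSpace M] [ChartedSpace H M]
    {E V : Type*} [NormedAddCommGroup E] [NormedSpace ℝ E] [FiniteDimensional ℝ E]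
    [NormedAddCommGroup V] [NormedSpace ℝ V] {L : M → E →L[ℝ] V} {W : Set M}
    (h : ∀ e, ContMDiffOn I 𝓘(ℝ, V) ∞ (fun y => L y e) W) :
    ContMDiffOn I 𝓘(ℝ, E →L[ℝ] V) ∞ L W := by
  let b := Module.finBasis ℝ E
  have hL : L = fun y => ∑ i, ContinuousLinearMap.smulRightL ℝ E V
      (LinearMap.toContinuousLinearMap (b.coord i)) (L y (b i)) := by
    funext y
    ext e
    have h1 : L y e = ∑ i, b.repr e i • L y (b i) := by
      simp only [← map_smul, ← map_sum, b.sum_repr]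
    simpa using h1
  rw [hL]
  exact contMDiffOn_finsetSum fun i _ =>
    ContMDiffOn.clm_apply (contMDiffOn_const) (h (b i))

namespace RegularFoliation

section CoordinateFields

variable {p q : ℕ} {M : Type*} [TopologicalSpace M] [ChartedSpace (Euc (p + q)) M]
  {φ : OpenPartialHomeomorph M (Euc q × Euc p)}
  {V : Type*} [NormedAddCommGroup V] [NormedSpace ℝ V]

/-- Smooth coordinates on an open subset of `M`. -/
structure IsSmoothChart (φ : OpenPartialHomeomorph M (Euc q × Euc p)) : Prop where
  smooth : ContMDiffOn 𝓘(ℝ, Euc (p + q)) 𝓘(ℝ, Euc q × Euc p) ∞ φ φ.source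
  smooth_symm : ContMDiffOn 𝓘(ℝ, Euc q × Euc p) 𝓘(ℝ, Euc (p + q)) ∞ φ.symm φ.target

theorem IsSmoothChart.mdiff (hφ : IsSmoothChart φ) {y : M} (hy : y ∈ φ.source) :
    MDifferentiableAt 𝓘(ℝ, Euc (p + q)) 𝓘(ℝ, Euc q × Euc p) φ y :=
  (hφ.smooth.contMDiffAt (φ.open_source.mem_nhds hy)).mdifferentiableAt (by simp)

theorem IsSmoothChart.mdiff_symm (hφ : IsSmoothChart φ) {z : Euc q × Euc p} (hz : z ∈ φ.target) :
    MDifferentiableAt 𝓘(ℝ, Euc q × Euc p) 𝓘(ℝ, Euc (p + q)) φ.symm z :=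
  (hφ.smooth_symm.contMDiffAt (φ.open_target.mem_nhds hz)).mdifferentiableAt (by simp)

/-- A coordinate field acts on functions as the partial derivative in the coordinates. -/
theorem IsSmoothChart.mvfderiv_coordField (hφ : IsSmoothChart φ) {g : M → V} {y : M}
    (hy : y ∈ φ.source) (hg : MDifferentiableAt 𝓘(ℝ, Euc (p + q)) 𝓘(ℝ, V) g y)
    (b : Euc q × Euc p) :
    mvfderiv 𝓘(ℝ, Euc (p + q)) g y (coordField φ b y) =
      fderiv ℝ (fun z => g (φ.symm z)) (φ y) b := by
  have h := fderiv_comp_mvfderiv (f := g) (ψ := φ.symm) (z := φ y)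
    (by rw [φ.left_inv hy]; exact hg) (hφ.mdiff_symm (φ.map_source hy)) b
  have e : φ.symm (φ y) = y := φ.left_inv hy
  rw [h]
  unfold coordField
  have key : ∀ w : M, w = y → ∀ v : Euc (p + q), (mvfderiv 𝓘(ℝ, Euc (p + q)) g y :
      Euc (p + q) →L[ℝ] V) v = (mvfderiv 𝓘(ℝ, Euc (p + q)) g w : Euc (p + q) →L[ℝ] V) v := by
    rintro w rfl v; rfl
  exact key _ e _

theorem IsSmoothChart.mvfderiv_self_coordField (hφ : IsSmoothChart φ) {y : M}
    (hy : y ∈ φ.source) (b : Euc q × Euc p) :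
    mvfderiv 𝓘(ℝ, Euc (p + q)) φ y (coordField φ b y) = b := by
  rw [hφ.mvfderiv_coordField hy (hφ.mdiff hy)]
  have : (fun z => φ (φ.symm z)) =ᶠ[𝓝 (φ y)] id := by
    filter_upwards [φ.open_target.mem_nhds (φ.map_source hy)] with z hz using φ.right_inv hz
  rw [this.fderiv_eq, fderiv_id]; rfl

theorem IsSmoothChart.mvfderiv_fst_coordField (hφ : IsSmoothChart φ) {y : M}
    (hy : y ∈ φ.source) (b : Euc q × Euc p) :
    mvfderiv 𝓘(ℝ, Euc (p + q)) (fun z => (φ z).1) y (coordField φ b y) = b.1 := by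
  rw [mvfderiv_fderiv_comp (h := Prod.fst) differentiableAt_fst (hφ.mdiff hy),
    hφ.mvfderiv_self_coordField hy, fderiv_fst]; rfl

theorem IsSmoothChart.injective_mvfderiv (hφ : IsSmoothChart φ) {y : M} (hy : y ∈ φ.source) :
    Function.Injective (mvfderiv 𝓘(ℝ, Euc (p + q)) φ y) := by
  let L : Euc (p + q) →L[ℝ] Euc q × Euc p := mvfderiv 𝓘(ℝ, Euc (p + q)) φ y
  have hs : Function.Surjective L :=
    fun b => ⟨coordField φ b y, hφ.mvfderiv_self_coordField hy b⟩
  have hi : Function.Injective L.toLinearMap :=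
    (LinearMap.injective_iff_surjective_of_finrank_eq_finrank (by simp [add_comm])).2 hs
  exact hi

theorem IsSmoothChart.coordField_mvfderiv (hφ : IsSmoothChart φ) {y : M} (hy : y ∈ φ.source)
    (v : TangentSpace 𝓘(ℝ, Euc (p + q)) y) :
    coordField φ (mvfderiv 𝓘(ℝ, Euc (p + q)) φ y v) y = v :=
  hφ.injective_mvfderiv hy (hφ.mvfderiv_self_coordField hy _)

theorem coordField_add (b c : Euc q × Euc p) (y : M) :
    coordField φ (b + c) y = coordField φ b y + coordField φ c y :=
  map_add (mfderiv 𝓘(ℝ, Euc q × Euc p) 𝓘(ℝ, Euc (p + q)) φ.symm (φ y) : _ →L[ℝ] Euc (p + q)) b c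

theorem coordField_smul (r : ℝ) (b : Euc q × Euc p) (y : M) :
    coordField φ (r • b) y = r • coordField φ b y :=
  map_smul (mfderiv 𝓘(ℝ, Euc q × Euc p) 𝓘(ℝ, Euc (p + q)) φ.symm (φ y) : _ →L[ℝ] Euc (p + q)) r b

/-- A vector field with smooth components is smooth. -/
theorem IsSmoothChart.smoothFieldOn_coordField [IsManifold 𝓘(ℝ, Euc (p + q)) ∞ M]
    (hφ : IsSmoothChart φ) {b : M → Euc q × Euc p}
    (hb : ContMDiffOn 𝓘(ℝ, Euc (p + q)) 𝓘(ℝ, Euc q × Euc p) ∞ b φ.source) :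
    SmoothFieldOn (fun y => coordField φ (b y) y) φ.source := by
  intro y hy
  have hbc : ContMDiffAt 𝓘(ℝ, Euc q × Euc p) 𝓘(ℝ, Euc q × Euc p) ∞
      (fun z => b (φ.symm z)) (φ y) := by
    have h1 := hφ.smooth_symm.contMDiffAt (φ.open_target.mem_nhds (φ.map_source hy))
    have h2 : ContMDiffAt 𝓘(ℝ, Euc (p + q)) 𝓘(ℝ, Euc q × Euc p) ∞ b (φ.symm (φ y)) := by
      rw [φ.left_inv hy]; exact hb.contMDiffAt (φ.open_source.mem_nhds hy)
    exact h2.comp _ h1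
  have hinv : ∀ w ∈ φ.source, (mfderiv 𝓘(ℝ, Euc (p + q)) 𝓘(ℝ, Euc q × Euc p) φ w).IsInvertible := by
    intro w hw
    let e : Euc (p + q) ≃ₗ[ℝ] Euc q × Euc p := LinearEquiv.ofBijective
      (mvfderiv 𝓘(ℝ, Euc (p + q)) φ w : Euc (p + q) →L[ℝ] Euc q × Euc p).toLinearMap
      ⟨hφ.injective_mvfderiv hw, fun b => ⟨coordField φ b w, hφ.mvfderiv_self_coordField hw b⟩⟩
    exact ⟨e.toContinuousLinearEquiv, rfl⟩
  have h := ContMDiffAt.mpullback_vectorField_preimage (n := ∞) (m := ∞) (f := φ)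
    (V := fun z => (b (φ.symm z) : Euc q × Euc p))
    (contMDiffAt_vectorSpace_iff_contDiffAt.2 hbc.contDiffAt)
    (hφ.smooth.contMDiffAt (φ.open_source.mem_nhds hy)) (hinv y hy) (by simp)
  refine (h.congr_of_eventuallyEq ?_).contMDiffWithinAt
  filter_upwards [φ.open_source.mem_nhds hy] with w hw
  congr 1
  apply hφ.injective_mvfderiv hw
  refine (hφ.mvfderiv_self_coordField hw (b w)).trans ?_
  refine Eq.trans ?_ ((hinv w hw).self_apply_inverse (b (φ.symm (φ w)) : Euc q × Euc p)).symm
  rw [φ.left_inv hw]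

end CoordinateFields

/-! ### Transverse charts -/

variable {p q : ℕ} {M : Type*} [TopologicalSpace M] [ChartedSpace (Euc (p + q)) M] {ι : Type*}
  (F : RegularFoliation p q M ι)

/-- A transverse chart: a submersion of the open set `U` onto an open subset of `ℝ^q` whose level
sets are tangent to the foliation. The Haefliger charts are transverse charts, and so are the first
components of foliation coordinates. -/
structure IsTransverseChart (f : M → Euc q) (U : Set M) : Prop where
  isOpen : IsOpen U
  smooth : ContMDiffOn 𝓘(ℝ, Euc (p + q)) 𝓘(ℝ, Euc q) ∞ f U
  surjective : ∀ x ∈ U, Function.Surjective (mvfderiv 𝓘(ℝ, Euc (p + q)) f x)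
  mem_tangent : ∀ x ∈ U, ∀ v, v ∈ F.tangent x ↔ mvfderiv 𝓘(ℝ, Euc (p + q)) f x v = 0

variable {F}

theorem IsTransverseChart.mdiff {f : M → Euc q} {U : Set M} (hf : F.IsTransverseChart f U) {x : M}
    (hx : x ∈ U) : MDifferentiableAt 𝓘(ℝ, Euc (p + q)) 𝓘(ℝ, Euc q) f x :=
  (hf.smooth.contMDiffAt (hf.isOpen.mem_nhds hx)).mdifferentiableAt (by simp)

variable (F)

theorem mdiff_haefliger {α : ι} {x : M} (hx : x ∈ F.U α) :
    MDifferentiableAt 𝓘(ℝ, Euc (p + q)) 𝓘(ℝ, Euc q) (F.f α) x :=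
  ((F.smooth α).contMDiffAt ((F.isOpen_U α).mem_nhds hx)).mdifferentiableAt (by simp)

/-- Two Haefliger charts differ by a local diffeomorphism of `ℝ^q`. -/
theorem exists_transition {α β : ι} {x : M} (hα : x ∈ F.U α) (hβ : x ∈ F.U β) :
    ∃ h : Euc q → Euc q, ContDiffAt ℝ ∞ h (F.f β x) ∧
      F.f α =ᶠ[𝓝 x] fun y => h (F.f β y) := by
  obtain ⟨h, h1, -, h3, h4⟩ := F.transition α β x ⟨hα, hβ⟩
  exact ⟨h, h1.contDiffAt (h.open_source.mem_nhds h3), h4⟩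

/-- One Haefliger chart around a point determines the tangent space of the leaf, because the
derivatives of two charts have the same kernel. -/
theorem isTransverseChart_haefliger (α : ι) : F.IsTransverseChart (F.f α) (F.U α) where
  isOpen := F.isOpen_U α
  smooth := F.smooth α
  surjective := F.submersive α
  mem_tangent := by
    intro x hx v
    have hm : v ∈ F.tangent x ↔
        ∀ β, x ∈ F.U β → mvfderiv 𝓘(ℝ, Euc (p + q)) (F.f β) x v = 0 := by
      simp only [tangent, Submodule.mem_iInf]
      exact Iff.rfl
    rw [hm]
    refine ⟨fun h => h α hx, fun h β hβ => ?_⟩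
    obtain ⟨k, hk, he⟩ := F.exists_transition hβ hx
    rw [mvfderiv_congr he, mvfderiv_fderiv_comp (hk.differentiableAt (by simp))
      (F.mdiff_haefliger hx), h, map_zero]

variable {F}

theorem IsTransverseChart.mono {f : M → Euc q} {U W : Set M} (hf : F.IsTransverseChart f U)
    (hW : IsOpen W) (hWU : W ⊆ U) : F.IsTransverseChart f W where
  isOpen := hW
  smooth := hf.smooth.mono hWU
  surjective := fun x hx => hf.surjective x (hWU hx)
  mem_tangent := fun x hx => hf.mem_tangent x (hWU hx)

/-- Composition of a transverse chart with a linear automorphism of `ℝ^q`. -/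
theorem IsTransverseChart.comp_equiv {f : M → Euc q} {U : Set M} (hf : F.IsTransverseChart f U)
    (A : Euc q ≃L[ℝ] Euc q) : F.IsTransverseChart (fun y => A (f y)) U := by
  have hd : ∀ x ∈ U, ∀ v, mvfderiv 𝓘(ℝ, Euc (p + q)) (fun y => A (f y)) x v =
      A (mvfderiv 𝓘(ℝ, Euc (p + q)) f x v) := fun x hx v => by
    rw [mvfderiv_fderiv_comp A.differentiableAt (hf.mdiff hx), A.fderiv]; rfl
  refine ⟨hf.isOpen, A.contDiff.contMDiff.comp_contMDiffOn hf.smooth, fun x hx w => ?_,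
    fun x hx v => ?_⟩
  · obtain ⟨v, hv⟩ := hf.surjective x hx (A.symm w)
    exact ⟨v, by rw [hd x hx, hv, A.apply_symm_apply]⟩
  · rw [hd x hx, hf.mem_tangent x hx]
    simp

theorem IsFoliationChart.isSmoothChart {φ : OpenPartialHomeomorph M (Euc q × Euc p)}
    (hφ : F.IsFoliationChart φ) : IsSmoothChart φ := ⟨hφ.smooth, hφ.smooth_symm⟩

theorem IsFoliationChart.isTransverseChart {φ : OpenPartialHomeomorph M (Euc q × Euc p)}
    (hφ : F.IsFoliationChart φ) : F.IsTransverseChart (fun y => (φ y).1) φ.source where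
  isOpen := φ.open_source
  smooth := contDiff_fst.contMDiff.comp_contMDiffOn hφ.smooth
  surjective := fun x hx e =>
    ⟨coordField φ (e, 0) x, hφ.isSmoothChart.mvfderiv_fst_coordField hx _⟩
  mem_tangent := fun x hx v => by rw [hφ.tangent_eq x hx]; exact Iff.rfl

theorem IsFoliationChart.coordField_mem_tangent {φ : OpenPartialHomeomorph M (Euc q × Euc p)}
    (hφ : F.IsFoliationChart φ) {y : M} (hy : y ∈ φ.source) (k : Euc p) :
    coordField φ (0, k) y ∈ F.tangent y := by
  rw [hφ.isTransverseChart.mem_tangent y hy, hφ.isSmoothChart.mvfderiv_fst_coordField hy]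

/-- A surjective linear map is the first component of a linear isomorphism. -/
theorem exists_clm_complement (L : Euc (p + q) →L[ℝ] Euc q) (hL : Function.Surjective L) :
    ∃ (π : Euc (p + q) →L[ℝ] Euc p) (e : Euc (p + q) ≃L[ℝ] Euc q × Euc p),
      (e : Euc (p + q) →L[ℝ] Euc q × Euc p) = L.prod π := by
  let K := L.toLinearMap.ker
  obtain ⟨r, hr⟩ := K.subtype.exists_leftInverse_of_injective K.ker_subtype
  have hK : Module.finrank ℝ K = Module.finrank ℝ (Euc p) := by
    have h1 := L.toLinearMap.finrank_range_add_finrank_ker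
    rw [LinearMap.range_eq_top.2 hL, finrank_top] at h1
    simp only [finrank_euclideanSpace, Fintype.card_fin] at h1 ⊢
    change q + Module.finrank ℝ K = p + q at h1
    omega
  let k : K ≃ₗ[ℝ] Euc p := LinearEquiv.ofFinrankEq _ _ hK
  let π : Euc (p + q) →L[ℝ] Euc p := LinearMap.toContinuousLinearMap (k.toLinearMap ∘ₗ r)
  have hinj : Function.Injective (L.prod π).toLinearMap := by
    rw [← LinearMap.ker_eq_bot, Submodule.eq_bot_iff]
    intro v hv
    have hv' : (L v, k (r v)) = (0, 0) := hv
    obtain ⟨h1, h2⟩ := Prod.ext_iff.1 hv'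
    have h3 : r v = 0 := by simpa using h2
    have h4 : r (K.subtype ⟨v, h1⟩) = ⟨v, h1⟩ := LinearMap.congr_fun hr _
    have h5 : (⟨v, h1⟩ : K) = 0 := h4.symm.trans h3
    exact congrArg Subtype.val h5
  refine ⟨π, (LinearEquiv.ofInjectiveOfFinrankEq (L.prod π).toLinearMap hinj
    (by simp [add_comm])).toContinuousLinearEquiv, ?_⟩
  ext v <;> rfl

end RegularFoliation

/-! ### Existence of foliation coordinates -/

/-- The inverse function theorem, with smoothness of the inverse on a whole neighbourhood. -/
theorem exists_smooth_localInverse {E E' : Type*} [NormedAddCommGroup E] [NormedSpace ℝ E]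
    [CompleteSpace E] [NormedAddCommGroup E'] [NormedSpace ℝ E'] {g : E → E'} {N : Set E}
    (hN : IsOpen N) (hg : ContDiffOn ℝ ∞ g N) {a : E} (ha : a ∈ N) {e : E ≃L[ℝ] E'}
    (he : HasFDerivAt g (e : E →L[ℝ] E') a) :
    ∃ Ψ : OpenPartialHomeomorph E E', ⇑Ψ = g ∧ a ∈ Ψ.source ∧ Ψ.source ⊆ N ∧
      ContDiffOn ℝ ∞ Ψ.symm Ψ.target ∧
      ∀ z ∈ Ψ.source, ∃ e' : E ≃L[ℝ] E', HasFDerivAt g (e' : E →L[ℝ] E') z := by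
  have hga : ContDiffAt ℝ ∞ g a := hg.contDiffAt (hN.mem_nhds ha)
  let Ψ₀ := hga.toOpenPartialHomeomorph g he (by simp)
  let N' := N ∩ fderiv ℝ g ⁻¹' (Set.range ((↑) : (E ≃L[ℝ] E') → E →L[ℝ] E'))
  have hN' : IsOpen N' := (hg.continuousOn_fderiv_of_isOpen hN (by simp)).isOpen_inter_preimage hN
    ContinuousLinearEquiv.isOpen
  have hd : ∀ z ∈ N', ∃ e' : E ≃L[ℝ] E', HasFDerivAt g (e' : E →L[ℝ] E') z := by
    rintro z ⟨hz, e', h'⟩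
    refine ⟨e', ?_⟩
    rw [h']
    exact ((hg.contDiffAt (hN.mem_nhds hz)).differentiableAt (by simp)).hasFDerivAt
  have hs : (Ψ₀.restrOpen N' hN').source = Ψ₀.source ∩ N' := Ψ₀.restrOpen_source N' hN'
  refine ⟨Ψ₀.restrOpen N' hN', rfl, ?_, ?_, ?_, ?_⟩
  · rw [hs]
    exact ⟨hga.mem_toOpenPartialHomeomorph_source he (by simp), ha, ⟨e, he.fderiv.symm⟩⟩
  · rw [hs]; exact fun z hz => hz.2.1
  · intro y hy
    have hy' := (Ψ₀.restrOpen N' hN').map_target hy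
    rw [hs] at hy'
    obtain ⟨e', he'⟩ := hd _ hy'.2
    exact ((Ψ₀.restrOpen N' hN').contDiffAt_symm hy he'
      (hg.contDiffAt (hN.mem_nhds hy'.2.1))).contDiffWithinAt
  · rw [hs]; exact fun z hz => hd z hz.2

namespace RegularFoliation

variable {p q : ℕ} {M : Type*} [TopologicalSpace M] [ChartedSpace (Euc (p + q)) M] {ι : Type*}
  {F : RegularFoliation p q M ι}

/-- A transverse chart is locally the transverse part of foliation coordinates. -/
theorem IsTransverseChart.exists_isFoliationChart [IsManifold 𝓘(ℝ, Euc (p + q)) ∞ M]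
    {f : M → Euc q} {U : Set M} (hf : F.IsTransverseChart f U) {x : M} (hx : x ∈ U) :
    ∃ φ : OpenPartialHomeomorph M (Euc q × Euc p), F.IsFoliationChart φ ∧ x ∈ φ.source ∧
      φ.source ⊆ U ∧ ∀ y ∈ φ.source, (φ y).1 = f y := by
  let c := chartAt (Euc (p + q)) x
  have hxc : x ∈ c.source := mem_chart_source _ x
  let N := c.target ∩ c.symm ⁻¹' U
  have hN : IsOpen N := c.isOpen_inter_preimage_symm hf.isOpen
  have haN : c x ∈ N := ⟨c.map_source hxc, by
    rw [Set.mem_preimage, c.left_inv hxc]; exact hx⟩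
  let f' : Euc (p + q) → Euc q := fun z => f (c.symm z)
  have hf' : ContDiffOn ℝ ∞ f' N := by
    have h1 : ContMDiffOn 𝓘(ℝ, Euc (p + q)) 𝓘(ℝ, Euc (p + q)) ∞ c.symm N :=
      (contMDiffOn_chart_symm (x := x)).mono Set.inter_subset_left
    exact (hf.smooth.comp h1 fun z hz => hz.2).contDiffOn
  have hda : DifferentiableAt ℝ f' (c x) :=
    (hf'.contDiffAt (hN.mem_nhds haN)).differentiableAt (by simp)
  have hcd : MDifferentiableAt 𝓘(ℝ, Euc (p + q)) 𝓘(ℝ, Euc (p + q)) c x :=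
    ((contMDiffOn_chart (n := ∞) (x := x)).contMDiffAt (c.open_source.mem_nhds hxc)).mdifferentiableAt
      (by simp)
  have hsurj : Function.Surjective (fderiv ℝ f' (c x)) := by
    intro e
    obtain ⟨v, hv⟩ := hf.surjective x hx e
    refine ⟨mvfderiv 𝓘(ℝ, Euc (p + q)) c x v, ?_⟩
    rw [← mvfderiv_fderiv_comp hda hcd, ← hv]
    have : (fun y => f' (c y)) =ᶠ[𝓝 x] f := by
      filter_upwards [c.open_source.mem_nhds hxc] with y hy
      exact congrArg f (c.left_inv hy)
    rw [mvfderiv_congr this]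
  obtain ⟨π, e, he⟩ := exists_clm_complement _ hsurj
  let g : Euc (p + q) → Euc q × Euc p := fun z => (f' z, π z)
  have hg : ContDiffOn ℝ ∞ g N := hf'.prodMk π.contDiff.contDiffOn
  have hge : HasFDerivAt g (e : Euc (p + q) →L[ℝ] Euc q × Euc p) (c x) := by
    rw [he]; exact hda.hasFDerivAt.prodMk π.hasFDerivAt
  obtain ⟨Ψ, hΨg, haΨ, hΨN, hΨs, -⟩ := exists_smooth_localInverse hN hg haN hge
  let φ := c.trans Ψ
  have hsrc : φ.source = c.source ∩ c ⁻¹' Ψ.source := c.trans_source Ψ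
  have hfst : ∀ y ∈ φ.source, (φ y).1 = f y := by
    intro y hy
    rw [hsrc] at hy
    change (Ψ (c y)).1 = f y
    rw [hΨg]
    exact congrArg f (c.left_inv hy.1)
  have hsU : φ.source ⊆ U := by
    intro y hy
    rw [hsrc] at hy
    have := (hΨN hy.2).2
    rwa [Set.mem_preimage, c.left_inv hy.1] at this
  refine ⟨φ, ⟨?_, ?_, fun y hy => ?_⟩, ?_, hsU, hfst⟩
  · have h1 : ContMDiffOn 𝓘(ℝ, Euc (p + q)) 𝓘(ℝ, Euc (p + q)) ∞ c φ.source :=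
      (contMDiffOn_chart (x := x)).mono (by rw [hsrc]; exact Set.inter_subset_left)
    have h2 : ContDiffOn ℝ ∞ Ψ Ψ.source := by rw [hΨg]; exact hg.mono hΨN
    exact h2.contMDiffOn.comp h1 fun y hy => by rw [hsrc] at hy; exact hy.2
  · have ht : φ.target = Ψ.target ∩ Ψ.symm ⁻¹' c.target := c.trans_target Ψ
    have h1 : ContMDiffOn 𝓘(ℝ, Euc (p + q)) 𝓘(ℝ, Euc (p + q)) ∞ c.symm c.target :=
      contMDiffOn_chart_symm (x := x)
    refine h1.comp (hΨs.contMDiffOn.mono ?_) fun z hz => ?_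
    · rw [ht]; exact Set.inter_subset_left
    · rw [ht] at hz; exact hz.2
  · ext v
    rw [hf.mem_tangent y (hsU hy)]
    have : (fun z => (φ z).1) =ᶠ[𝓝 y] f := by
      filter_upwards [φ.open_source.mem_nhds hy] with z hz using hfst z hz
    rw [← mvfderiv_congr this]
    exact Iff.rfl
  · rw [hsrc]; exact ⟨hxc, haΨ⟩

/-! ### Sections of the normal bundle in a transverse chart -/

variable (F) in
open Classical in
/-- The map `ν_x → ℝ^q` induced by the derivative at `x` of a transverse chart `f` around `x`.
The value is zero if the derivative does not vanish on the tangent space of the leaf. -/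
def normalDeriv (f : M → Euc q) (x : M) : F.Normal x →ₗ[ℝ] Euc q :=
  if h : F.tangent x ≤ (mvfderiv 𝓘(ℝ, Euc (p + q)) f x).toLinearMap.ker then
    (F.tangent x).liftQ _ h else 0

section NormalDeriv

variable {f : M → Euc q} {U : Set M} {x : M}

theorem IsTransverseChart.normalDeriv_proj (hf : F.IsTransverseChart f U) (hx : x ∈ U)
    (v : TangentSpace 𝓘(ℝ, Euc (p + q)) x) :
    F.normalDeriv f x (F.proj x v) = mvfderiv 𝓘(ℝ, Euc (p + q)) f x v := by
  have h : F.tangent x ≤ (mvfderiv 𝓘(ℝ, Euc (p + q)) f x).toLinearMap.ker := fun w hw =>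
    (hf.mem_tangent x hx w).1 hw
  rw [normalDeriv, dif_pos h]
  exact (F.tangent x).liftQ_apply _ _

theorem proj_surjective (x : M) : Function.Surjective (F.proj x) := (F.tangent x).mkQ_surjective

theorem IsTransverseChart.normalDeriv_injective (hf : F.IsTransverseChart f U) (hx : x ∈ U) :
    Function.Injective (F.normalDeriv f x) := by
  refine (injective_iff_map_eq_zero _).2 fun s hs => ?_
  obtain ⟨v, rfl⟩ := proj_surjective x s
  rw [hf.normalDeriv_proj hx, ← hf.mem_tangent x hx] at hs
  exact (Submodule.Quotient.mk_eq_zero _).2 hs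

theorem IsTransverseChart.normalDeriv_surjective (hf : F.IsTransverseChart f U) (hx : x ∈ U) :
    Function.Surjective (F.normalDeriv f x) := fun e => by
  obtain ⟨v, hv⟩ := hf.surjective x hx e
  exact ⟨F.proj x v, by rw [hf.normalDeriv_proj hx, hv]⟩

theorem IsTransverseChart.proj_eq_iff (hf : F.IsTransverseChart f U) (hx : x ∈ U)
    {v : TangentSpace 𝓘(ℝ, Euc (p + q)) x} {s : F.Normal x} :
    s = F.proj x v ↔ F.normalDeriv f x s = mvfderiv 𝓘(ℝ, Euc (p + q)) f x v := by
  rw [← hf.normalDeriv_proj hx]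
  exact ⟨fun h => h ▸ rfl, fun h => hf.normalDeriv_injective hx h⟩

variable {g : M → Euc q} {U' : Set M} {h : Euc q → Euc q}

theorem eventually_mvfderiv_transition (hg : F.IsTransverseChart g U') (hx' : x ∈ U')
    (hh : ContDiffAt ℝ ∞ h (g x)) (he : f =ᶠ[𝓝 x] fun y => h (g y)) :
    ∀ᶠ y in 𝓝 x, ∀ w : TangentSpace 𝓘(ℝ, Euc (p + q)) y,
      mvfderiv 𝓘(ℝ, Euc (p + q)) f y w =
        fderiv ℝ h (g y) (mvfderiv 𝓘(ℝ, Euc (p + q)) g y w) := by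
  have hhd : ∀ᶠ y in 𝓝 x, DifferentiableAt ℝ h (g y) := by
    refine (hg.mdiff hx').continuousAt.eventually ?_
    filter_upwards [(hh.of_le (m := 1) (by simp)).eventually (by simp)] with z hz
    exact hz.differentiableAt (by simp)
  filter_upwards [he.eventuallyEq_nhds, hhd, hg.isOpen.mem_nhds hx'] with y hy hyd hyU w
  rw [mvfderiv_congr hy, mvfderiv_fderiv_comp hyd (hg.mdiff hyU)]

theorem eventually_normalDeriv_transition (hf : F.IsTransverseChart f U)
    (hg : F.IsTransverseChart g U') (hx : x ∈ U) (hx' : x ∈ U')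
    (hh : ContDiffAt ℝ ∞ h (g x)) (he : f =ᶠ[𝓝 x] fun y => h (g y)) :
    ∀ᶠ y in 𝓝 x, ∀ t : F.Normal y,
      F.normalDeriv f y t = fderiv ℝ h (g y) (F.normalDeriv g y t) := by
  filter_upwards [eventually_mvfderiv_transition hg hx' hh he, hf.isOpen.mem_nhds hx,
    hg.isOpen.mem_nhds hx'] with y hy hyU hyU' t
  obtain ⟨w, rfl⟩ := proj_surjective y t
  rw [hf.normalDeriv_proj hyU, hg.normalDeriv_proj hyU', hy]

variable [IsManifold 𝓘(ℝ, Euc (p + q)) ∞ M]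

/-- In a transverse chart, a smooth section of `ν` is a smooth function with values in `ℝ^q`. -/
theorem IsTransverseChart.smooth_section (hf : F.IsTransverseChart f U) (s : F.normalSections) :
    ContMDiffOn 𝓘(ℝ, Euc (p + q)) 𝓘(ℝ, Euc q) ∞ (fun y => F.normalDeriv f y (s.1 y)) U := by
  intro x hx
  obtain ⟨W, hW, hxW, Y, hY, h⟩ := s.2 x
  have hWU := hW.inter hf.isOpen
  have h1 := contMDiffOn_mvfderiv_apply hWU (hf.smooth.mono Set.inter_subset_right)
    (ContMDiffOn.mono hY Set.inter_subset_left)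
  refine ((h1.congr fun y hy => ?_).contMDiffAt (hWU.mem_nhds ⟨hxW, hx⟩)).contMDiffWithinAt
  rw [h y hy.1, hf.normalDeriv_proj hy.2]

theorem IsTransverseChart.mdiff_section (hf : F.IsTransverseChart f U) (s : F.normalSections)
    (hx : x ∈ U) : MDifferentiableAt 𝓘(ℝ, Euc (p + q)) 𝓘(ℝ, Euc q)
      (fun y => F.normalDeriv f y (s.1 y)) x :=
  ((hf.smooth_section s).contMDiffAt (hf.isOpen.mem_nhds hx)).mdifferentiableAt (by simp)

/-- A section of `ν` is smooth if it is a smooth function in some transverse chart around every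
point. -/
theorem mem_normalSections_of_smooth (s : Π x, F.Normal x)
    (h : ∀ x, ∃ (f : M → Euc q) (U : Set M), F.IsTransverseChart f U ∧ x ∈ U ∧
      ContMDiffOn 𝓘(ℝ, Euc (p + q)) 𝓘(ℝ, Euc q) ∞ (fun y => F.normalDeriv f y (s y)) U) :
    s ∈ F.normalSections := by
  intro x
  obtain ⟨f, U, hf, hx, hs⟩ := h x
  obtain ⟨φ, hφ, hxφ, hφU, hφf⟩ := hf.exists_isFoliationChart hx
  refine ⟨φ.source, φ.open_source, hxφ,
    fun y => coordField φ (F.normalDeriv f y (s y), 0) y, ?_, fun y hy => ?_⟩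
  · exact hφ.isSmoothChart.smoothFieldOn_coordField
      ((contDiff_id.prodMk contDiff_const).contMDiff.comp_contMDiffOn (hs.mono hφU))
  · have h1 : (fun z => (φ z).1) =ᶠ[𝓝 y] f := by
      filter_upwards [φ.open_source.mem_nhds hy] with z hz using hφf z hz
    have h2 := hφ.isSmoothChart.mvfderiv_fst_coordField hy (F.normalDeriv f y (s y), 0)
    rw [mvfderiv_congr h1] at h2
    exact (hf.proj_eq_iff (hφU hy)).2 h2.symm

theorem normalSections_smul {g : M → ℝ} (hg : ContMDiff 𝓘(ℝ, Euc (p + q)) 𝓘(ℝ, ℝ) ∞ g)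
    {s : Π x, F.Normal x} (hs : s ∈ F.normalSections) :
    (fun x => g x • s x) ∈ F.normalSections := by
  refine mem_normalSections_of_smooth _ fun x => ?_
  obtain ⟨α, hα⟩ := F.cover x
  refine ⟨_, _, F.isTransverseChart_haefliger α, hα, ?_⟩
  simp only [map_smul]
  exact hg.contMDiffOn.smul ((F.isTransverseChart_haefliger α).smooth_section ⟨s, hs⟩)

theorem tangentSections_smul {g : M → ℝ} (hg : ContMDiff 𝓘(ℝ, Euc (p + q)) 𝓘(ℝ, ℝ) ∞ g)
    {s : Π x, F.tangent x} (hs : s ∈ F.tangentSections) :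
    (fun x => g x • s x) ∈ F.tangentSections :=
  ContMDiffOn.smul_section (V := TangentSpace 𝓘(ℝ, Euc (p + q)) (M := M)) hg.contMDiffOn hs

/-- Around a point of the domain of foliation coordinates, the coordinate fields extend to global
smooth vector fields, linearly in their components; the extensions of the leafwise coordinate fields
are leafwise. -/
theorem IsFoliationChart.exists_extension [T2Space M] {φ : OpenPartialHomeomorph M (Euc q × Euc p)}
    (hφ : F.IsFoliationChart φ) (hx : x ∈ φ.source) :
    ∃ (Y : (Euc q × Euc p) →ₗ[ℝ] smoothFields (p + q) M) (N : Set M), IsOpen N ∧ x ∈ N ∧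
      N ⊆ φ.source ∧ (∀ y ∈ N, ∀ b, (Y b).1 y = coordField φ b y) ∧
      ∀ k y, (Y (0, k)).1 y ∈ F.tangent y := by
  obtain ⟨χ, hχ, h1, hs⟩ := exists_smooth_bump (n := p + q) φ.open_source hx
  obtain ⟨N, hN, hNo, hxN⟩ := mem_nhds_iff.1 (h1.and (φ.open_source.mem_nhds hx))
  refine ⟨{ toFun := fun b => ⟨_, smoothFields_cutoff φ.open_source hχ hs
              (hφ.isSmoothChart.smoothFieldOn_coordField (b := fun _ => b) contMDiffOn_const)⟩
            map_add' := fun b c => ?_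
            map_smul' := fun r b => ?_ }, N, hNo, hxN, fun y hy => (hN hy).2, ?_, ?_⟩
  · ext y : 2
    simp [coordField_add]
  · ext y : 2
    change χ y • coordField φ (r • b) y = r • χ y • coordField φ b y
    rw [coordField_smul, smul_comm]
  · intro y hy b
    simp [(hN hy).1]
  · intro k y
    by_cases hy : y ∈ φ.source
    · exact (F.tangent y).smul_mem _ (hφ.coordField_mem_tangent hy k)
    · have : χ y = 0 := image_eq_zero_of_notMem_tsupport fun h => hy (hs h)
      simp [this]

end NormalDeriv

end RegularFoliation

theorem sum_smul_single {q : ℕ} (e : Euc q) :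
    ∑ i, e i • (EuclideanSpace.single i (1 : ℝ) : Euc q) = e := by
  ext j
  simp [Finset.sum_apply, Pi.single_apply]

/-! ### Locality and linearity of connections -/

namespace KoszulConnection

variable {n : ℕ} {M : Type*} [TopologicalSpace M] [ChartedSpace (Euc n) M]
  [IsManifold 𝓘(ℝ, Euc n) ∞ M] {B : M → Type*} [∀ x, AddCommGroup (B x)] [∀ x, Module ℝ (B x)]
  {Γ : Submodule ℝ (Π x, B x)} (D : KoszulConnection (n := n) Γ)

theorem map_smul_const (c : ℝ) (s : Γ) (x : M) : D.toFun (c • s) x = c • D.toFun s x := by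
  ext v
  have h := D.leibniz (fun _ => c) contMDiff_const s (c • s) (fun _ => rfl) x v
  rw [mvfderiv_const] at h
  simpa using h

/-- The covariant derivative `s ↦ ∇ s (x)` as a linear map on the smooth sections. -/
def derivAt (x : M) : Γ →ₗ[ℝ] TangentSpace 𝓘(ℝ, Euc n) x →ₗ[ℝ] B x where
  toFun s := D.toFun s x
  map_add' s s' := D.map_add s s' x
  map_smul' c s := D.map_smul_const c s x

/-- A connection is a local operator. -/
theorem congr_germ [T2Space M]
    (hΓ : ∀ g : M → ℝ, ContMDiff 𝓘(ℝ, Euc n) 𝓘(ℝ, ℝ) ∞ g → ∀ s ∈ Γ, (fun x => g x • s x) ∈ Γ)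
    {s s' : Γ} {x : M} (h : ∀ᶠ y in 𝓝 x, s.1 y = s'.1 y) : D.toFun s x = D.toFun s' x := by
  obtain ⟨W, hW, hWo, hxW⟩ := mem_nhds_iff.1 h
  obtain ⟨χ, hχ, h1, hs⟩ := exists_smooth_bump (n := n) hWo hxW
  -- cutting off a section by `χ`, which is `1` near `x`, does not change its derivative at `x`
  have hd : mvfderiv 𝓘(ℝ, Euc n) χ x = 0 := by
    rw [mvfderiv_congr (g := fun _ => (1 : ℝ)) h1, mvfderiv_const]
  have key : ∀ (t t' : Γ), (∀ y, t'.1 y = χ y • t.1 y) → D.toFun t' x = D.toFun t x := by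
    intro t t' ht
    ext v
    rw [D.leibniz χ hχ t t' ht x v, h1.self_of_nhds, hd]
    simp
  rw [← key s ⟨_, hΓ χ hχ s.1 s.2⟩ fun _ => rfl]
  refine key s' _ fun y => ?_
  by_cases hy : y ∈ W
  · exact congrArg (χ y • ·) (hW hy)
  · have : χ y = 0 := image_eq_zero_of_notMem_tsupport fun h => hy (hs h)
    simp [this]

end KoszulConnection

/-! ### Christoffel symbols of a torsion-free Bott connection -/

namespace RegularFoliation

variable {p q : ℕ} {M : Type*} [TopologicalSpace M] [ChartedSpace (Euc (p + q)) M]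
  [IsManifold 𝓘(ℝ, Euc (p + q)) ∞ M] {ι : Type*} {F : RegularFoliation p q M ι}

/-- `Γ` are the Christoffel symbols at `x` of the connection `D` on `ν`, in the trivialization of
`ν` by the transverse chart `f`: if `S` is the function representing the section `s`, then `∇_v s`
is represented by `dS(v) + Γ(df(v), S)`. -/
def HasChristoffelAt (D : F.NormalConnection) (f : M → Euc q) (x : M)
    (Γ : Euc q →L[ℝ] Euc q →L[ℝ] Euc q) : Prop :=
  ∀ (s : F.normalSections) (v : TangentSpace 𝓘(ℝ, Euc (p + q)) x),
    F.normalDeriv f x (D.toFun s x v) =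
      mvfderiv 𝓘(ℝ, Euc (p + q)) (fun y => F.normalDeriv f y (s.1 y)) x v +
        Γ (mvfderiv 𝓘(ℝ, Euc (p + q)) f x v) (F.normalDeriv f x (s.1 x))

/-- The derivative of a bracket in the direction of a transverse chart. -/
theorem IsTransverseChart.normalDeriv_mlieBracket {f : M → Euc q} {U : Set M} {x : M}
    (hf : F.IsTransverseChart f U) (hx : x ∈ U)
    (X Y : smoothFields (p + q) M) :
    F.normalDeriv f x (F.proj x (VectorField.mlieBracket 𝓘(ℝ, Euc (p + q)) X.1 Y.1 x)) =
      mvfderiv 𝓘(ℝ, Euc (p + q)) (fun y => mvfderiv 𝓘(ℝ, Euc (p + q)) f y (Y.1 y)) x (X.1 x) -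
      mvfderiv 𝓘(ℝ, Euc (p + q)) (fun y => mvfderiv 𝓘(ℝ, Euc (p + q)) f y (X.1 y)) x (Y.1 x) := by
  rw [hf.normalDeriv_proj hx]
  exact mvfderiv_mlieBracket hf.isOpen hf.smooth (ContMDiffOn.mono X.2 (Set.subset_univ _))
    (ContMDiffOn.mono Y.2 (Set.subset_univ _)) hx

theorem IsTransverseChart.normalDeriv_projSection {f : M → Euc q} {U : Set M} {x : M}
    (hf : F.IsTransverseChart f U) (hx : x ∈ U)
    (Y : smoothFields (p + q) M) :
    (fun y => F.normalDeriv f y ((F.projSection Y).1 y)) =ᶠ[𝓝 x]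
      fun y => mvfderiv 𝓘(ℝ, Euc (p + q)) f y (Y.1 y) := by
  filter_upwards [hf.isOpen.mem_nhds hx] with y hy using hf.normalDeriv_proj hy _

/-- Christoffel symbols in terms of vector fields with constant transverse components. -/
theorem HasChristoffelAt.apply_lift {f : M → Euc q} {U : Set M} {x : M} {D : F.NormalConnection}
    {Γ : Euc q →L[ℝ] Euc q →L[ℝ] Euc q}
    (h : HasChristoffelAt D f x Γ) (hf : F.IsTransverseChart f U) (hx : x ∈ U) {e e' : Euc q}
    {Y Y' : smoothFields (p + q) M}
    (hY : mvfderiv 𝓘(ℝ, Euc (p + q)) f x (Y.1 x) = e)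
    (hY' : ∀ᶠ y in 𝓝 x, mvfderiv 𝓘(ℝ, Euc (p + q)) f y (Y'.1 y) = e') :
    Γ e e' = F.normalDeriv f x (D.toFun (F.projSection Y') x (Y.1 x)) := by
  have h2 : (fun z => F.normalDeriv f z ((F.projSection Y').1 z)) =ᶠ[𝓝 x] fun _ => e' := by
    filter_upwards [hf.normalDeriv_projSection hx Y', hY'] with z hz hzN
    rw [hz, hzN]
  have h3 := h (F.projSection Y') (Y.1 x)
  have h4 : F.normalDeriv f x ((F.projSection Y').1 x) = e' := h2.self_of_nhds
  rw [mvfderiv_congr h2, mvfderiv_const, h4, hY] at h3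
  exact (h3.trans (zero_add _)).symm

section

variable {f g : M → Euc q} {U U' : Set M} {x : M} {h : Euc q → Euc q}

theorem mvfderiv_section_transition (hf : F.IsTransverseChart f U)
    (hg : F.IsTransverseChart g U') (hx : x ∈ U) (hx' : x ∈ U')
    (hh : ContDiffAt ℝ ∞ h (g x)) (he : f =ᶠ[𝓝 x] fun y => h (g y)) (s : F.normalSections)
    (v : TangentSpace 𝓘(ℝ, Euc (p + q)) x) :
    mvfderiv 𝓘(ℝ, Euc (p + q)) (fun y => F.normalDeriv f y (s.1 y)) x v =
      fderiv ℝ (fderiv ℝ h) (g x) (mvfderiv 𝓘(ℝ, Euc (p + q)) g x v)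
          (F.normalDeriv g x (s.1 x)) +
        fderiv ℝ h (g x)
          (mvfderiv 𝓘(ℝ, Euc (p + q)) (fun y => F.normalDeriv g y (s.1 y)) x v) := by
  have hS : (fun y => F.normalDeriv f y (s.1 y)) =ᶠ[𝓝 x]
      fun y => fderiv ℝ h (g y) (F.normalDeriv g y (s.1 y)) := by
    filter_upwards [eventually_normalDeriv_transition hf hg hx hx' hh he] with y hy using hy _
  have hh2 : DifferentiableAt ℝ (fderiv ℝ h) (g x) :=
    (hh.fderiv_right (m := 1) (by rw [one_add_one_eq_two]; exact two_le_infty)).differentiableAt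
      (by simp)
  have hLd : MDifferentiableAt 𝓘(ℝ, Euc (p + q)) 𝓘(ℝ, Euc q →L[ℝ] Euc q)
      (fun y => fderiv ℝ h (g y)) x :=
    (hh2.hasFDerivAt.hasMFDerivAt.comp x
      (hg.mdiff hx').hasMFDerivAt_mvfderiv).mdifferentiableAt
  rw [mvfderiv_congr hS, mvfderiv_clm_apply hLd (hg.mdiff_section s hx'),
    mvfderiv_fderiv_comp hh2 (hg.mdiff hx')]

end

variable [T2Space M]

theorem NormalConnection.congr_germ (D : F.NormalConnection) {s s' : F.normalSections} {x : M}
    (h : ∀ᶠ y in 𝓝 x, s.1 y = s'.1 y) : D.toFun s x = D.toFun s' x :=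
  KoszulConnection.congr_germ D (fun _ hg _ hs => normalSections_smul hg hs) h

theorem TangentialConnection.congr_germ (D : F.TangentialConnection) {s s' : F.tangentSections}
    {x : M} (h : ∀ᶠ y in 𝓝 x, s.1 y = s'.1 y) : D.toFun s x = D.toFun s' x :=
  KoszulConnection.congr_germ D (fun _ hg _ hs => tangentSections_smul hg hs) h

/-- The coordinate fields `∂/∂x^i` of foliation coordinates whose transverse part is the transverse
chart `f`, extended to global vector fields. -/
theorem IsTransverseChart.exists_lift {f : M → Euc q} {U : Set M} (hf : F.IsTransverseChart f U)
    {x : M} (hx : x ∈ U) :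
    ∃ (Y : (Euc q × Euc p) →ₗ[ℝ] smoothFields (p + q) M) (N : Set M), IsOpen N ∧ x ∈ N ∧ N ⊆ U ∧
      (∀ y ∈ N, ∀ b, mvfderiv 𝓘(ℝ, Euc (p + q)) f y ((Y b).1 y) = b.1) ∧
      (∀ k y, (Y (0, k)).1 y ∈ F.tangent y) ∧ ∀ y ∈ N, ∀ v, ∃ b, (Y b).1 y = v := by
  obtain ⟨φ, hφ, hxφ, hφU, hφf⟩ := hf.exists_isFoliationChart hx
  obtain ⟨Y, N, hN, hxN, hNφ, hY, hYt⟩ := hφ.exists_extension hxφ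
  refine ⟨Y, N, hN, hxN, hNφ.trans hφU, fun y hy b => ?_, hYt, fun y hy v =>
    ⟨mvfderiv 𝓘(ℝ, Euc (p + q)) φ y v, ?_⟩⟩
  · have : (fun z => (φ z).1) =ᶠ[𝓝 y] f := by
      filter_upwards [φ.open_source.mem_nhds (hNφ hy)] with z hz using hφf z hz
    rw [hY y hy, ← mvfderiv_congr this, hφ.isSmoothChart.mvfderiv_fst_coordField (hNφ hy)]
  · rw [hY y hy, hφ.isSmoothChart.coordField_mvfderiv (hNφ hy)]

section

variable {f : M → Euc q} {U : Set M} {x : M}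

/-- A section `s` of `ν` is, near `x`, the combination of the basic sections `p ∂/∂x^i` whose
coefficients are the components of `s` in the transverse chart. -/
theorem IsTransverseChart.toFun_eq_sum (hf : F.IsTransverseChart f U) (D : F.NormalConnection)
    {N : Set M} (hN : IsOpen N) (hxN : x ∈ N) (hNU : N ⊆ U) (Y : Euc q → smoothFields (p + q) M)
    (hY : ∀ y ∈ N, ∀ e, mvfderiv 𝓘(ℝ, Euc (p + q)) f y ((Y e).1 y) = e) (s : F.normalSections)
    (v : TangentSpace 𝓘(ℝ, Euc (p + q)) x) :
    D.toFun s x v = ∑ i, ((F.normalDeriv f x (s.1 x)) i •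
        D.toFun (F.projSection (Y (EuclideanSpace.single i 1))) x v +
      (mvfderiv 𝓘(ℝ, Euc (p + q)) (fun y => F.normalDeriv f y (s.1 y)) x v) i •
        F.proj x ((Y (EuclideanSpace.single i 1)).1 x)) := by
  obtain ⟨χ, hχ, h1, hs⟩ := exists_smooth_bump (n := p + q) hN hxN
  let S : M → Euc q := fun y => F.normalDeriv f y (s.1 y)
  have hS : ContMDiffOn 𝓘(ℝ, Euc (p + q)) 𝓘(ℝ, Euc q) ∞ S N := (hf.smooth_section s).mono hNU
  have hpr : ∀ i : Fin q, ContDiff ℝ ∞ (fun e : Euc q => e i) := fun i =>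
    (EuclideanSpace.proj (𝕜 := ℝ) i : Euc q →L[ℝ] ℝ).contDiff
  have hg : ∀ i, ContMDiff 𝓘(ℝ, Euc (p + q)) 𝓘(ℝ, ℝ) ∞ (fun y => χ y * S y i) := fun i => by
    refine contMDiff_of_tsupport fun y hy => ?_
    have hyN : y ∈ N := hs (tsupport_mul_subset_left hy)
    exact hχ.contMDiffAt.mul
      ((hpr i).contMDiff.contMDiffAt.comp y (hS.contMDiffAt (hN.mem_nhds hyN)))
  let σ : Fin q → F.normalSections := fun i => F.projSection (Y (EuclideanSpace.single i 1))
  let τ : Fin q → F.normalSections := fun i =>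
    ⟨fun y => (χ y * S y i) • (σ i).1 y, normalSections_smul (hg i) (σ i).2⟩
  have hsum : ∀ᶠ y in 𝓝 x, s.1 y = (∑ i, τ i).1 y := by
    filter_upwards [h1, hN.mem_nhds hxN] with y hy hyN
    apply hf.normalDeriv_injective (hNU hyN)
    have e1 : (∑ i, τ i).1 y = ∑ i, (τ i).1 y := by
      rw [AddSubmonoidClass.coe_finsetSum, Finset.sum_apply]
    rw [e1, map_sum]
    have e2 : ∀ i, F.normalDeriv f y ((τ i).1 y) = S y i • EuclideanSpace.single i (1 : ℝ) := by
      intro i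
      change F.normalDeriv f y ((χ y * S y i) • F.proj y ((Y (EuclideanSpace.single i 1)).1 y)) = _
      rw [hy, one_mul, map_smul, hf.normalDeriv_proj (hNU hyN), hY y hyN]
    simp only [e2, sum_smul_single]
    rfl
  rw [NormalConnection.congr_germ D hsum]
  have e3 : D.toFun (∑ i, τ i) x = ∑ i, D.toFun (τ i) x :=
    map_sum (KoszulConnection.derivAt D x) τ Finset.univ
  rw [e3, LinearMap.sum_apply]
  refine Finset.sum_congr rfl fun i _ => ?_
  rw [D.leibniz _ (hg i) (σ i) (τ i) (fun _ => rfl) x v, h1.self_of_nhds, one_mul]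
  have e4 : mvfderiv 𝓘(ℝ, Euc (p + q)) (fun y => χ y * S y i) x v =
      (mvfderiv 𝓘(ℝ, Euc (p + q)) S x v) i := by
    have e5 : (fun y => χ y * S y i) =ᶠ[𝓝 x] fun y => (S y) i := by
      filter_upwards [h1] with y hy
      rw [hy, one_mul]
    rw [mvfderiv_congr e5]
    exact mvfderiv_fderiv_comp (h := fun e : Euc q => e i) ((hpr i).differentiable (by simp) _)
      (hf.mdiff_section s (hNU hxN)) v |>.trans (by
        rw [show (fun e : Euc q => e i) = (EuclideanSpace.proj (𝕜 := ℝ) i : Euc q →L[ℝ] ℝ) from rfl,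
          ContinuousLinearMap.fderiv]; rfl)
  rw [e4]
  rfl

/-- In a transverse chart, a Bott connection has Christoffel symbols. The derivative of a basic
section in a leafwise direction vanishes by the Bott property, so `∇_v s - dS(v)` depends on `v`
through `df(v)` only. -/
theorem IsTransverseChart.exists_hasChristoffelAt (hf : F.IsTransverseChart f U) (hx : x ∈ U)
    {D : F.NormalConnection} (hB : F.IsBott D) :
    ∃ Γ : Euc q →L[ℝ] Euc q →L[ℝ] Euc q, HasChristoffelAt D f x Γ := by
  obtain ⟨Y, N, hN, hxN, hNU, hYf, hYt, hYs⟩ := hf.exists_lift hx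
  let G : Euc q →ₗ[ℝ] Euc q →ₗ[ℝ] Euc q := LinearMap.mk₂ ℝ
    (fun e e' => F.normalDeriv f x (D.toFun (F.projSection (Y (e', 0))) x ((Y (e, 0)).1 x)))
    (fun e₁ e₂ e' => by
      have : (Y (e₁ + e₂, 0)).1 x = (Y (e₁, 0)).1 x + (Y (e₂, 0)).1 x := by
        have h := map_add Y (e₁, 0) (e₂, 0)
        rw [Prod.mk_add_mk, add_zero] at h
        rw [h]; rfl
      rw [this, map_add, map_add])
    (fun c e e' => by
      have : (Y (c • e, 0)).1 x = c • (Y (e, 0)).1 x := by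
        have h := map_smul Y c (e, 0)
        rw [Prod.smul_mk, smul_zero] at h
        rw [h]; rfl
      rw [this, map_smul, map_smul])
    (fun e e₁ e₂ => by
      have : F.projSection (Y (e₁ + e₂, 0)) =
          F.projSection (Y (e₁, 0)) + F.projSection (Y (e₂, 0)) := by
        have h := map_add Y (e₁, 0) (e₂, 0)
        rw [Prod.mk_add_mk, add_zero] at h
        rw [h]
        ext y
        exact map_add (F.proj y) _ _
      rw [this, D.map_add, LinearMap.add_apply, map_add])
    (fun c e e' => by
      have : F.projSection (Y (c • e', 0)) = c • F.projSection (Y (e', 0)) := by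
        have h := map_smul Y c (e', 0)
        rw [Prod.smul_mk, smul_zero] at h
        rw [h]
        ext y
        exact map_smul (F.proj y) _ _
      rw [this, D.map_smul_const, LinearMap.smul_apply, map_smul])
  let Γ : Euc q →L[ℝ] Euc q →L[ℝ] Euc q := LinearMap.toContinuousLinearMap
    ((LinearMap.toContinuousLinearMap : (Euc q →ₗ[ℝ] Euc q) ≃ₗ[ℝ] _).toLinearMap ∘ₗ G)
  refine ⟨Γ, fun s v => ?_⟩
  obtain ⟨b, rfl⟩ := hYs x hxN v
  have hleaf : ∀ e k, F.normalDeriv f x (D.toFun (F.projSection (Y (e, 0))) x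
      ((Y (0, k)).1 x)) = 0 := by
    intro e k
    rw [hB (Y (0, k)) (Y (e, 0)) (hYt k), hf.normalDeriv_mlieBracket hx]
    have h1 : ∀ c : Euc q × Euc p, mvfderiv 𝓘(ℝ, Euc (p + q))
        (fun y => mvfderiv 𝓘(ℝ, Euc (p + q)) f y ((Y c).1 y)) x = 0 := by
      intro c
      rw [mvfderiv_congr (g := fun _ => c.1), mvfderiv_const]
      filter_upwards [hN.mem_nhds hxN] with y hy using hYf y hy c
    rw [h1, h1]
    simp
  have hb : (Y b).1 x = (Y (b.1, 0)).1 x + (Y (0, b.2)).1 x := by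
    have h := map_add Y (b.1, 0) (0, b.2)
    rw [Prod.mk_add_mk, add_zero, zero_add] at h
    rw [show Y b = Y (b.1, b.2) from rfl, h]; rfl
  have hD : ∀ e, F.normalDeriv f x (D.toFun (F.projSection (Y (e, 0))) x ((Y b).1 x)) =
      Γ b.1 e := by
    intro e
    rw [hb, map_add, map_add, hleaf, add_zero]
    rfl
  rw [hf.toFun_eq_sum D hN hxN hNU (fun e => Y (e, 0)) (fun y hy e => hYf y hy (e, 0)) s,
    map_sum, hYf x hxN]
  simp only [map_add, map_smul, hD, hf.normalDeriv_proj hx, hYf x hxN]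
  rw [Finset.sum_add_distrib, add_comm]
  congr 1
  · rw [sum_smul_single]
  · simp only [← map_smul, ← map_sum, sum_smul_single]

/-- In a transverse chart, a torsion-free Bott connection has smooth symmetric Christoffel
symbols. -/
theorem IsTransverseChart.exists_christoffel (hf : F.IsTransverseChart f U)
    (D : F.TorsionFreeBottConnection) :
    ∃ Γ : M → Euc q →L[ℝ] Euc q →L[ℝ] Euc q,
      ContMDiffOn 𝓘(ℝ, Euc (p + q)) 𝓘(ℝ, Euc q →L[ℝ] Euc q →L[ℝ] Euc q) ∞ Γ U ∧
      ∀ x ∈ U, (∀ e e', Γ x e e' = Γ x e' e) ∧ HasChristoffelAt D.1 f x (Γ x) := by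
  obtain ⟨D, hB, hT⟩ := D
  have hpt : ∀ x ∈ U, ∃ Γ : Euc q →L[ℝ] Euc q →L[ℝ] Euc q, HasChristoffelAt D f x Γ :=
    fun x hx => hf.exists_hasChristoffelAt hx hB
  choose! Γ hΓ using hpt
  refine ⟨Γ, ?_, fun x hx => ⟨fun e e' => ?_, hΓ x hx⟩⟩
  · refine contMDiffOn_clm_of_apply fun e => contMDiffOn_clm_of_apply fun e' x hx => ?_
    obtain ⟨Y, N, hN, hxN, hNU, hYf, -, -⟩ := hf.exists_lift hx
    let t : F.normalSections :=
      ⟨fun y => D.toFun (F.projSection (Y (e', 0))) y ((Y (e, 0)).1 y),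
        D.smooth (Y (e, 0)).1 (Y (e, 0)).2 (F.projSection (Y (e', 0)))⟩
    have h1 := (hf.mono hN hNU).smooth_section t
    have h2 : ∀ y ∈ N, Γ y e e' = F.normalDeriv f y (t.1 y) := fun y hy =>
      (hΓ y (hNU hy)).apply_lift hf (hNU hy) (hYf y hy _) (by
        filter_upwards [hN.mem_nhds hy] with z hz using hYf z hz _)
    exact ((h1.congr h2).contMDiffAt (hN.mem_nhds hxN)).contMDiffWithinAt
  · obtain ⟨Y, N, hN, hxN, hNU, hYf, -, -⟩ := hf.exists_lift hx
    have h1 : ∀ c, ∀ᶠ y in 𝓝 x, mvfderiv 𝓘(ℝ, Euc (p + q)) f y ((Y c).1 y) = c.1 := fun c => by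
      filter_upwards [hN.mem_nhds hxN] with y hy using hYf y hy c
    have h2 : ∀ c, mvfderiv 𝓘(ℝ, Euc (p + q))
        (fun y => mvfderiv 𝓘(ℝ, Euc (p + q)) f y ((Y c).1 y)) x = 0 := fun c => by
      rw [mvfderiv_congr (h1 c), mvfderiv_const]
    have h3 := congrArg (F.normalDeriv f x) (hT (Y (e, 0)) (Y (e', 0)) x)
    have h4 : ∀ c c' : Euc q, Γ x c c' = F.normalDeriv f x
        (D.toFun (F.projSection (Y (c', 0))) x ((Y (c, 0)).1 x)) := fun c c' =>
      (hΓ x hx).apply_lift hf hx (hYf x hxN _) (h1 _)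
    have h5 : F.normalDeriv f x (F.proj x
        (VectorField.mlieBracket 𝓘(ℝ, Euc (p + q)) (Y (e, 0)).1 (Y (e', 0)).1 x)) = 0 := by
      rw [hf.normalDeriv_mlieBracket hx, h2, h2]
      exact sub_self _
    rw [torsion, map_sub, map_sub, h5, ← h4, ← h4, map_zero, sub_zero] at h3
    exact sub_eq_zero.1 h3

/-- Sections of `ν` take all values at a point. -/
theorem IsTransverseChart.exists_section (hf : F.IsTransverseChart f U) (hx : x ∈ U) (e : Euc q) :
    ∃ s : F.normalSections, F.normalDeriv f x (s.1 x) = e := by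
  obtain ⟨Y, N, hN, hxN, hNU, hYf, -, -⟩ := hf.exists_lift hx
  exact ⟨F.projSection (Y (e, 0)), (hf.normalDeriv_proj hx _).trans (hYf x hxN _)⟩

theorem IsTransverseChart.christoffel_unique (hf : F.IsTransverseChart f U) (hx : x ∈ U)
    {D : F.NormalConnection} {Γ Γ' : Euc q →L[ℝ] Euc q →L[ℝ] Euc q}
    (h : HasChristoffelAt D f x Γ) (h' : HasChristoffelAt D f x Γ') : Γ = Γ' := by
  ext1 e
  ext1 e'
  obtain ⟨v, rfl⟩ := hf.surjective x hx e
  obtain ⟨s, rfl⟩ := hf.exists_section hx e'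
  exact add_left_cancel ((h s v).symm.trans (h' s v))

variable {g : M → Euc q} {U' : Set M} {h : Euc q → Euc q}

/-- The transformation law of Christoffel symbols under a change of transverse charts `f = h ∘ g`. -/
theorem HasChristoffelAt.transform (hf : F.IsTransverseChart f U)
    (hg : F.IsTransverseChart g U') (hx : x ∈ U) (hx' : x ∈ U')
    (hh : ContDiffAt ℝ ∞ h (g x)) (he : f =ᶠ[𝓝 x] fun y => h (g y))
    {D : F.NormalConnection} {Γ Γ' : Euc q →L[ℝ] Euc q →L[ℝ] Euc q}
    (hΓ : HasChristoffelAt D f x Γ) (hΓ' : HasChristoffelAt D g x Γ') (e e' : Euc q) :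
    fderiv ℝ (fderiv ℝ h) (g x) e e' + Γ (fderiv ℝ h (g x) e) (fderiv ℝ h (g x) e') =
      fderiv ℝ h (g x) (Γ' e e') := by
  obtain ⟨v, rfl⟩ := hg.surjective x hx' e
  obtain ⟨s, rfl⟩ := hg.exists_section hx' e'
  have hnd := (eventually_normalDeriv_transition hf hg hx hx' hh he).self_of_nhds
  have h1 := hΓ s v
  rw [hnd, hnd, (eventually_mvfderiv_transition hg hx' hh he).self_of_nhds,
    mvfderiv_section_transition hf hg hx hx' hh he, hΓ' s v, map_add] at h1
  have h2 := sub_eq_zero.2 h1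
  rw [← sub_eq_zero, ← neg_eq_zero, ← h2]
  abel

end

end RegularFoliation

/-! ### Second derivatives and embeddings of `ℝ^q` in itself -/

section SecondOrder

variable {E E' E'' : Type*} [NormedAddCommGroup E] [NormedSpace ℝ E] [NormedAddCommGroup E']
  [NormedSpace ℝ E'] [NormedAddCommGroup E''] [NormedSpace ℝ E'']

/-- The chain rule for second derivatives. -/
theorem fderiv_fderiv_comp {h : E' → E''} {k : E → E'} {x : E} (hh : ContDiffAt ℝ 2 h (k x))
    (hk : ContDiffAt ℝ 2 k x) (w w' : E) :
    fderiv ℝ (fderiv ℝ fun s => h (k s)) x w w' =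
      fderiv ℝ (fderiv ℝ h) (k x) (fderiv ℝ k x w) (fderiv ℝ k x w') +
        fderiv ℝ h (k x) (fderiv ℝ (fderiv ℝ k) x w w') := by
  have h1 : (fderiv ℝ fun s => h (k s)) =ᶠ[𝓝 x]
      fun s => (fderiv ℝ h (k s)).comp (fderiv ℝ k s) := by
    filter_upwards [hk.continuousAt.eventually (hh.eventually (by simp)), hk.eventually (by simp)]
      with s hs hs'
    exact fderiv_comp s (hs.differentiableAt (by simp)) (hs'.differentiableAt (by simp))
  have h2 : DifferentiableAt ℝ (fderiv ℝ h) (k x) :=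
    (hh.fderiv_right (m := 1) (by rw [one_add_one_eq_two])).differentiableAt (by simp)
  have h3 : DifferentiableAt ℝ (fderiv ℝ k) x :=
    (hk.fderiv_right (m := 1) (by rw [one_add_one_eq_two])).differentiableAt (by simp)
  have h4 := (h2.hasFDerivAt.comp x (hk.differentiableAt (by simp)).hasFDerivAt).clm_comp
    h3.hasFDerivAt
  rw [h1.fderiv_eq]
  have h5 := congrArg (fun L : E →L[ℝ] E →L[ℝ] E'' => L w w') h4.fderiv
  refine h5.trans ?_
  simp [add_comm]

/-- The second derivative at `0` of an odd map vanishes. -/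
theorem fderiv_fderiv_zero_of_odd {k : E → E'} (hk : ContDiffAt ℝ 2 k 0)
    (hodd : ∀ x, k (-x) = -k x) (w w' : E) : fderiv ℝ (fderiv ℝ k) 0 w w' = 0 := by
  have hneg : fderiv ℝ (fun x : E => -x) = fun _ => -ContinuousLinearMap.id ℝ E := by
    funext x
    exact (hasFDerivAt_id x).neg.fderiv
  have h1 := fderiv_fderiv_comp (h := k) (k := fun x : E => -x) (x := 0)
    (by simpa using hk) contDiffAt_id.neg w w'
  have h2 : fderiv ℝ (fun s => k (-s)) = fun s => -fderiv ℝ k s := by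
    funext s
    rw [show (fun s => k (-s)) = fun s => -k s from funext hodd, fderiv_fun_neg]
  rw [h2, fderiv_fun_neg, hneg] at h1
  simp only [neg_zero, fderiv_fun_const, Pi.zero_apply] at h1
  simp only [neg_apply, ContinuousLinearMap.id_apply, map_neg, neg_neg, zero_apply, map_zero,
    add_zero] at h1
  have h3 : (2 : ℝ) • fderiv ℝ (fderiv ℝ k) 0 w w' = 0 := by
    rw [two_smul]
    nth_rewrite 1 [← h1]
    exact neg_add_cancel _
  exact (smul_eq_zero.1 h3).resolve_left two_ne_zero

end SecondOrder

open OpenPartialHomeomorph in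
/-- The standard diffeomorphism of `ℝ^q` onto a ball is an immersion. -/
theorem fderiv_univBall_injective {q : ℕ} (c : Euc q) {r : ℝ} (hr : 0 < r) (s : Euc q) :
    Function.Injective (fderiv ℝ (univBall c r : Euc q → Euc q) s) := by
  have hs : univBall c r s ∈ Metric.ball c r := by
    rw [← univBall_target c hr]; exact (univBall c r).map_source (by simp)
  have h1 : DifferentiableAt ℝ (univBall c r).symm (univBall c r s) :=
    ((contDiffOn_univBall_symm (n := 1)).contDiffAt (Metric.isOpen_ball.mem_nhds hs)).differentiableAt
      (by simp)
  have h2 : DifferentiableAt ℝ (univBall c r : Euc q → Euc q) s :=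
    (contDiff_univBall (n := 1)).differentiable (by simp) s
  have h3 := fderiv_comp s h1 h2
  rw [show (univBall c r).symm ∘ (univBall c r : Euc q → Euc q) = id from
    funext fun x => (univBall c r).left_inv (by simp), fderiv_id] at h3
  intro v w hvw
  have h4 := congrArg (fun L : Euc q →L[ℝ] Euc q => L v) h3
  have h5 := congrArg (fun L : Euc q →L[ℝ] Euc q => L w) h3
  simp only [ContinuousLinearMap.comp_apply, ContinuousLinearMap.id_apply] at h4 h5
  rw [h4, hvw, ← h5]

theorem univBall_zero_apply {q : ℕ} {r : ℝ} (hr : 0 < r) (s : Euc q) :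
    OpenPartialHomeomorph.univBall (0 : Euc q) r s = r • (√(1 + ‖s‖ ^ 2))⁻¹ • s := by
  unfold OpenPartialHomeomorph.univBall
  rw [dif_pos hr]
  exact add_zero _

/-- Every symmetric bilinear map is the second derivative at `0` of an open embedding of `ℝ^q` in
itself which is tangent to the identity at `0`. -/
theorem exists_embedding_of_second_derivative {q : ℕ} (β : Euc q →L[ℝ] Euc q →L[ℝ] Euc q)
    (hβ : ∀ e e', β e e' = β e' e) :
    ∃ Q : Euc q → Euc q, ContDiff ℝ ∞ Q ∧ Topology.IsEmbedding Q ∧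
      (∀ s, Function.Bijective (fderiv ℝ Q s)) ∧ Q 0 = 0 ∧
      fderiv ℝ Q 0 = ContinuousLinearMap.id ℝ (Euc q) ∧ fderiv ℝ (fderiv ℝ Q) 0 = β := by
  -- `Q` is the quadratic map `R`, restricted to a small ball, which is identified with `ℝ^q` by the
  -- diffeomorphism `ρ`, normalized to `P` with derivative the identity at `0`; as `ρ` is odd, it does
  -- not contribute to the second derivative
  let R : Euc q → Euc q := fun s => s + (2⁻¹ : ℝ) • β s s
  have hR : ContDiff ℝ ∞ R :=
    contDiff_id.add (((β.contDiff).clm_apply contDiff_id).const_smul (2⁻¹ : ℝ))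
  have hR1 : ∀ s, HasFDerivAt R (ContinuousLinearMap.id ℝ (Euc q) + β s) s := by
    intro s
    have h1 := (hasFDerivAt_id (𝕜 := ℝ) s).add
      ((β.hasFDerivAt.clm_apply (hasFDerivAt_id s)).const_smul (2⁻¹ : ℝ))
    refine h1.congr_fderiv ?_
    ext1 e
    simp only [add_apply, smul_apply, ContinuousLinearMap.comp_apply, ContinuousLinearMap.flip_apply,
      ContinuousLinearMap.id_apply, id]
    rw [hβ e s, ← two_smul ℝ, smul_smul]
    norm_num
  have hfR : fderiv ℝ R = fun s => ContinuousLinearMap.id ℝ (Euc q) + β s :=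
    funext fun s => (hR1 s).fderiv
  have hffR : ∀ s, fderiv ℝ (fderiv ℝ R) s = β := by
    intro s
    rw [hfR]
    simp
  obtain ⟨Ψ, hΨR, h0Ψ, -, -, hΨd⟩ := exists_smooth_localInverse isOpen_univ hR.contDiffOn
    (Set.mem_univ (0 : Euc q)) (e := ContinuousLinearEquiv.refl ℝ (Euc q))
    ((hR1 0).congr_fderiv (by ext1 e; simp))
  obtain ⟨r, hr, hrΨ⟩ := Metric.isOpen_iff.1 Ψ.open_source 0 h0Ψ
  let ρ := OpenPartialHomeomorph.univBall (0 : Euc q) r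
  have hρc : ContDiff ℝ ∞ (ρ : Euc q → Euc q) := OpenPartialHomeomorph.contDiff_univBall
  have hρ0 : ρ 0 = 0 := OpenPartialHomeomorph.univBall_apply_zero 0 r
  have hρm : ∀ s, ρ s ∈ Ψ.source := fun s => hrΨ (by
    rw [← OpenPartialHomeomorph.univBall_target (0 : Euc q) hr]
    exact ρ.map_source (by simp [ρ]))
  have hρodd : ∀ s, ρ (-s) = -ρ s := by
    intro s
    rw [univBall_zero_apply hr, univBall_zero_apply hr, norm_neg, smul_neg, smul_neg]
  have hρb : ∀ s, Function.Bijective (fderiv ℝ (ρ : Euc q → Euc q) s) := fun s =>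
    ⟨fderiv_univBall_injective 0 hr s,
      LinearMap.surjective_of_injective (f := (fderiv ℝ (ρ : Euc q → Euc q) s).toLinearMap)
        (fderiv_univBall_injective 0 hr s)⟩
  let K : Euc q ≃L[ℝ] Euc q := (LinearEquiv.ofBijective
    (fderiv ℝ (ρ : Euc q → Euc q) 0).toLinearMap (hρb 0)).toContinuousLinearEquiv
  have hK : ∀ e, fderiv ℝ (ρ : Euc q → Euc q) 0 (K.symm e) = e := fun e => K.apply_symm_apply e
  let P : Euc q → Euc q := fun s => ρ (K.symm s)
  have hP : ContDiff ℝ ∞ P := hρc.comp K.symm.contDiff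
  have hPd : ∀ s, fderiv ℝ P s = (fderiv ℝ (ρ : Euc q → Euc q) (K.symm s)).comp
      (K.symm : Euc q →L[ℝ] Euc q) := fun s => by
    have := fderiv_comp s ((hρc.differentiable (by simp)) (K.symm s)) K.symm.differentiableAt
    rw [K.symm.fderiv] at this
    exact this
  have hP0 : P 0 = 0 := by simp only [P, map_zero, hρ0]
  have hP1 : fderiv ℝ P 0 = ContinuousLinearMap.id ℝ (Euc q) := by
    rw [hPd]
    ext1 e
    simp only [map_zero]
    exact hK e
  have hP2 : ∀ w w', fderiv ℝ (fderiv ℝ P) 0 w w' = 0 := fun w w' =>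
    fderiv_fderiv_zero_of_odd (hP.contDiffAt.of_le two_le_infty)
      (fun s => by simp only [P, map_neg, hρodd]) w w'
  have hQd : ∀ s, fderiv ℝ (fun s => R (P s)) s = (fderiv ℝ R (P s)).comp (fderiv ℝ P s) := fun s =>
    fderiv_comp s ((hR.differentiable (by simp)) _) ((hP.differentiable (by simp)) _)
  refine ⟨fun s => R (P s), hR.comp hP, ?_, fun s => ?_, ?_, ?_, ?_⟩
  · have h1 := Ψ.isOpenEmbedding_restrict.isEmbedding.comp
      (((ρ.isOpenEmbedding (by simp [ρ])).isEmbedding.codRestrict Ψ.source hρm).comp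
        K.symm.toHomeomorph.isEmbedding)
    have h2 : (fun s => R (P s)) = Ψ.source.domRestrict Ψ ∘
        (Set.codRestrict ρ Ψ.source hρm ∘ K.symm.toHomeomorph) := by
      funext s
      exact (congrFun hΨR (P s)).symm
    rw [h2]; exact h1
  · rw [hQd, hPd]
    obtain ⟨e', he'⟩ := hΨd (P s) (hρm _)
    rw [he'.fderiv]
    exact e'.bijective.comp ((hρb _).comp K.symm.bijective)
  · simp [R, hP0]
  · rw [hQd, hP1, hP0, hfR]
    ext1 e
    simp
  · ext1 w
    ext1 w'
    rw [fderiv_fderiv_comp (hR.contDiffAt.of_le two_le_infty) (hP.contDiffAt.of_le two_le_infty),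
      hP1, hP2, hP0, hffR]
    simp

namespace RegularFoliation

variable {p q : ℕ} {M : Type*} [TopologicalSpace M] [ChartedSpace (Euc (p + q)) M] {ι : Type*}
  {F : RegularFoliation p q M ι}

/-! ### Transverse embeddings and their jets -/

namespace TransverseEmbedding

theorem mdiff (u : F.TransverseEmbedding) (s : Euc q) :
    MDifferentiableAt 𝓘(ℝ, Euc q) 𝓘(ℝ, Euc (p + q)) u.toFun s :=
  u.smooth.mdifferentiable (by simp) s

theorem frame_injective (u : F.TransverseEmbedding) : Function.Injective u.frame := by
  refine (injective_iff_map_eq_zero _).2 fun e he => ?_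
  have h1 : mfderiv 𝓘(ℝ, Euc q) 𝓘(ℝ, Euc (p + q)) u.toFun 0 e ∈ F.tangent (u 0) :=
    (Submodule.Quotient.mk_eq_zero _).1 he
  have h2 := Submodule.disjoint_def.1 (u.transverse 0).disjoint _ ⟨e, rfl⟩ h1
  exact u.immersive 0 (h2.trans (map_zero _).symm)

variable {f : M → Euc q} {U : Set M}

theorem contDiffAt_comp (u : F.TransverseEmbedding) (hf : F.IsTransverseChart f U)
    (hu : u 0 ∈ U) : ContDiffAt ℝ ∞ (fun s => f (u s)) 0 :=
  ((hf.smooth.contMDiffAt (hf.isOpen.mem_nhds hu)).comp 0 u.smooth.contMDiffAt).contDiffAt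

theorem fderiv_comp_apply (u : F.TransverseEmbedding) (hf : F.IsTransverseChart f U)
    (hu : u 0 ∈ U) (e : Euc q) :
    fderiv ℝ (fun s => f (u s)) 0 e = F.normalDeriv f (u 0) (u.frame e) :=
  (fderiv_comp_mvfderiv (hf.mdiff hu) (u.mdiff 0) e).trans (hf.normalDeriv_proj hu _).symm

variable {α β : ι}

theorem normalDeriv_frame (u : F.TransverseEmbedding) (hα : u 0 ∈ F.U α) (e : Euc q) :
    F.normalDeriv (F.f α) (u 0) (u.frame e) = u.deriv₁ α e :=
  (u.fderiv_comp_apply (F.isTransverseChart_haefliger α) hα e).symm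

theorem deriv₁_bijective (u : F.TransverseEmbedding) (hα : u 0 ∈ F.U α) :
    Function.Bijective (u.deriv₁ α) := by
  have h : Function.Injective (u.deriv₁ α) := by
    intro v w hvw
    rw [← u.normalDeriv_frame hα, ← u.normalDeriv_frame hα] at hvw
    exact u.frame_injective
      ((F.isTransverseChart_haefliger α).normalDeriv_injective hα hvw)
  exact ⟨h, LinearMap.surjective_of_injective (f := (u.deriv₁ α).toLinearMap) h⟩

/-- The first derivative in a Haefliger chart, as a linear automorphism. -/
def deriv₁Equiv (u : F.TransverseEmbedding) (hα : u 0 ∈ F.U α) : Euc q ≃L[ℝ] Euc q :=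
  (LinearEquiv.ofBijective (u.deriv₁ α).toLinearMap
    (u.deriv₁_bijective hα)).toContinuousLinearEquiv

theorem coe_deriv₁Equiv (u : F.TransverseEmbedding) (hα : u 0 ∈ F.U α) :
    (u.deriv₁Equiv hα : Euc q →L[ℝ] Euc q) = u.deriv₁ α := rfl

theorem contDiffAt_haefliger (u : F.TransverseEmbedding) (hα : u 0 ∈ F.U α) :
    ContDiffAt ℝ ∞ (fun s => F.f α (u s)) 0 :=
  u.contDiffAt_comp (F.isTransverseChart_haefliger α) hα

theorem deriv₂_symm (u : F.TransverseEmbedding) (hα : u 0 ∈ F.U α) (w w' : Euc q) :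
    u.deriv₂ α w w' = u.deriv₂ α w' w :=
  (u.contDiffAt_haefliger hα).isSymmSndFDerivAt (by simpa using two_le_infty) w w'

theorem eventually_transition (u : F.TransverseEmbedding) {h : Euc q → Euc q}
    (he : F.f α =ᶠ[𝓝 (u 0)] fun y => h (F.f β y)) :
    (fun s => F.f α (u s)) =ᶠ[𝓝 0] fun s => h (F.f β (u s)) :=
  u.smooth.continuous.continuousAt.eventually he

theorem deriv₁_transition (u : F.TransverseEmbedding) (hβ : u 0 ∈ F.U β) {h : Euc q → Euc q}
    (hh : ContDiffAt ℝ ∞ h (F.f β (u 0))) (he : F.f α =ᶠ[𝓝 (u 0)] fun y => h (F.f β y)) :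
    u.deriv₁ α = (fderiv ℝ h (F.f β (u 0))).comp (u.deriv₁ β) := by
  rw [deriv₁, (u.eventually_transition he).fderiv_eq]
  exact fderiv_comp (g := h) 0 (hh.differentiableAt (by simp))
    ((u.contDiffAt_haefliger hβ).differentiableAt (by simp))

theorem deriv₂_transition (u : F.TransverseEmbedding) (hβ : u 0 ∈ F.U β) {h : Euc q → Euc q}
    (hh : ContDiffAt ℝ ∞ h (F.f β (u 0))) (he : F.f α =ᶠ[𝓝 (u 0)] fun y => h (F.f β y))
    (w w' : Euc q) :
    u.deriv₂ α w w' = fderiv ℝ (fderiv ℝ h) (F.f β (u 0)) (u.deriv₁ β w) (u.deriv₁ β w') +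
      fderiv ℝ h (F.f β (u 0)) (u.deriv₂ β w w') := by
  rw [deriv₂, (u.eventually_transition he).fderiv.fderiv_eq]
  exact fderiv_fderiv_comp (k := fun s => F.f β (u s)) (x := 0) (hh.of_le two_le_infty)
    ((u.contDiffAt_haefliger hβ).of_le two_le_infty) w w'

theorem jet_eq_iff {k : ℕ} {u v : F.TransverseEmbedding} : u.jet k = v.jet k ↔
    u 0 = v 0 ∧ ∀ α, u 0 ∈ F.U α → ∀ i ≤ k,
      iteratedFDeriv ℝ i (fun s => F.f α (u s)) 0 = iteratedFDeriv ℝ i (fun s => F.f α (v s)) 0 :=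
  Quotient.eq (r := F.jetSetoid k)

theorem iteratedFDeriv_one_eq_iff {u v : F.TransverseEmbedding} :
    iteratedFDeriv ℝ 1 (fun s => F.f α (u s)) 0 = iteratedFDeriv ℝ 1 (fun s => F.f α (v s)) 0 ↔
      u.deriv₁ α = v.deriv₁ α := by
  refine ⟨fun h => ?_, fun h => ?_⟩
  · ext1 w
    have := congrArg (fun L => L fun _ => w) h
    simp only [iteratedFDeriv_one_apply] at this
    exact this
  · ext1 m
    rw [iteratedFDeriv_one_apply, iteratedFDeriv_one_apply]
    exact congrArg (fun L : Euc q →L[ℝ] Euc q => L (m 0)) h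

theorem iteratedFDeriv_two_eq_iff {u v : F.TransverseEmbedding} :
    iteratedFDeriv ℝ 2 (fun s => F.f α (u s)) 0 = iteratedFDeriv ℝ 2 (fun s => F.f α (v s)) 0 ↔
      u.deriv₂ α = v.deriv₂ α := by
  refine ⟨fun h => ?_, fun h => ?_⟩
  · ext1 w
    ext1 w'
    have := congrArg (fun L => L ![w, w']) h
    simp only [iteratedFDeriv_two_apply, Matrix.cons_val_zero, Matrix.cons_val_one] at this
    exact this
  · ext1 m
    rw [iteratedFDeriv_two_apply, iteratedFDeriv_two_apply]
    exact congrArg (fun L : Euc q →L[ℝ] Euc q →L[ℝ] Euc q => L (m 0) (m 1)) h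

theorem base_eq_of_jet_eq {k : ℕ} {u v : F.TransverseEmbedding} (h : u.jet k = v.jet k) :
    u 0 = v 0 := (jet_eq_iff.1 h).1

theorem deriv₁_eq_of_jet_eq {u v : F.TransverseEmbedding} (h : u.jet 1 = v.jet 1)
    (hα : u 0 ∈ F.U α) : u.deriv₁ α = v.deriv₁ α :=
  iteratedFDeriv_one_eq_iff.1 ((jet_eq_iff.1 h).2 α hα 1 le_rfl)

theorem deriv₂_eq_of_jet_eq {u v : F.TransverseEmbedding} (h : u.jet 2 = v.jet 2)
    (hα : u 0 ∈ F.U α) : u.deriv₂ α = v.deriv₂ α :=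
  iteratedFDeriv_two_eq_iff.1 ((jet_eq_iff.1 h).2 α hα 2 le_rfl)

theorem truncate_jet (u : F.TransverseEmbedding) : (u.jet 2).truncate = u.jet 1 := rfl

theorem act_jet {k : ℕ} (u : F.TransverseEmbedding) (A : Euc q ≃L[ℝ] Euc q) :
    (u.jet k).act A = (u.comp A).jet k := rfl

/-- A transverse `1`-jet is determined by the first derivative in one Haefliger chart. -/
theorem jet_one_eq {u v : F.TransverseEmbedding} (h0 : u 0 = v 0) (hα : u 0 ∈ F.U α)
    (h1 : u.deriv₁ α = v.deriv₁ α) : u.jet 1 = v.jet 1 := by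
  refine jet_eq_iff.2 ⟨h0, fun β hβ i hi => ?_⟩
  interval_cases i
  · ext m
    simp [h0]
  · obtain ⟨h, hh, he⟩ := F.exists_transition hβ hα
    rw [iteratedFDeriv_one_eq_iff, u.deriv₁_transition hα hh he,
      v.deriv₁_transition (h0 ▸ hα) (h0 ▸ hh) (h0 ▸ he), h1, h0]

/-- A transverse `2`-jet is determined by the first two derivatives in one Haefliger chart. -/
theorem jet_two_eq {u v : F.TransverseEmbedding} (h0 : u 0 = v 0) (hα : u 0 ∈ F.U α)
    (h1 : u.deriv₁ α = v.deriv₁ α) (h2 : u.deriv₂ α = v.deriv₂ α) : u.jet 2 = v.jet 2 := by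
  refine jet_eq_iff.2 ⟨h0, fun β hβ i hi => ?_⟩
  rcases hi.lt_or_eq with hi | rfl
  · exact (jet_eq_iff.1 (jet_one_eq h0 hα h1)).2 β hβ i (Nat.lt_succ_iff.1 hi)
  · obtain ⟨h, hh, he⟩ := F.exists_transition hβ hα
    rw [iteratedFDeriv_two_eq_iff]
    ext1 w
    ext1 w'
    rw [u.deriv₂_transition hα hh he,
      v.deriv₂_transition (h0 ▸ hα) (h0 ▸ hh) (h0 ▸ he), h1, h2, h0]

theorem comp_zero (u : F.TransverseEmbedding) (A : Euc q ≃L[ℝ] Euc q) : (u.comp A) 0 = u 0 :=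
  congrArg u.toFun (map_zero A)

theorem deriv₁_comp (u : F.TransverseEmbedding) (A : Euc q ≃L[ℝ] Euc q) (hα : u 0 ∈ F.U α)
    (w : Euc q) : (u.comp A).deriv₁ α w = u.deriv₁ α (A w) := by
  have h1 : DifferentiableAt ℝ (fun s => F.f α (u s)) (A 0) := by
    rw [map_zero]; exact (u.contDiffAt_haefliger hα).differentiableAt (by simp)
  have h := fderiv_comp (0 : Euc q) h1 A.differentiableAt
  rw [A.fderiv, map_zero] at h
  exact congrArg (fun L : Euc q →L[ℝ] Euc q => L w) h

theorem deriv₂_comp (u : F.TransverseEmbedding) (A : Euc q ≃L[ℝ] Euc q) (hα : u 0 ∈ F.U α)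
    (w w' : Euc q) : (u.comp A).deriv₂ α w w' = u.deriv₂ α (A w) (A w') := by
  have h1 : ContDiffAt ℝ 2 (fun s => F.f α (u s)) (A 0) := by
    rw [map_zero]; exact (u.contDiffAt_haefliger hα).of_le two_le_infty
  have hA : fderiv ℝ (A : Euc q → Euc q) = fun _ => (A : Euc q →L[ℝ] Euc q) :=
    funext fun s => A.fderiv
  have h := fderiv_fderiv_comp h1 (A.contDiff.contDiffAt (x := 0)) w w'
  rw [hA, map_zero] at h
  simp only [fderiv_fun_const, Pi.zero_apply, zero_apply, map_zero, add_zero] at h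
  exact h

/-- Reparametrization of a transverse embedding by an embedding of `ℝ^q` in itself. -/
def reparam (u : F.TransverseEmbedding) (Q : Euc q → Euc q) (hQ : ContDiff ℝ ∞ Q)
    (hQe : Topology.IsEmbedding Q) (hQd : ∀ s, Function.Bijective (fderiv ℝ Q s)) :
    F.TransverseEmbedding :=
  have hd : ∀ s, mfderiv 𝓘(ℝ, Euc q) 𝓘(ℝ, Euc (p + q)) (fun s => u (Q s)) s =
      (mfderiv 𝓘(ℝ, Euc q) 𝓘(ℝ, Euc (p + q)) u.toFun (Q s)).comp (fderiv ℝ Q s) := fun s =>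
    ((u.mdiff (Q s)).hasMFDerivAt.comp s
      (hQ.differentiable (by simp) s).hasFDerivAt.hasMFDerivAt).mfderiv
  { toFun := fun s => u (Q s)
    smooth := u.smooth.comp hQ.contMDiff
    isEmbedding := u.isEmbedding.comp hQe
    immersive := fun s => by
      rw [hd s]; exact (u.immersive (Q s)).comp (hQd s).1
    transverse := fun s => by
      have h := u.transverse (Q s)
      have : (mfderiv 𝓘(ℝ, Euc q) 𝓘(ℝ, Euc (p + q)) (fun s => u (Q s)) s).toLinearMap.range =
          (mfderiv 𝓘(ℝ, Euc q) 𝓘(ℝ, Euc (p + q)) u.toFun (Q s)).toLinearMap.range := by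
        rw [hd s]
        exact LinearMap.range_comp_of_range_eq_top _ (LinearMap.range_eq_top.2 (hQd s).2)
      rw [this]; exact h }

/-- Every symmetric second derivative is realized by a transverse embedding with given `1`-jet. -/
theorem exists_deriv₂_eq (u : F.TransverseEmbedding) (hα : u 0 ∈ F.U α)
    (B : Euc q →L[ℝ] Euc q →L[ℝ] Euc q) (hB : ∀ e e', B e e' = B e' e) :
    ∃ v : F.TransverseEmbedding, v 0 = u 0 ∧ v.deriv₁ α = u.deriv₁ α ∧ v.deriv₂ α = B := by
  let C : Euc q →L[ℝ] Euc q := (u.deriv₁Equiv hα).symm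
  have hC : ∀ e, u.deriv₁ α (C e) = e := (u.deriv₁Equiv hα).apply_symm_apply
  -- the second derivative of `u ∘ Q` is that of `u` plus `u.deriv₁ α ∘ D²Q`, if `DQ = id` at `0`
  let β : Euc q →L[ℝ] Euc q →L[ℝ] Euc q :=
    (ContinuousLinearMap.compL ℝ _ _ _ C).comp (B - u.deriv₂ α)
  have hβ : ∀ e e', β e e' = C (B e e' - u.deriv₂ α e e') := fun _ _ => rfl
  obtain ⟨Q, hQ, hQe, hQd, hQ0, hQ1, hQ2⟩ := exists_embedding_of_second_derivative β
    fun e e' => by rw [hβ, hβ, hB, u.deriv₂_symm hα]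
  have hu : ContDiffAt ℝ ∞ (fun s => F.f α (u s)) (Q 0) := by
    rw [hQ0]; exact u.contDiffAt_haefliger hα
  refine ⟨u.reparam Q hQ hQe hQd, congrArg u.toFun hQ0, ?_, ?_⟩
  · have h := fderiv_comp (0 : Euc q) (hu.differentiableAt (by simp))
      (hQ.differentiable (by simp) 0)
    rw [hQ1, hQ0] at h
    exact h
  · ext1 w
    ext1 w'
    have h := fderiv_fderiv_comp (hu.of_le two_le_infty)
      (hQ.contDiffAt.of_le two_le_infty) w w'
    rw [hQ1, hQ0, hQ2] at h
    have h' : (u.reparam Q hQ hQe hQd).deriv₂ α w w' =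
      u.deriv₂ α w w' + u.deriv₁ α (β w w') := h
    rw [h', hβ, hC]
    abel

end TransverseEmbedding

/-- There are transverse embeddings through every point. -/
theorem exists_transverseEmbedding [IsManifold 𝓘(ℝ, Euc (p + q)) ∞ M] (x : M) :
    ∃ u : F.TransverseEmbedding, u 0 = x := by
  obtain ⟨α, hα⟩ := F.cover x
  obtain ⟨φ, hφ, hx, -, -⟩ := (F.isTransverseChart_haefliger α).exists_isFoliationChart hα
  obtain ⟨r, hr, hrφ⟩ := Metric.isOpen_iff.1
    (φ.open_target.preimage (Continuous.prodMk_left (φ x).2)) (φ x).1 (φ.map_source hx)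
  -- the slice `y = const` of a foliation chart, over a ball which is identified with `ℝ^q`
  let ζ := OpenPartialHomeomorph.univBall (φ x).1 r
  have hζc : ContDiff ℝ ∞ (ζ : Euc q → Euc q) := OpenPartialHomeomorph.contDiff_univBall
  let κ : Euc q → Euc q × Euc p := fun s => (ζ s, (φ x).2)
  have hκ : ContDiff ℝ ∞ κ := hζc.prodMk contDiff_const
  have hκm : ∀ s, κ s ∈ φ.target := fun s => hrφ (by
    rw [← OpenPartialHomeomorph.univBall_target (φ x).1 hr]
    exact ζ.map_source (by simp [ζ]))
  have hκe : Topology.IsEmbedding κ := by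
    have h1 : Continuous ζ := hζc.continuous
    refine Topology.IsEmbedding.of_comp hκ.continuous continuous_fst ?_
    exact (ζ.isOpenEmbedding (by simp [ζ])).isEmbedding
  have hsm : ContMDiff 𝓘(ℝ, Euc q) 𝓘(ℝ, Euc (p + q)) ∞ (fun s => φ.symm (κ s)) :=
    hφ.smooth_symm.comp_contMDiff hκ.contMDiff hκm
  have hsrc : ∀ s, φ.symm (κ s) ∈ φ.source := fun s => φ.map_target (hκm s)
  -- the derivative of the embedding, read in the coordinates
  have hd : ∀ s e, mvfderiv 𝓘(ℝ, Euc (p + q)) φ (φ.symm (κ s))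
      (mfderiv 𝓘(ℝ, Euc q) 𝓘(ℝ, Euc (p + q)) (fun s => φ.symm (κ s)) s e) =
        (fderiv ℝ (ζ : Euc q → Euc q) s e, 0) := by
    intro s e
    rw [← fderiv_comp_mvfderiv (f := φ) (ψ := fun s => φ.symm (κ s))
      (hφ.isSmoothChart.mdiff (hsrc s)) (hsm.mdifferentiable (by simp) s) e]
    rw [show (fun s => φ (φ.symm (κ s))) = κ from funext fun s => φ.right_inv (hκm s)]
    have h := ((hζc.differentiable (by simp)) s).hasFDerivAt.prodMk
      (hasFDerivAt_const (φ x).2 s)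
    rw [show fderiv ℝ κ s = _ from h.fderiv]
    rfl
  have hζi := fun s => fderiv_univBall_injective (φ x).1 hr s
  have hζs : ∀ s, Function.Surjective (fderiv ℝ (ζ : Euc q → Euc q) s) := fun s =>
    LinearMap.surjective_of_injective (f := (fderiv ℝ (ζ : Euc q → Euc q) s).toLinearMap) (hζi s)
  have htan : ∀ s (v : TangentSpace 𝓘(ℝ, Euc (p + q)) (φ.symm (κ s))),
      v ∈ F.tangent (φ.symm (κ s)) ↔
        (mvfderiv 𝓘(ℝ, Euc (p + q)) φ (φ.symm (κ s)) v).1 = 0 := by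
    intro s v
    rw [hφ.isTransverseChart.mem_tangent _ (hsrc s)]
    rw [mvfderiv_fderiv_comp (h := Prod.fst) differentiableAt_fst
      (hφ.isSmoothChart.mdiff (hsrc s)), fderiv_fst]
    rfl
  refine ⟨⟨fun s => φ.symm (κ s), hsm, ?_, fun s v w hvw => ?_, fun s => ⟨?_, ?_⟩⟩, ?_⟩
  · exact φ.symm.isOpenEmbedding_restrict.isEmbedding.comp (hκe.codRestrict φ.target hκm)
  · have h := hd s v
    rw [hvw] at h
    exact hζi s (Prod.ext_iff.1 (h.symm.trans (hd s w))).1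
  · rw [Submodule.disjoint_def]
    rintro _ ⟨e, rfl⟩ hv
    have h1 := (htan s _).1 hv
    have h2 : fderiv ℝ (ζ : Euc q → Euc q) s e = 0 := (congrArg Prod.fst (hd s e)).symm.trans h1
    rw [hζi s (h2.trans (map_zero _).symm)]
    exact map_zero _
  · rw [codisjoint_iff, eq_top_iff]
    intro v _
    obtain ⟨e, he⟩ := hζs s (mvfderiv 𝓘(ℝ, Euc (p + q)) φ (φ.symm (κ s)) v).1
    refine Submodule.mem_sup.2 ⟨_, ⟨e, rfl⟩,
      v - mfderiv 𝓘(ℝ, Euc q) 𝓘(ℝ, Euc (p + q)) (fun s => φ.symm (κ s)) s e, ?_, ?_⟩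
    · rw [htan, map_sub, hd s e, Prod.fst_sub, he, sub_self]
    · exact add_sub_cancel _ _
  · have h0 : κ 0 = φ x := by
      simp only [κ, ζ, OpenPartialHomeomorph.univBall_apply_zero]
    change φ.symm (κ 0) = x
    rw [h0, φ.left_inv hx]

end RegularFoliation

namespace RegularFoliation

variable {p q : ℕ} {M : Type*} [TopologicalSpace M] [ChartedSpace (Euc (p + q)) M]
  [IsManifold 𝓘(ℝ, Euc (p + q)) ∞ M] {ι : Type*} {F : RegularFoliation p q M ι}

/-! ### Connections from Christoffel symbols -/

variable (F) in
/-- A family of smooth symmetric Christoffel symbols in the Haefliger charts, related by the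
transformation law of linear connections. -/
structure ChristoffelFamily where
  toFun : ι → M → Euc q →L[ℝ] Euc q →L[ℝ] Euc q
  smooth : ∀ α, ContMDiffOn 𝓘(ℝ, Euc (p + q)) 𝓘(ℝ, Euc q →L[ℝ] Euc q →L[ℝ] Euc q) ∞ (toFun α)
    (F.U α)
  symm : ∀ α, ∀ x ∈ F.U α, ∀ e e', toFun α x e e' = toFun α x e' e
  transform : ∀ α β x, x ∈ F.U α → x ∈ F.U β → ∀ h : Euc q → Euc q, ContDiffAt ℝ ∞ h (F.f β x) →
    (F.f α =ᶠ[𝓝 x] fun y => h (F.f β y)) → ∀ e e',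
      fderiv ℝ (fderiv ℝ h) (F.f β x) e e' +
          toFun α x (fderiv ℝ h (F.f β x) e) (fderiv ℝ h (F.f β x) e') =
        fderiv ℝ h (F.f β x) (toFun β x e e')

namespace ChristoffelFamily

variable (Γ : F.ChristoffelFamily)

/-- The expression `dS(v) + Γ(df(v), S)` of a covariant derivative in a Haefliger chart. -/
def localDeriv (α : ι) (s : F.normalSections) (x : M) :
    TangentSpace 𝓘(ℝ, Euc (p + q)) x →ₗ[ℝ] Euc q :=
  (mvfderiv 𝓘(ℝ, Euc (p + q)) (fun y => F.normalDeriv (F.f α) y (s.1 y)) x).toLinearMap +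
    ((Γ.toFun α x).flip (F.normalDeriv (F.f α) x (s.1 x))).toLinearMap ∘ₗ
      (mvfderiv 𝓘(ℝ, Euc (p + q)) (F.f α) x).toLinearMap

theorem localDeriv_apply (α : ι) (s : F.normalSections) (x : M)
    (v : TangentSpace 𝓘(ℝ, Euc (p + q)) x) :
    Γ.localDeriv α s x v =
      mvfderiv 𝓘(ℝ, Euc (p + q)) (fun y => F.normalDeriv (F.f α) y (s.1 y)) x v +
        Γ.toFun α x (mvfderiv 𝓘(ℝ, Euc (p + q)) (F.f α) x v)
          (F.normalDeriv (F.f α) x (s.1 x)) := rfl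

/-- The isomorphism `ν_x ≃ ℝ^q` given by some Haefliger chart around `x`. -/
def normalEquiv (F : RegularFoliation p q M ι) (x : M) : F.Normal x ≃ₗ[ℝ] Euc q :=
  LinearEquiv.ofBijective (F.normalDeriv (F.f (F.cover x).choose) x)
    ⟨(F.isTransverseChart_haefliger _).normalDeriv_injective (F.cover x).choose_spec,
      (F.isTransverseChart_haefliger _).normalDeriv_surjective (F.cover x).choose_spec⟩

/-- The covariant derivative with the given Christoffel symbols. -/
def deriv (s : F.normalSections) (x : M) :
    TangentSpace 𝓘(ℝ, Euc (p + q)) x →ₗ[ℝ] F.Normal x :=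
  (normalEquiv F x).symm.toLinearMap ∘ₗ Γ.localDeriv (F.cover x).choose s x

/-- By the transformation law, the covariant derivative is given by the same expression in all
Haefliger charts. -/
theorem normalDeriv_deriv {α : ι} {x : M} (hx : x ∈ F.U α) (s : F.normalSections)
    (v : TangentSpace 𝓘(ℝ, Euc (p + q)) x) :
    F.normalDeriv (F.f α) x (Γ.deriv s x v) = Γ.localDeriv α s x v := by
  have hβ : x ∈ F.U (F.cover x).choose := (F.cover x).choose_spec
  have h1 : F.normalDeriv (F.f (F.cover x).choose) x (Γ.deriv s x v) =
      Γ.localDeriv (F.cover x).choose s x v := (normalEquiv F x).apply_symm_apply _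
  obtain ⟨h, hh, he⟩ := F.exists_transition hx hβ
  have hf := F.isTransverseChart_haefliger α
  have hg := F.isTransverseChart_haefliger (F.cover x).choose
  have hnd := (eventually_normalDeriv_transition hf hg hx hβ hh he).self_of_nhds
  rw [hnd, h1, localDeriv_apply, localDeriv_apply,
    mvfderiv_section_transition hf hg hx hβ hh he, hnd,
    (eventually_mvfderiv_transition hg hβ hh he).self_of_nhds, map_add,
    ← Γ.transform α _ x hx hβ h hh he]
  abel

/-- The connection with the given Christoffel symbols. -/
def connection : F.NormalConnection where
  toFun := Γ.deriv
  map_add s s' x := by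
    obtain ⟨α, hx⟩ := F.cover x
    have hf := F.isTransverseChart_haefliger α
    ext v
    refine hf.normalDeriv_injective hx ?_
    have hS : (fun y => F.normalDeriv (F.f α) y ((s + s').1 y)) =
        (fun y => F.normalDeriv (F.f α) y (s.1 y)) +
          fun y => F.normalDeriv (F.f α) y (s'.1 y) := by
      funext y; exact map_add (F.normalDeriv (F.f α) y) _ _
    have hS' := congrFun hS x
    rw [Pi.add_apply] at hS'
    rw [LinearMap.add_apply, map_add, Γ.normalDeriv_deriv hx, Γ.normalDeriv_deriv hx,
      Γ.normalDeriv_deriv hx, localDeriv_apply, localDeriv_apply, localDeriv_apply, hS', hS,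
      mvfderiv_add (hf.mdiff_section s hx) (hf.mdiff_section s' hx), map_add, add_apply]
    abel
  leibniz g hg s s' hs x v := by
    obtain ⟨α, hx⟩ := F.cover x
    have hf := F.isTransverseChart_haefliger α
    refine hf.normalDeriv_injective hx ?_
    have hS : (fun y => F.normalDeriv (F.f α) y (s'.1 y)) =
        fun y => g y • F.normalDeriv (F.f α) y (s.1 y) := by
      funext y; rw [hs y, map_smul]
    have hS' := congrFun hS x
    rw [map_add, map_smul, map_smul, Γ.normalDeriv_deriv hx, Γ.normalDeriv_deriv hx,
      localDeriv_apply, localDeriv_apply, hS', hS,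
      mvfderiv_fun_smul (hg.mdifferentiable (by simp) x) (hf.mdiff_section s hx), map_smul, smul_add,
      add_apply, smul_apply, ContinuousLinearMap.smulRight_apply]
    abel
  smooth X hX s := by
    refine mem_normalSections_of_smooth _ fun x => ?_
    obtain ⟨α, hx⟩ := F.cover x
    have hf := F.isTransverseChart_haefliger α
    refine ⟨_, _, hf, hx, ?_⟩
    have hX' : SmoothFieldOn X (F.U α) := ContMDiffOn.mono hX (Set.subset_univ _)
    have h1 := contMDiffOn_mvfderiv_apply hf.isOpen (hf.smooth_section s) hX'
    have h2 := contMDiffOn_mvfderiv_apply hf.isOpen hf.smooth hX'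
    refine (h1.add (((Γ.smooth α).clm_apply h2).clm_apply (hf.smooth_section s))).congr
      fun y hy => ?_
    rw [Γ.normalDeriv_deriv hy, localDeriv_apply]
    rfl

theorem hasChristoffelAt_connection {α : ι} {x : M} (hx : x ∈ F.U α) :
    HasChristoffelAt Γ.connection (F.f α) x (Γ.toFun α x) :=
  fun s v => Γ.normalDeriv_deriv hx s v

theorem torsion_connection (X Y : smoothFields (p + q) M) (x : M) :
    F.torsion Γ.connection X Y x = 0 := by
  obtain ⟨α, hx⟩ := F.cover x
  have hf := F.isTransverseChart_haefliger α
  refine hf.normalDeriv_injective hx ?_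
  have hpr : ∀ Z : smoothFields (p + q) M, F.normalDeriv (F.f α) x ((F.projSection Z).1 x) =
      mvfderiv 𝓘(ℝ, Euc (p + q)) (F.f α) x (Z.1 x) := fun Z => hf.normalDeriv_proj hx _
  rw [torsion, map_sub, map_sub, hf.normalDeriv_mlieBracket hx,
    Γ.hasChristoffelAt_connection hx, Γ.hasChristoffelAt_connection hx,
    mvfderiv_congr (hf.normalDeriv_projSection hx Y),
    mvfderiv_congr (hf.normalDeriv_projSection hx X), hpr, hpr, map_zero, Γ.symm α x hx]
  abel

/-- A torsion-free connection is a Bott connection, since `pX = 0` for leafwise `X`. -/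
theorem isBott_connection : F.IsBott Γ.connection := by
  intro X Y hX x
  have h1 := Γ.torsion_connection X Y x
  have h2 : F.projSection X = 0 := by
    ext y
    exact (Submodule.Quotient.mk_eq_zero _).2 (hX y)
  have h3 : Γ.connection.toFun (0 : F.normalSections) x = 0 :=
    map_zero (Γ.connection.derivAt x)
  rw [torsion, h2, h3, LinearMap.zero_apply, sub_zero] at h1
  exact sub_eq_zero.1 h1

end ChristoffelFamily

end RegularFoliation

namespace RegularFoliation

variable {p q : ℕ} {M : Type*} [TopologicalSpace M] [ChartedSpace (Euc (p + q)) M]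
  {ι : Type*} {F : RegularFoliation p q M ι}

/-! ### The correspondence between sections and connections -/

theorem exists_jet_eq {k : ℕ} (η : F.Fr k) : ∃ v : F.TransverseEmbedding, v.jet k = η :=
  Quotient.exists_rep η

namespace EquivariantSection

variable (σ : F.EquivariantSection) {u v : F.TransverseEmbedding} {α : ι}

theorem jet_one_eq (h : σ.toFun (u.jet 1) = v.jet 2) : v.jet 1 = u.jet 1 := by
  rw [← TransverseEmbedding.truncate_jet, ← h, σ.isSection]

theorem base_eq (h : σ.toFun (u.jet 1) = v.jet 2) : v 0 = u 0 :=
  TransverseEmbedding.base_eq_of_jet_eq (σ.jet_one_eq h)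

theorem deriv₁_eq (h : σ.toFun (u.jet 1) = v.jet 2) (hα : u 0 ∈ F.U α) :
    v.deriv₁ α = u.deriv₁ α :=
  TransverseEmbedding.deriv₁_eq_of_jet_eq (σ.jet_one_eq h) (by rwa [σ.base_eq h])

/-- By equivariance, the second derivative of `σ(ε)` is a fixed bilinear map evaluated on the
frame `ε`. -/
theorem exists_deriv₂_eq (α : ι) :
    ∃ Γ : M → Euc q →L[ℝ] Euc q →L[ℝ] Euc q,
      ContMDiffOn 𝓘(ℝ, Euc (p + q)) 𝓘(ℝ, Euc q →L[ℝ] Euc q →L[ℝ] Euc q) ∞ Γ (F.U α) ∧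
      ∀ u v : F.TransverseEmbedding, u 0 ∈ F.U α → σ.toFun (u.jet 1) = v.jet 2 →
        ∀ w w', v.deriv₂ α w w' = -Γ (u 0) (u.deriv₁ α w) (u.deriv₁ α w') := by
  obtain ⟨b, hb, h⟩ := σ.smooth α
  refine ⟨fun x => -b (x, ContinuousLinearMap.id ℝ (Euc q)), ?_, fun u v hu huv w w' => ?_⟩
  · have h1 : ContMDiffOn 𝓘(ℝ, Euc (p + q)) (𝓘(ℝ, Euc (p + q)).prod 𝓘(ℝ, Euc q →L[ℝ] Euc q)) ∞
        (fun x : M => (x, ContinuousLinearMap.id ℝ (Euc q))) (F.U α) :=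
      contMDiffOn_id.prodMk contMDiffOn_const
    exact (hb.comp h1 fun x hx => ⟨hx, ContinuousLinearEquiv.refl ℝ (Euc q), rfl⟩).neg
  · -- the frame `u` is the image of the frame `id` under the linear automorphism `A`
    let A := u.deriv₁Equiv hu
    have hv : v 0 ∈ F.U α := by rwa [σ.base_eq huv]
    have hu' : (u.comp A.symm) 0 ∈ F.U α := by rwa [u.comp_zero]
    have h1 : (u.comp A.symm).deriv₁ α = ContinuousLinearMap.id ℝ (Euc q) := by
      ext1 w
      rw [u.deriv₁_comp _ hu]
      exact A.apply_symm_apply w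
    have h2 : σ.toFun ((u.comp A.symm).jet 1) = (v.comp A.symm).jet 2 := by
      rw [← TransverseEmbedding.act_jet, σ.equivariant, huv, TransverseEmbedding.act_jet]
    have h3 := h _ _ hu' h2
    rw [h1, u.comp_zero] at h3
    have h4 := v.deriv₂_comp A.symm hv (A w) (A w')
    rw [h3, A.symm_apply_apply, A.symm_apply_apply] at h4
    rw [← h4, neg_apply, neg_apply, neg_neg]
    rfl

end EquivariantSection

/-- Over every frame there is a `2`-jet whose second derivatives, in all Haefliger charts, are
minus the Christoffel symbols. -/
theorem ChristoffelFamily.exists_embedding (Γ : F.ChristoffelFamily) (u : F.TransverseEmbedding) :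
    ∃ v : F.TransverseEmbedding, v 0 = u 0 ∧ ∀ α, u 0 ∈ F.U α → v.deriv₁ α = u.deriv₁ α ∧
      ∀ w w', v.deriv₂ α w w' = -Γ.toFun α (u 0) (u.deriv₁ α w) (u.deriv₁ α w') := by
  obtain ⟨β, hβ⟩ := F.cover (u 0)
  obtain ⟨v, h0, h1, h2⟩ := u.exists_deriv₂_eq hβ
    (-(Γ.toFun β (u 0)).bilinearComp (u.deriv₁ β) (u.deriv₁ β)) fun e e' =>
      congrArg Neg.neg (Γ.symm β _ hβ _ _)
  refine ⟨v, h0, fun α hα => ?_⟩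
  have h3 : v.jet 1 = u.jet 1 := TransverseEmbedding.jet_one_eq h0 (by rwa [h0]) h1
  refine ⟨TransverseEmbedding.deriv₁_eq_of_jet_eq h3 (by rwa [h0]), fun w w' => ?_⟩
  obtain ⟨h, hh, he⟩ := F.exists_transition hα hβ
  have h4 := Γ.transform α β _ hα hβ h hh he (u.deriv₁ β w) (u.deriv₁ β w')
  have h5 : v.deriv₂ β w w' = -Γ.toFun β (u 0) (u.deriv₁ β w) (u.deriv₁ β w') := by
    rw [h2]; rfl
  rw [v.deriv₂_transition (h0 ▸ hβ) (h0 ▸ hh) (h0 ▸ he), h5, h1, h0, map_neg, ← h4,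
    u.deriv₁_transition hβ hh he]
  simp only [ContinuousLinearMap.comp_apply]
  abel

namespace ChristoffelFamily

variable (Γ : F.ChristoffelFamily)

/-- The `2`-jet over a frame whose second derivatives are minus the Christoffel symbols. -/
def lift (ε : F.Fr 1) : F.Fr 2 := (Γ.exists_embedding (exists_jet_eq ε).choose).choose.jet 2

theorem truncate_lift (ε : F.Fr 1) : (Γ.lift ε).truncate = ε := by
  have h := (Γ.exists_embedding (exists_jet_eq ε).choose).choose_spec
  obtain ⟨α, hα⟩ := F.cover ((exists_jet_eq ε).choose 0)
  have h1 := TransverseEmbedding.jet_one_eq h.1 (by rwa [h.1]) (h.2 α hα).1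
  exact h1.trans (exists_jet_eq ε).choose_spec

theorem deriv₂_eq_of_lift_eq {u v : F.TransverseEmbedding} (h : Γ.lift (u.jet 1) = v.jet 2) {α : ι}
    (hα : u 0 ∈ F.U α) (w w' : Euc q) :
    v.deriv₂ α w w' = -Γ.toFun α (u 0) (u.deriv₁ α w) (u.deriv₁ α w') := by
  have h1 := (Γ.exists_embedding (exists_jet_eq (u.jet 1)).choose).choose_spec
  have h2 := (exists_jet_eq (u.jet 1)).choose_spec
  have hb := TransverseEmbedding.base_eq_of_jet_eq h2
  rw [← TransverseEmbedding.deriv₂_eq_of_jet_eq h (α := α) (by rwa [h1.1, hb]),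
    (h1.2 α (by rwa [hb])).2, TransverseEmbedding.deriv₁_eq_of_jet_eq h2 (by rwa [hb]), hb]

/-- The equivariant section with the given Christoffel symbols. -/
def toSection : F.EquivariantSection where
  toFun := Γ.lift
  isSection := Γ.truncate_lift
  equivariant ε A := by
    obtain ⟨u, rfl⟩ := exists_jet_eq ε
    obtain ⟨v, hv⟩ := exists_jet_eq (Γ.lift (u.jet 1))
    obtain ⟨v', hv'⟩ := exists_jet_eq (Γ.lift ((u.comp A).jet 1))
    obtain ⟨α, hα⟩ := F.cover (u 0)
    have h1 : v.jet 1 = u.jet 1 := by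
      rw [← TransverseEmbedding.truncate_jet, hv, Γ.truncate_lift]
    have h1' : v'.jet 1 = (u.comp A).jet 1 := by
      rw [← TransverseEmbedding.truncate_jet, hv', Γ.truncate_lift]
    have hb : v 0 = u 0 := TransverseEmbedding.base_eq_of_jet_eq h1
    have hb' : v' 0 = u 0 := (TransverseEmbedding.base_eq_of_jet_eq h1').trans (u.comp_zero A)
    have hα' : (u.comp A) 0 ∈ F.U α := by rwa [u.comp_zero]
    rw [TransverseEmbedding.act_jet, ← hv, ← hv', TransverseEmbedding.act_jet]
    refine TransverseEmbedding.jet_two_eq (α := α) (hb'.trans (hb.symm.trans (v.comp_zero A).symm))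
      (by rwa [hb']) ?_ ?_
    · rw [TransverseEmbedding.deriv₁_eq_of_jet_eq h1' (by rwa [hb'])]
      ext1 w
      rw [u.deriv₁_comp A hα, v.deriv₁_comp A (by rwa [hb]),
        TransverseEmbedding.deriv₁_eq_of_jet_eq h1 (by rwa [hb])]
    · ext1 w
      ext1 w'
      rw [v.deriv₂_comp A (by rwa [hb]), Γ.deriv₂_eq_of_lift_eq hv.symm hα,
        Γ.deriv₂_eq_of_lift_eq hv'.symm hα', u.deriv₁_comp A hα, u.deriv₁_comp A hα, u.comp_zero]
  smooth α := by
    refine ⟨fun z => -(Γ.toFun α z.1).bilinearComp z.2 z.2, ?_, fun u v hu h => ?_⟩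
    · refine contMDiffOn_clm_of_apply fun e => contMDiffOn_clm_of_apply fun e' => ?_
      have h1 : ContMDiffOn (𝓘(ℝ, Euc (p + q)).prod 𝓘(ℝ, Euc q →L[ℝ] Euc q))
          𝓘(ℝ, Euc q →L[ℝ] Euc q →L[ℝ] Euc q) ∞
          (fun z : M × (Euc q →L[ℝ] Euc q) => Γ.toFun α z.1)
          {z | z.1 ∈ F.U α ∧ z.2.IsInvertible} :=
        (Γ.smooth α).comp contMDiffOn_fst fun z hz => hz.1
      have h0 : ContMDiffOn (𝓘(ℝ, Euc (p + q)).prod 𝓘(ℝ, Euc q →L[ℝ] Euc q))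
          𝓘(ℝ, Euc q →L[ℝ] Euc q) ∞ (fun z : M × (Euc q →L[ℝ] Euc q) => z.2)
          {z | z.1 ∈ F.U α ∧ z.2.IsInvertible} := contMDiffOn_snd
      have h2 : ∀ e : Euc q, ContMDiffOn (𝓘(ℝ, Euc (p + q)).prod 𝓘(ℝ, Euc q →L[ℝ] Euc q))
          𝓘(ℝ, Euc q) ∞ (fun z : M × (Euc q →L[ℝ] Euc q) => z.2 e)
          {z | z.1 ∈ F.U α ∧ z.2.IsInvertible} :=
        fun e => h0.clm_apply contMDiffOn_const
      exact ((h1.clm_apply (h2 e)).clm_apply (h2 e')).neg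
    · ext1 w
      ext1 w'
      exact Γ.deriv₂_eq_of_lift_eq h hu w w'

end ChristoffelFamily

variable [IsManifold 𝓘(ℝ, Euc (p + q)) ∞ M]

/-- There are transverse embeddings with given base point and first derivative. -/
theorem exists_deriv₁_eq {α : ι} {x : M} (hx : x ∈ F.U α) (A : Euc q ≃L[ℝ] Euc q) :
    ∃ u : F.TransverseEmbedding, u 0 = x ∧ u.deriv₁ α = A := by
  obtain ⟨u, rfl⟩ := F.exists_transverseEmbedding x
  refine ⟨u.comp (A.trans (u.deriv₁Equiv hx).symm), u.comp_zero _, ?_⟩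
  ext1 w
  rw [u.deriv₁_comp _ hx]
  exact (u.deriv₁Equiv hx).apply_symm_apply (A w)

namespace EquivariantSection

variable (σ : F.EquivariantSection) {u v : F.TransverseEmbedding} {α : ι}

/-- The Christoffel symbols defined by an equivariant section. -/
def christoffelFamily : F.ChristoffelFamily where
  toFun α := (σ.exists_deriv₂_eq α).choose
  smooth α := (σ.exists_deriv₂_eq α).choose_spec.1
  symm α x hx e e' := by
    obtain ⟨u, rfl, hu⟩ := exists_deriv₁_eq hx (ContinuousLinearEquiv.refl ℝ (Euc q))
    obtain ⟨v, hv⟩ := exists_jet_eq (σ.toFun (u.jet 1))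
    have h := (σ.exists_deriv₂_eq α).choose_spec.2 u v hx hv.symm
    have h1 := h e e'
    have h2 := h e' e
    rw [hu] at h1 h2
    have h3 := v.deriv₂_symm (α := α) (by rwa [σ.base_eq hv.symm]) e e'
    exact neg_injective (h1.symm.trans (h3.trans h2))
  transform α β x hα hβ h hh he e e' := by
    obtain ⟨u, rfl, hu⟩ := exists_deriv₁_eq hβ (ContinuousLinearEquiv.refl ℝ (Euc q))
    obtain ⟨v, hv⟩ := exists_jet_eq (σ.toFun (u.jet 1))
    have hb := σ.base_eq hv.symm
    have h1 := (σ.exists_deriv₂_eq α).choose_spec.2 u v hα hv.symm e e'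
    have h2 := (σ.exists_deriv₂_eq β).choose_spec.2 u v hβ hv.symm e e'
    have h3 := v.deriv₂_transition (hb ▸ hβ) (hb ▸ hh) (hb ▸ he) e e'
    rw [h1, h2, σ.deriv₁_eq hv.symm hβ, u.deriv₁_transition hβ hh he, hu, hb, map_neg] at h3
    have h4 := sub_eq_zero.2 h3
    rw [← sub_eq_zero, ← neg_eq_zero]
    refine Eq.trans ?_ h4
    simp only [ContinuousLinearMap.comp_apply, ContinuousLinearEquiv.coe_coe,
      ContinuousLinearEquiv.refl_apply]
    abel

theorem deriv₂_eq (h : σ.toFun (u.jet 1) = v.jet 2) (hα : u 0 ∈ F.U α) (w w' : Euc q) :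
    v.deriv₂ α w w' = -σ.christoffelFamily.toFun α (u 0) (u.deriv₁ α w) (u.deriv₁ α w') :=
  (σ.exists_deriv₂_eq α).choose_spec.2 u v hα h w w'

end EquivariantSection

/-- The section `σ` of `Fr_2 → Fr_1` and the connection `D` correspond to each other: the second
derivatives of `σ(ε)` are minus the Christoffel symbols of `D`, evaluated on the frame `ε`. -/
def Corresponds (σ : F.EquivariantSection) (D : F.NormalConnection) : Prop :=
  ∀ u v : F.TransverseEmbedding, σ.toFun (u.jet 1) = v.jet 2 → ∀ α, u 0 ∈ F.U α →
    ∃ Γ, HasChristoffelAt D (F.f α) (u 0) Γ ∧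
      ∀ w w', v.deriv₂ α w w' = -Γ (u.deriv₁ α w) (u.deriv₁ α w')

theorem exists_connection_corresponds (σ : F.EquivariantSection) :
    ∃ D : F.TorsionFreeBottConnection, Corresponds σ D.1 :=
  ⟨⟨σ.christoffelFamily.connection, σ.christoffelFamily.isBott_connection,
    σ.christoffelFamily.torsion_connection⟩, fun _ _ h _ hα =>
      ⟨_, σ.christoffelFamily.hasChristoffelAt_connection hα, σ.deriv₂_eq h hα⟩⟩

theorem Corresponds.connection_unique {σ : F.EquivariantSection} {D D' : F.NormalConnection}
    (h : Corresponds σ D) (h' : Corresponds σ D') : D = D' := by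
  ext s x : 3
  ext t
  obtain ⟨α, hα⟩ := F.cover x
  obtain ⟨u, rfl, hu⟩ := exists_deriv₁_eq hα (ContinuousLinearEquiv.refl ℝ (Euc q))
  obtain ⟨v, hv⟩ := exists_jet_eq (σ.toFun (u.jet 1))
  obtain ⟨Γ, hΓ, h1⟩ := h u v hv.symm α hα
  obtain ⟨Γ', hΓ', h1'⟩ := h' u v hv.symm α hα
  have h2 : Γ = Γ' := by
    ext1 e
    ext1 e'
    have h3 := (h1 e e').symm.trans (h1' e e')
    rw [hu] at h3
    exact neg_injective h3
  refine (F.isTransverseChart_haefliger α).normalDeriv_injective hα ?_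
  rw [hΓ, hΓ', h2]

variable [T2Space M]

/-- The Christoffel symbols of a torsion-free Bott connection. -/
def christoffelFamilyOfConnection (D : F.TorsionFreeBottConnection) : F.ChristoffelFamily where
  toFun α := ((F.isTransverseChart_haefliger α).exists_christoffel D).choose
  smooth α := ((F.isTransverseChart_haefliger α).exists_christoffel D).choose_spec.1
  symm α x hx := (((F.isTransverseChart_haefliger α).exists_christoffel D).choose_spec.2 x hx).1
  transform α β x hα hβ _ hh he :=
    HasChristoffelAt.transform (F.isTransverseChart_haefliger α) (F.isTransverseChart_haefliger β)
      hα hβ hh he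
      (((F.isTransverseChart_haefliger α).exists_christoffel D).choose_spec.2 x hα).2
      (((F.isTransverseChart_haefliger β).exists_christoffel D).choose_spec.2 x hβ).2

theorem exists_section_corresponds (D : F.TorsionFreeBottConnection) :
    ∃ σ : F.EquivariantSection, Corresponds σ D.1 :=
  ⟨(christoffelFamilyOfConnection D).toSection, fun u _ h α hα =>
    ⟨_, (((F.isTransverseChart_haefliger α).exists_christoffel D).choose_spec.2 (u 0) hα).2,
      (christoffelFamilyOfConnection D).deriv₂_eq_of_lift_eq h hα⟩⟩

theorem Corresponds.section_unique {σ σ' : F.EquivariantSection} {D : F.NormalConnection}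
    (h : Corresponds σ D) (h' : Corresponds σ' D) : σ = σ' := by
  ext ε
  obtain ⟨u, rfl⟩ := exists_jet_eq ε
  obtain ⟨v, hv⟩ := exists_jet_eq (σ.toFun (u.jet 1))
  obtain ⟨v', hv'⟩ := exists_jet_eq (σ'.toFun (u.jet 1))
  obtain ⟨α, hα⟩ := F.cover (u 0)
  obtain ⟨Γ, hΓ, h1⟩ := h u v hv.symm α hα
  obtain ⟨Γ', hΓ', h1'⟩ := h' u v' hv'.symm α hα
  have h2 := (F.isTransverseChart_haefliger α).christoffel_unique hα hΓ hΓ'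
  have hb := σ.base_eq hv.symm
  rw [← hv, ← hv']
  refine TransverseEmbedding.jet_two_eq (α := α) (hb.trans (σ'.base_eq hv'.symm).symm)
    (by rwa [hb]) ((σ.deriv₁_eq hv.symm hα).trans (σ'.deriv₁_eq hv'.symm hα).symm) ?_
  ext1 w
  ext1 w'
  rw [h1, h1', h2]

variable (F) in
/-- The bijection between the equivariant sections and the torsion-free Bott connections. -/
def sectionEquivConnection : F.EquivariantSection ≃ F.TorsionFreeBottConnection where
  toFun σ := (exists_connection_corresponds σ).choose
  invFun D := (exists_section_corresponds D).choose
  left_inv σ := (exists_section_corresponds _).choose_spec.section_unique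
    (exists_connection_corresponds σ).choose_spec
  right_inv D := Subtype.ext ((exists_connection_corresponds _).choose_spec.connection_unique
    (exists_section_corresponds D).choose_spec)

theorem corresponds_sectionEquivConnection (σ : F.EquivariantSection) :
    Corresponds σ (F.sectionEquivConnection σ).1 := (exists_connection_corresponds σ).choose_spec

theorem corresponds_sectionEquivConnection_symm (D : F.TorsionFreeBottConnection) :
    Corresponds (F.sectionEquivConnection.symm D) D.1 := (exists_section_corresponds D).choose_spec

end RegularFoliation

namespace RegularFoliation

variable {p q : ℕ} {M : Type*} [TopologicalSpace M] [ChartedSpace (Euc (p + q)) M]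
  {ι : Type*} {F : RegularFoliation p q M ι}

/-! ### The tautological form and the connection form -/

/-- A left inverse of a local diffeomorphism of `ℝ^q` is smooth. -/
theorem contDiffAt_of_leftInverse {k g : Euc q → Euc q} (hk : ContDiffAt ℝ ∞ k 0)
    {A : Euc q ≃L[ℝ] Euc q} (hA : fderiv ℝ k 0 = A) (hg : ∀ᶠ s in 𝓝 0, g (k s) = s) :
    ContDiffAt ℝ ∞ g (k 0) := by
  have hd : HasFDerivAt k (A : Euc q →L[ℝ] Euc q) 0 := by
    rw [← hA]; exact (hk.differentiableAt (by simp)).hasFDerivAt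
  have hs := hk.hasStrictFDerivAt' hd (by simp)
  refine (hk.to_localInverse hd (by simp)).congr_of_eventuallyEq ?_
  have h1 := hs.map_nhds_eq_of_equiv
  change ∀ᶠ y in 𝓝 (k 0), g y = hk.localInverse hd (by simp) y
  rw [← h1, Filter.eventually_map]
  filter_upwards [hg, hs.eventually_left_inverse] with s h h'
  exact h.trans h'.symm

theorem fderiv_leftInverse {k g : Euc q → Euc q} (hk : ContDiffAt ℝ ∞ k 0)
    (hgs : ContDiffAt ℝ ∞ g (k 0)) (hg : ∀ᶠ s in 𝓝 0, g (k s) = s) (w : Euc q) :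
    fderiv ℝ g (k 0) (fderiv ℝ k 0 w) = w := by
  have hid : (fun s => g (k s)) =ᶠ[𝓝 0] id := hg
  have h1 := fderiv_comp (g := g) (f := k) 0 (hgs.differentiableAt (by simp))
    (hk.differentiableAt (by simp))
  have h2 := congrArg (fun L : Euc q →L[ℝ] Euc q => L w) (h1.symm.trans hid.fderiv_eq)
  rw [fderiv_id] at h2
  exact h2

/-- The second derivative of an inverse `g` of `k`, from differentiating `g ∘ k = id` twice. -/
theorem fderiv_fderiv_leftInverse {k g : Euc q → Euc q} (hk : ContDiffAt ℝ ∞ k 0)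
    (hgs : ContDiffAt ℝ ∞ g (k 0)) (hg : ∀ᶠ s in 𝓝 0, g (k s) = s) (w w' : Euc q) :
    fderiv ℝ (fderiv ℝ g) (k 0) (fderiv ℝ k 0 w) (fderiv ℝ k 0 w') =
      -fderiv ℝ g (k 0) (fderiv ℝ (fderiv ℝ k) 0 w w') := by
  have hid : (fun s => g (k s)) =ᶠ[𝓝 0] id := hg
  have h6 := fderiv_fderiv_comp (hgs.of_le two_le_infty) (hk.of_le two_le_infty) w w'
  have h7 : fderiv ℝ (id : Euc q → Euc q) = fun _ => ContinuousLinearMap.id ℝ (Euc q) :=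
    funext fun s => fderiv_id
  rw [hid.fderiv.fderiv_eq, h7] at h6
  simp only [fderiv_fun_const, Pi.zero_apply, zero_apply] at h6
  exact eq_neg_of_add_eq_zero_left h6.symm

theorem hasDerivAt_fderiv_comp {g : Euc q → Euc q} {y : ℝ → Euc q} {η : Euc q}
    {A : ℝ → Euc q →L[ℝ] Euc q} {A' : Euc q →L[ℝ] Euc q} (hg : ContDiffAt ℝ ∞ g (y 0))
    (hy : HasDerivAt y η 0) (hA : HasDerivAt A A' 0) :
    HasDerivAt (fun t => (fderiv ℝ g (y t)).comp (A t))
      ((fderiv ℝ (fderiv ℝ g) (y 0) η).comp (A 0) + (fderiv ℝ g (y 0)).comp A') 0 := by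
  have h2 : DifferentiableAt ℝ (fderiv ℝ g) (y 0) :=
    (hg.fderiv_right (m := 1) (by rw [one_add_one_eq_two]; exact two_le_infty)).differentiableAt
      (by simp)
  exact (h2.hasFDerivAt.comp_hasDerivAt (0 : ℝ) hy).clm_comp hA

namespace TransverseEmbedding

theorem frame_bijective (u : F.TransverseEmbedding) : Function.Bijective u.frame := by
  refine ⟨u.frame_injective, fun t => ?_⟩
  obtain ⟨α, hα⟩ := F.cover (u 0)
  obtain ⟨e, he⟩ := (u.deriv₁_bijective hα).2 (F.normalDeriv (F.f α) (u 0) t)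
  refine ⟨e, (F.isTransverseChart_haefliger α).normalDeriv_injective hα ?_⟩
  rw [u.normalDeriv_frame hα, he]

end TransverseEmbedding

section Curves

variable {α : ι} {u v : ℝ → F.TransverseEmbedding}

/-- The tautological form on a curve of `2`-jets in terms of the first and second derivatives
`A`, `B` in a Haefliger chart: it is `A⁻¹ (A' - B (A⁻¹ ξ, ·))`, where `ξ` is the velocity of the base
curve. -/
theorem hasDerivAt_tautological {A' Ω : Euc q →L[ℝ] Euc q} {η : Euc q}
    (hα : ∀ᶠ t in 𝓝 0, v t 0 ∈ F.U α)
    (hv : HasDerivAt (fun t => (v t).deriv₁ α) A' 0)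
    (hb : HasDerivAt (fun t => F.f α (v t 0)) ((v 0).deriv₁ α η) 0)
    (hΩ : ∀ w, (v 0).deriv₁ α (Ω w) = A' w - (v 0).deriv₂ α η w) {g : Euc q → Euc q}
    (hg : ∀ᶠ s in 𝓝 0, g (F.f α (v 0 s)) = s) :
    HasDerivAt (fun t => fderiv ℝ (fun s => g (F.f α (v t s))) 0) Ω 0 := by
  have h0 : v 0 0 ∈ F.U α := hα.self_of_nhds
  have hk := (v 0).contDiffAt_haefliger h0
  have hgs : ContDiffAt ℝ ∞ g (F.f α (v 0 0)) :=
    contDiffAt_of_leftInverse hk ((v 0).coe_deriv₁Equiv h0).symm hg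
  have hgd : ∀ᶠ t in 𝓝 0, DifferentiableAt ℝ g (F.f α (v t 0)) := by
    refine hb.continuousAt.eventually ?_
    filter_upwards [(hgs.of_le (m := 1) (by simp)).eventually (by simp)] with z hz
    exact hz.differentiableAt (by simp)
  have h1 : (fun t => fderiv ℝ (fun s => g (F.f α (v t s))) 0) =ᶠ[𝓝 0]
      fun t => (fderiv ℝ g (F.f α (v t 0))).comp ((v t).deriv₁ α) := by
    filter_upwards [hα, hgd] with t ht htd
    exact fderiv_comp (g := g) 0 htd (((v t).contDiffAt_haefliger ht).differentiableAt (by simp))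
  have h3 := hasDerivAt_fderiv_comp (y := fun t => F.f α (v t 0)) hgs hb hv
  refine (h3.congr_of_eventuallyEq h1).congr_deriv ?_
  ext1 w
  have h8 : fderiv ℝ (fderiv ℝ g) (F.f α (v 0 0)) ((v 0).deriv₁ α η) ((v 0).deriv₁ α w) =
      -fderiv ℝ g (F.f α (v 0 0)) ((v 0).deriv₂ α η w) :=
    fderiv_fderiv_leftInverse hk hgs hg η w
  have h9 : fderiv ℝ g (F.f α (v 0 0)) ((v 0).deriv₁ α (Ω w)) = Ω w :=
    fderiv_leftInverse hk hgs hg (Ω w)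
  rw [hΩ, map_sub] at h9
  rw [add_apply, ContinuousLinearMap.comp_apply, ContinuousLinearMap.comp_apply, h8, ← h9]
  abel

variable [IsManifold 𝓘(ℝ, Euc (p + q)) ∞ M]

/-- The connection form in terms of the Christoffel symbols. -/
theorem isConnectionFormValue {D : F.NormalConnection} {A' Ω : Euc q →L[ℝ] Euc q} {η : Euc q}
    {Γ : Euc q →L[ℝ] Euc q →L[ℝ] Euc q} (hD : HasChristoffelAt D (F.f α) (u 0 0) Γ)
    (hα : ∀ᶠ t in 𝓝 0, u t 0 ∈ F.U α)
    (hγ : MDifferentiableAt 𝓘(ℝ, ℝ) 𝓘(ℝ, Euc (p + q)) (fun t => u t 0) 0)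
    (hu : HasDerivAt (fun t => (u t).deriv₁ α) A' 0)
    (hη : mvfderiv 𝓘(ℝ, Euc (p + q)) (F.f α) (u 0 0)
      (mfderiv 𝓘(ℝ, ℝ) 𝓘(ℝ, Euc (p + q)) (fun t => u t 0) 0 (1 : ℝ)) = (u 0).deriv₁ α η)
    (hΩ : ∀ w, (u 0).deriv₁ α (Ω w) = A' w + Γ ((u 0).deriv₁ α η) ((u 0).deriv₁ α w)) :
    F.IsConnectionFormValue D u Ω := by
  intro s c hc
  have h0 : u 0 0 ∈ F.U α := hα.self_of_nhds
  have hf := F.isTransverseChart_haefliger α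
  have hS := hasDerivAt_comp_mvfderiv (γ := fun t => u t 0) (t := 0) (hf.mdiff_section s h0) hγ
  have hAc : ∀ᶠ t in 𝓝 0, (u t).deriv₁ α (c t) = F.normalDeriv (F.f α) (u t 0) (s.1 (u t 0)) := by
    filter_upwards [hα] with t ht
    rw [← hc t, (u t).normalDeriv_frame ht]
  -- the coefficients `c` are differentiable since `c = A⁻¹ S`, with `S` representing the section
  have hinv : DifferentiableAt ℝ (fun t => ((u t).deriv₁ α).inverse) 0 := by
    have h1 : ContDiffAt ℝ 1 ContinuousLinearMap.inverse
        ((u 0).deriv₁Equiv h0 : Euc q →L[ℝ] Euc q) := contDiffAt_map_inverse _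
    exact DifferentiableAt.comp (0 : ℝ) (g := ContinuousLinearMap.inverse)
      (h1.differentiableAt (by simp)) hu.differentiableAt
  have hcd : DifferentiableAt ℝ c 0 := by
    refine (hinv.clm_apply hS.differentiableAt).congr_of_eventuallyEq ?_
    filter_upwards [hα, hAc] with t ht htc
    rw [← htc, ← (u t).coe_deriv₁Equiv ht, ContinuousLinearMap.inverse_equiv]
    exact (((u t).deriv₁Equiv ht).symm_apply_apply _).symm
  refine ⟨deriv c 0, hcd.hasDerivAt, hf.normalDeriv_injective h0 ?_⟩
  have h1 := (hS.congr_of_eventuallyEq hAc).unique (hu.clm_apply hcd.hasDerivAt)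
  have h2 := hD s (mfderiv 𝓘(ℝ, ℝ) 𝓘(ℝ, Euc (p + q)) (fun t => u t 0) 0 (1 : ℝ))
  rw [(u 0).normalDeriv_frame h0, map_add, hΩ]
  refine h2.trans ?_
  rw [hη, ← hAc.self_of_nhds]
  refine (congrArg (· + _) h1).trans ?_
  abel

variable [T2Space M]

/-- The value of the connection form is unique: sections of `ν` take all values. -/
theorem IsConnectionFormValue.unique {D : F.NormalConnection} {Ω Ω' : Euc q →L[ℝ] Euc q}
    (h : F.IsConnectionFormValue D u Ω) (h' : F.IsConnectionFormValue D u Ω') : Ω = Ω' := by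
  ext1 w
  obtain ⟨α, hα⟩ := F.cover (u 0 0)
  have hf := F.isTransverseChart_haefliger α
  obtain ⟨s, hs⟩ := hf.exists_section hα (F.normalDeriv (F.f α) (u 0 0) ((u 0).frame w))
  choose c hc using fun t => (u t).frame_bijective.2 (s.1 (u t 0))
  have hc0 : c 0 = w := (u 0).frame_injective ((hc 0).trans (hf.normalDeriv_injective hα hs))
  obtain ⟨c', h1, h2⟩ := h s c hc
  obtain ⟨c'', h1', h2'⟩ := h' s c hc
  have h3 := (u 0).frame_injective (h2.symm.trans h2')
  rw [h1.unique h1', hc0] at h3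
  exact add_left_cancel h3

/-- The pullback of the tautological form by the section corresponding to a connection is the
connection form. -/
theorem Corresponds.pullsBackToConnectionForm {σ : F.EquivariantSection} {D : F.NormalConnection}
    (h : Corresponds σ D) : F.PullsBackToConnectionForm σ D := by
  intro u v hu huv
  have hb : ∀ t, v t 0 = u t 0 := fun t => σ.base_eq (huv t)
  have hγ : MDifferentiableAt 𝓘(ℝ, ℝ) 𝓘(ℝ, Euc (p + q)) (fun t => u t 0) 0 :=
    hu.1.mdifferentiable (by simp) 0
  have key : ∀ α, u 0 0 ∈ F.U α → ∃ Ω, F.IsConnectionFormValue D u Ω ∧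
      ∀ g : Euc q → Euc q, (∀ᶠ s in 𝓝 0, g (F.f α (v 0 s)) = s) →
        HasDerivAt (fun t => fderiv ℝ (fun s => g (F.f α (v t s))) 0) Ω 0 := by
    intro α h0
    have hα : ∀ᶠ t in 𝓝 0, u t 0 ∈ F.U α :=
      hγ.continuousAt.eventually ((F.isOpen_U α).mem_nhds h0)
    have hα' : ∀ᶠ t in 𝓝 0, v t 0 ∈ F.U α := by simpa only [hb] using hα
    have hA : (fun t => (v t).deriv₁ α) =ᶠ[𝓝 0] fun t => (u t).deriv₁ α := by
      filter_upwards [hα] with t ht using σ.deriv₁_eq (huv t) ht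
    have hA' := ((hu.2 α 0 h0).differentiableAt (by simp)).hasDerivAt
    have hA0 : (v 0).deriv₁ α = (u 0).deriv₁ α := hA.self_of_nhds
    let A := (u 0).deriv₁Equiv h0
    let ξ : Euc q := mvfderiv 𝓘(ℝ, Euc (p + q)) (F.f α) (u 0 0)
      (mfderiv 𝓘(ℝ, ℝ) 𝓘(ℝ, Euc (p + q)) (fun t => u t 0) 0 (1 : ℝ))
    have hξ : (u 0).deriv₁ α (A.symm ξ) = ξ := A.apply_symm_apply ξ
    obtain ⟨Γ, hΓ, hB⟩ := h (u 0) (v 0) (huv 0) α h0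
    let Ω : Euc q →L[ℝ] Euc q := (A.symm : Euc q →L[ℝ] Euc q).comp
      (deriv (fun t => (u t).deriv₁ α) 0 - (v 0).deriv₂ α (A.symm ξ))
    have hΩ : ∀ w, (u 0).deriv₁ α (Ω w) =
        deriv (fun t => (u t).deriv₁ α) 0 w - (v 0).deriv₂ α (A.symm ξ) w :=
      fun w => A.apply_symm_apply _
    refine ⟨Ω, isConnectionFormValue hΓ hα hγ hA' hξ.symm fun w => ?_, fun g hg =>
      hasDerivAt_tautological (η := A.symm ξ) hα' (hA'.congr_of_eventuallyEq hA) ?_ ?_ hg⟩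
    · rw [hΩ, hB, sub_neg_eq_add]
    · rw [hA0, hξ]
      simp only [hb]
      exact hasDerivAt_comp_mvfderiv (γ := fun t => u t 0)
        ((F.isTransverseChart_haefliger α).mdiff h0) hγ
    · rw [hA0]
      exact hΩ
  -- by uniqueness of the connection form, the values `Ω` in all Haefliger charts agree
  obtain ⟨α, hα⟩ := F.cover (u 0 0)
  obtain ⟨Ω, hΩ, -⟩ := key α hα
  refine ⟨Ω, fun β hβ => ?_, hΩ⟩
  obtain ⟨Ω', hΩ', h1⟩ := key β (hb 0 ▸ hβ)
  rw [hΩ.unique hΩ']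
  exact h1

end Curves

end RegularFoliation

/-! ### Geodesics of a connection on a normed space -/

section Geodesics

variable {E : Type*} [NormedAddCommGroup E] [NormedSpace ℝ E]

/-- A solution `z : [0, 1] → E` of the geodesic equation `z'' = -H(z)(z', z')`, with initial point
`a` and initial velocity `b`; `z'` is its velocity. -/
structure IsGeodesicPath (H : E → E →L[ℝ] E →L[ℝ] E) (a b : E) (z z' : ℝ → E) : Prop where
  init : z 0 = a
  init' : z' 0 = b
  hasDeriv : ∀ t ∈ Set.Icc (0 : ℝ) 1, HasDerivWithinAt z (z' t) (Set.Icc 0 1) t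
  hasDeriv' : ∀ t ∈ Set.Icc (0 : ℝ) 1,
    HasDerivWithinAt z' (-H (z t) (z' t) (z' t)) (Set.Icc 0 1) t

variable {H : E → E →L[ℝ] E →L[ℝ] E} {a b : E} {z z' : ℝ → E}

/-- Geodesics with small initial velocity stay close to the initial point: on the boundary of the
region where `(z - a, z')` is bounded by `ε e ^ (2 t)`, its derivative is less than `2 ε e ^ (2 t)`,
because `H` is quadratic in the velocity. -/
theorem IsGeodesicPath.norm_le (h : IsGeodesicPath H a b z z') {C r ε : ℝ} (hC : 0 ≤ C)
    (hH : ∀ x, ‖x - a‖ < r → ‖H x‖ ≤ C) (hε : 0 < ε) (hb : ‖b‖ ≤ ε) (hr : Real.exp 2 * ε < r)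
    (hCε : C * (Real.exp 2 * ε) < 2) {t : ℝ} (ht : t ∈ Set.Icc (0 : ℝ) 1) :
    ‖z t - a‖ ≤ Real.exp 2 * ε ∧ ‖z' t‖ ≤ Real.exp 2 * ε := by
  have hB : ∀ t : ℝ, HasDerivAt (fun t => ε * Real.exp (2 * t)) (2 * (ε * Real.exp (2 * t))) t := by
    intro t
    have h1 := (((hasDerivAt_id t).const_mul 2).exp).const_mul ε
    refine h1.congr_deriv ?_
    simp only [id, mul_one]
    ring
  have hle : ∀ t ∈ Set.Icc (0 : ℝ) 1, ε * Real.exp (2 * t) ≤ Real.exp 2 * ε := by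
    intro t ht
    rw [mul_comm]
    exact mul_le_mul_of_nonneg_right (Real.exp_le_exp.2 (by linarith [ht.2])) hε.le
  have hd : ∀ t ∈ Set.Icc (0 : ℝ) 1, HasDerivWithinAt (fun t => (z t - a, z' t))
      (z' t, -H (z t) (z' t) (z' t)) (Set.Icc 0 1) t := fun t ht =>
    ((h.hasDeriv t ht).sub_const a).prodMk (h.hasDeriv' t ht)
  have key := image_norm_le_of_norm_deriv_right_lt_deriv_boundary
    (f := fun t => (z t - a, z' t)) (f' := fun t => (z' t, -H (z t) (z' t) (z' t)))
    (a := 0) (b := 1) (fun t ht => (hd t ht).continuousWithinAt)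
    (fun t ht => (hd t (Set.Ico_subset_Icc_self ht)).mono_of_mem_nhdsWithin
      (Icc_mem_nhdsGE_of_mem ht))
    (B := fun t => ε * Real.exp (2 * t)) (B' := fun t => 2 * (ε * Real.exp (2 * t)))
    (by simpa [h.init, h.init', Prod.norm_def] using hb) hB (fun t ht hn => by
      have ht' := Set.Ico_subset_Icc_self ht
      have hpos : 0 < ε * Real.exp (2 * t) := mul_pos hε (Real.exp_pos _)
      have h1 : ‖z t - a‖ ≤ ε * Real.exp (2 * t) := hn ▸ norm_fst_le (z t - a, z' t)
      have h2 : ‖z' t‖ ≤ ε * Real.exp (2 * t) := hn ▸ norm_snd_le (z t - a, z' t)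
      have h3 : ‖H (z t)‖ ≤ C := hH _ ((h1.trans (hle t ht')).trans_lt hr)
      have h4 : ‖H (z t) (z' t) (z' t)‖ ≤ C * (ε * Real.exp (2 * t)) * (ε * Real.exp (2 * t)) :=
        ((H (z t)).le_opNorm₂ _ _).trans (by gcongr)
      have h5 : C * (ε * Real.exp (2 * t)) < 2 :=
        (mul_le_mul_of_nonneg_left (hle t ht') hC).trans_lt hCε
      rw [Prod.norm_def, max_lt_iff, norm_neg]
      exact ⟨by linarith, h4.trans_lt (mul_lt_mul_of_pos_right h5 hpos)⟩)
  have h6 := (key ht).trans (hle t ht)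
  exact ⟨(norm_fst_le (z t - a, z' t)).trans h6, (norm_snd_le (z t - a, z' t)).trans h6⟩

theorem exists_norm_le_of_continuousAt (hH : ContinuousAt H a) {ε : ℝ} (hε : 0 < ε) :
    ∃ r > 0, ∀ x, ‖x - a‖ < r → ‖H x‖ ≤ ‖H a‖ + 1 ∧ ‖H a - H x‖ ≤ ε := by
  obtain ⟨r, hr, h⟩ := (Metric.continuousAt_iff (f := H) (a := a)).1 hH (min ε 1)
    (lt_min hε one_pos)
  refine ⟨r, hr, fun x hx => ?_⟩
  have h1 : ‖H x - H a‖ < min ε 1 :=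
    (dist_eq_norm (H x) (H a)).symm.trans_lt (h (x := x) (by rwa [dist_eq_norm]))
  rw [lt_min_iff] at h1
  refine ⟨?_, (norm_sub_rev (H a) (H x)).trans_le h1.1.le⟩
  have h2 := norm_sub_norm_le (H x) (H a)
  linarith

/-- Geodesics with small initial velocity `b` stay at a distance `O(‖b‖)` of the initial point. -/
theorem exists_forall_isGeodesicPath_norm_le (hH : ContinuousAt H a) :
    ∃ δ > 0, ∀ b z z', ‖b‖ < δ → IsGeodesicPath H a b z z' → ∀ t ∈ Set.Icc (0 : ℝ) 1,
      ‖z t - a‖ ≤ Real.exp 2 * ‖b‖ ∧ ‖z' t‖ ≤ Real.exp 2 * ‖b‖ := by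
  obtain ⟨r, hr, hrH⟩ := exists_norm_le_of_continuousAt hH one_pos
  have hC : 0 < ‖H a‖ + 1 := by positivity
  have he := Real.exp_pos 2
  refine ⟨min (r / Real.exp 2) (2 / ((‖H a‖ + 1) * Real.exp 2)),
    lt_min (by positivity) (by positivity), fun b z z' hb h t ht => ?_⟩
  -- the estimate holds with any `ε > ‖b‖` instead of `‖b‖`, which may vanish
  have h1 : ∀ᶠ ε in 𝓝[>] ‖b‖, ‖z t - a‖ ≤ Real.exp 2 * ε ∧ ‖z' t‖ ≤ Real.exp 2 * ε := by
    filter_upwards [Ioo_mem_nhdsGT hb] with ε hε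
    have h2 := hε.2.trans_le (min_le_left _ _)
    have h3 := hε.2.trans_le (min_le_right _ _)
    rw [lt_div_iff₀ he] at h2
    rw [lt_div_iff₀ (by positivity)] at h3
    exact h.norm_le hC.le (fun x hx => (hrH x hx).1)
      ((norm_nonneg b).trans_lt hε.1) hε.1.le (by linarith) (by linarith) ht
  have h4 : Filter.Tendsto (fun ε => Real.exp 2 * ε) (𝓝[>] ‖b‖) (𝓝 (Real.exp 2 * ‖b‖)) :=
    ((continuous_const.mul continuous_id).tendsto _).mono_left nhdsWithin_le_nhds
  exact ⟨ge_of_tendsto h4 (h1.mono fun _ h => h.1), ge_of_tendsto h4 (h1.mono fun _ h => h.2)⟩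

/-- The second-order expansion of the exponential map: `exp(b) = a + b - ½ H(a)(b, b) + o(|b|²)`. -/
theorem exists_forall_isGeodesicPath_expansion (hH : ContinuousAt H a) {η : ℝ} (hη : 0 < η) :
    ∃ δ > 0, ∀ b z z', ‖b‖ < δ → IsGeodesicPath H a b z z' →
      ‖z 1 - a - b + (2⁻¹ : ℝ) • H a b b‖ ≤ η * ‖b‖ ^ 2 := by
  obtain ⟨δ, hδ, hbd⟩ := exists_forall_isGeodesicPath_norm_le hH
  have he := Real.exp_pos 2
  set K := Real.exp 2 with hK
  set C := ‖H a‖ + 1 with hC'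
  have hC : 0 < C := by positivity
  obtain ⟨r, hr, hrH⟩ := exists_norm_le_of_continuousAt hH (ε := η / (2 * K ^ 2)) (by positivity)
  refine ⟨min δ (min (r / K) (η / (2 * (C ^ 2 * K ^ 2 * (1 + K))))),
    lt_min hδ (lt_min (by positivity) (by positivity)), fun b z z' hb h => ?_⟩
  have hb1 := hb.trans_le (min_le_left _ _)
  have hb2 := hb.trans_le ((min_le_right _ _).trans (min_le_left _ _))
  have hb3 := hb.trans_le ((min_le_right _ _).trans (min_le_right _ _))
  rw [lt_div_iff₀ he] at hb2
  rw [lt_div_iff₀ (by positivity)] at hb3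
  have hn := hbd b z z' hb1 h
  have hball : ∀ t ∈ Set.Icc (0 : ℝ) 1, ‖H (z t)‖ ≤ C ∧ ‖H a - H (z t)‖ ≤ η / (2 * K ^ 2) := by
    intro t ht
    exact hrH (z t) ((hn t ht).1.trans_lt (by linarith))
  have hvel : ∀ t ∈ Set.Icc (0 : ℝ) 1, ‖z' t - b‖ ≤ C * (K * ‖b‖) * (K * ‖b‖) := by
    intro t ht
    have h1 := norm_image_sub_le_of_norm_deriv_le_segment' (C := C * (K * ‖b‖) * (K * ‖b‖))
      h.hasDeriv' (fun t ht => by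
      have ht' := Set.Ico_subset_Icc_self ht
      rw [norm_neg]
      refine ((H (z t)).le_opNorm₂ _ _).trans ?_
      have h2 := (hn t ht').2
      have h3 := (hball t ht').1
      calc ‖H (z t)‖ * ‖z' t‖ * ‖z' t‖ ≤ C * (K * ‖b‖) * (K * ‖b‖) := by gcongr) t ht
    rw [h.init', sub_zero] at h1
    refine h1.trans (mul_le_of_le_one_right (by positivity) ht.2)
  -- the acceleration differs from `-H(a)(b, b)` by at most `η ‖b‖²`; integrate twice
  have hacc : ∀ t ∈ Set.Icc (0 : ℝ) 1, ‖H a b b - H (z t) (z' t) (z' t)‖ ≤ η * ‖b‖ ^ 2 := by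
    intro t ht
    have h1 : H a b b - H (z t) (z' t) (z' t) =
        -H a b (z' t - b) - H a (z' t - b) (z' t) + (H a - H (z t)) (z' t) (z' t) := by
      simp only [map_sub, sub_apply]
      abel
    have h2 := hvel t ht
    have h3 := (hn t ht).2
    have h4 := (hball t ht).2
    have hHa : ‖H a‖ ≤ C := by rw [hC']; linarith
    have e1 : ‖H a b (z' t - b)‖ ≤ C * ‖b‖ * (C * (K * ‖b‖) * (K * ‖b‖)) :=
      ((H a).le_opNorm₂ _ _).trans (by gcongr)
    have e2 : ‖H a (z' t - b) (z' t)‖ ≤ C * (C * (K * ‖b‖) * (K * ‖b‖)) * (K * ‖b‖) :=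
      ((H a).le_opNorm₂ _ _).trans (by gcongr)
    have e3 : ‖(H a - H (z t)) (z' t) (z' t)‖ ≤ η / (2 * K ^ 2) * (K * ‖b‖) * (K * ‖b‖) :=
      ((H a - H (z t)).le_opNorm₂ _ _).trans (by gcongr)
    have e4 : η / (2 * K ^ 2) * (K * ‖b‖) * (K * ‖b‖) = η / 2 * ‖b‖ ^ 2 := by
      field_simp
    have e5 : C * ‖b‖ * (C * (K * ‖b‖) * (K * ‖b‖)) + C * (C * (K * ‖b‖) * (K * ‖b‖)) * (K * ‖b‖) =
        ‖b‖ * (C ^ 2 * K ^ 2 * (1 + K)) * ‖b‖ ^ 2 := by ring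
    have e6 : ‖b‖ * (C ^ 2 * K ^ 2 * (1 + K)) * ‖b‖ ^ 2 ≤ η / 2 * ‖b‖ ^ 2 :=
      mul_le_mul_of_nonneg_right (by linarith) (by positivity)
    rw [h1]
    refine (norm_add_le _ _).trans ?_
    have e7 := norm_sub_le (-H a b (z' t - b)) (H a (z' t - b) (z' t))
    rw [norm_neg] at e7
    linarith
  have hk' : ∀ t ∈ Set.Icc (0 : ℝ) 1, HasDerivWithinAt (fun t => z' t - b + t • H a b b)
      (H a b b - H (z t) (z' t) (z' t)) (Set.Icc 0 1) t := by
    intro t ht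
    have h1 := ((h.hasDeriv' t ht).sub_const b).add
      ((hasDerivWithinAt_id t (Set.Icc 0 1)).smul_const (H a b b))
    refine h1.congr_deriv ?_
    rw [one_smul]; abel
  have hk : ∀ t ∈ Set.Icc (0 : ℝ) 1,
      HasDerivWithinAt (fun t => z t - a - t • b + (2⁻¹ * t ^ 2) • H a b b)
        (z' t - b + t • H a b b) (Set.Icc 0 1) t := by
    intro t ht
    have h1 := (((h.hasDeriv t ht).sub_const a).sub
      ((hasDerivWithinAt_id t (Set.Icc 0 1)).smul_const b)).add
      ((((hasDerivAt_pow 2 t).const_mul (2⁻¹ : ℝ)).hasDerivWithinAt (s := Set.Icc 0 1)).smul_const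
        (H a b b))
    refine h1.congr_deriv ?_
    rw [one_smul]
    congr 2
    norm_num
    ring
  have hk'n : ∀ t ∈ Set.Icc (0 : ℝ) 1, ‖z' t - b + t • H a b b‖ ≤ η * ‖b‖ ^ 2 := by
    intro t ht
    have h1 := norm_image_sub_le_of_norm_deriv_le_segment' hk'
      (fun t ht => hacc t (Set.Ico_subset_Icc_self ht)) t ht
    rw [h.init', zero_smul, sub_self, zero_add, sub_zero, sub_zero] at h1
    exact h1.trans (mul_le_of_le_one_right (by positivity) ht.2)
  have h2 := norm_image_sub_le_of_norm_deriv_le_segment_01' hk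
    (fun t ht => hk'n t (Set.Ico_subset_Icc_self ht))
  simpa [h.init] using h2

/-- Geodesics with small initial velocity exist up to time `1`. -/
theorem exists_forall_exists_isGeodesicPath [CompleteSpace E] (hH : ContDiffAt ℝ 1 H a) :
    ∃ δ > 0, ∀ b, ‖b‖ < δ → ∃ z z', IsGeodesicPath H a b z z' := by
  let V : E × E → E × E := fun y => (y.2, -H y.1 y.2 y.2)
  have hH' : ContDiffAt ℝ 1 (fun y : E × E => H y.1) (a, 0) :=
    ContDiffAt.comp (a, (0 : E)) (g := H) hH contDiffAt_fst
  have hV : ContDiffAt ℝ 1 V (a, 0) :=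
    contDiffAt_snd.prodMk ((hH'.clm_apply contDiffAt_snd).clm_apply contDiffAt_snd).neg
  obtain ⟨r, hr, ε, hε, hflow⟩ :=
    hV.exists_forall_mem_closedBall_exists_eq_forall_mem_Ioo_hasDerivAt 0
  -- a geodesic on `[0, τ]` with initial velocity `τ⁻¹ b` is rescaled to `[0, 1]`
  set τ := ε / 2 with hτ'
  have hτ : 0 < τ := by positivity
  refine ⟨τ * r, by positivity, fun b hb => ?_⟩
  obtain ⟨y, hy0, hy⟩ := hflow (a, τ⁻¹ • b) (by
    rw [mem_closedBall_iff_norm, Prod.mk_sub_mk, sub_self, sub_zero, Prod.norm_def, norm_zero,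
      norm_smul, norm_inv, Real.norm_of_nonneg hτ.le]
    refine max_le hr.le ?_
    rw [inv_mul_le_iff₀ hτ]
    exact hb.le)
  have hmem : ∀ t ∈ Set.Icc (0 : ℝ) 1, τ * t ∈ Set.Ioo (0 - ε) (0 + ε) := by
    intro t ht
    have h1 : 0 ≤ τ * t := mul_nonneg hτ.le ht.1
    have h2 : τ * t ≤ τ := mul_le_of_le_one_right hτ.le ht.2
    constructor <;> linarith
  have hy' : ∀ t ∈ Set.Icc (0 : ℝ) 1, HasDerivWithinAt (fun t => y (τ * t))
      (τ • V (y (τ * t))) (Set.Icc 0 1) t := by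
    intro t ht
    have h1 := (hasDerivAt_id t).const_mul τ
    rw [mul_one] at h1
    exact ((hy _ (hmem t ht)).scomp t h1).hasDerivWithinAt
  refine ⟨fun t => (y (τ * t)).1, fun t => τ • (y (τ * t)).2, ?_, ?_, fun t ht =>
    (hy' t ht).fst,
    fun t ht => ?_⟩
  · rw [mul_zero, hy0]
  · rw [mul_zero, hy0, smul_inv_smul₀ hτ.ne']
  · have h1 : HasDerivWithinAt (fun t => (y (τ * t)).2) (τ • V (y (τ * t))).2 (Set.Icc 0 1) t :=
      (hy' t ht).snd
    refine (h1.const_smul τ).congr_deriv ?_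
    simp only [V, Prod.smul_mk, map_smul, smul_apply, smul_neg]

end Geodesics

/-! ### Second-order Taylor expansions -/

section Taylor

open Asymptotics

variable {E F X : Type*} [NormedAddCommGroup E] [NormedSpace ℝ E] [NormedAddCommGroup F]
  [NormedSpace ℝ F] [NormedAddCommGroup X] [NormedSpace ℝ X]

/-- The second-order Taylor expansion: by the mean value inequality, as the derivative of the
remainder is `o(‖d‖)`. -/
theorem isLittleO_taylor_two {k : E → F} {a : E} (hk : ContDiffAt ℝ 2 k a) :
    (fun d => k (a + d) - k a - fderiv ℝ k a d - (2⁻¹ : ℝ) • fderiv ℝ (fderiv ℝ k) a d d)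
      =o[𝓝 0] fun d => ‖d‖ ^ 2 := by
  have hsymm : ∀ d d', fderiv ℝ (fderiv ℝ k) a d d' = fderiv ℝ (fderiv ℝ k) a d' d :=
    hk.isSymmSndFDerivAt (by simp)
  have h2 : HasFDerivAt (fderiv ℝ k) (fderiv ℝ (fderiv ℝ k) a) a :=
    ((hk.fderiv_right (m := 1) (by rw [one_add_one_eq_two])).differentiableAt
      (by simp)).hasFDerivAt
  have hd : ∀ᶠ d in 𝓝 (0 : E), DifferentiableAt ℝ k (a + d) := by
    have h1 : Filter.Tendsto (fun d => a + d) (𝓝 0) (𝓝 a) :=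
      Continuous.tendsto' (by fun_prop) _ _ (add_zero a)
    refine h1.eventually ?_
    filter_upwards [hk.eventually (by simp)] with x hx using hx.differentiableAt (by simp)
  refine isLittleO_iff.2 fun ε hε => ?_
  obtain ⟨δ, hδ, h⟩ := Metric.eventually_nhds_iff.1
    (hd.and (isLittleO_iff.1 (hasFDerivAt_iff_isLittleO_nhds_zero.1 h2) hε))
  refine Metric.eventually_nhds_iff.2 ⟨δ, hδ, fun d hd => ?_⟩
  rw [dist_zero_right] at hd
  let R : E → F := fun d =>
    k (a + d) - k a - fderiv ℝ k a d - (2⁻¹ : ℝ) • fderiv ℝ (fderiv ℝ k) a d d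
  have hR : ∀ y ∈ Metric.closedBall (0 : E) ‖d‖, HasFDerivWithinAt R
      (fderiv ℝ k (a + y) - fderiv ℝ k a - fderiv ℝ (fderiv ℝ k) a y)
      (Metric.closedBall 0 ‖d‖) y := by
    intro y hy
    have hyδ : dist y 0 < δ := (Metric.mem_closedBall.1 hy).trans_lt hd
    have e1 : HasFDerivAt (fun y => k (a + y)) (fderiv ℝ k (a + y)) y := by
      have := (h hyδ).1.hasFDerivAt.comp y ((hasFDerivAt_id y).const_add a)
      rwa [ContinuousLinearMap.comp_id] at this
    have e2 := (((fderiv ℝ (fderiv ℝ k) a).hasFDerivAt (x := y)).clm_apply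
      (hasFDerivAt_id y)).const_smul (2⁻¹ : ℝ)
    have e3 := ((e1.sub_const (k a)).sub ((fderiv ℝ k a).hasFDerivAt (x := y))).sub e2
    refine (e3.congr_fderiv ?_).hasFDerivWithinAt
    ext1 w
    simp only [sub_apply, add_apply, smul_apply, ContinuousLinearMap.comp_apply,
      ContinuousLinearMap.flip_apply, ContinuousLinearMap.id_apply, id]
    rw [hsymm w y, ← two_smul ℝ, smul_smul]
    norm_num
  have h3 := (convex_closedBall (0 : E) ‖d‖).norm_image_sub_le_of_norm_hasFDerivWithin_le hR
    (C := ε * ‖d‖) (fun y hy => by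
      have hy' : ‖y‖ ≤ ‖d‖ := mem_closedBall_zero_iff.1 hy
      refine (h (y := y) ((Metric.mem_closedBall.1 hy).trans_lt hd)).2.trans ?_
      gcongr)
    (Metric.mem_closedBall_self (norm_nonneg d)) (mem_closedBall_zero_iff.2 le_rfl)
  have h4 : R 0 = 0 := by simp [R]
  rw [h4, sub_zero, sub_zero, mul_assoc, ← pow_two] at h3
  rwa [norm_pow, norm_norm]

theorem isBigO_bilinear {S V V' W : Type*} [NormedAddCommGroup V] [NormedSpace ℝ V]
    [NormedAddCommGroup V'] [NormedSpace ℝ V'] [NormedAddCommGroup W] [NormedSpace ℝ W]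
    (L : V →L[ℝ] V' →L[ℝ] W) (u : S → V) (v : S → V') (l : Filter S) :
    (fun s => L (u s) (v s)) =O[l] fun s => ‖u s‖ * ‖v s‖ := by
  refine IsBigO.of_bound ‖L‖ (Filter.Eventually.of_forall fun s => ?_)
  rw [norm_mul, norm_norm, norm_norm, ← mul_assoc]
  exact L.le_opNorm₂ _ _

/-- The second-order expansion of a composition. -/
theorem isLittleO_comp_expansion {k : E → F} {a : E} (hk : ContDiffAt ℝ 2 k a) (ℓ : X →L[ℝ] E)
    (B : X →L[ℝ] X →L[ℝ] E) {y : X → E}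
    (hy : (fun s => y s - a - ℓ s + (2⁻¹ : ℝ) • B s s) =o[𝓝 0] fun s => ‖s‖ ^ 2) :
    (fun s => k (y s) - k a - fderiv ℝ k a (ℓ s) -
      (2⁻¹ : ℝ) • (fderiv ℝ (fderiv ℝ k) a (ℓ s) (ℓ s) - fderiv ℝ k a (B s s)))
      =o[𝓝 0] fun s => ‖s‖ ^ 2 := by
  have hsq : (fun s : X => ‖s‖ ^ 2) =o[𝓝 0] fun s => s := isLittleO_norm_pow_id one_lt_two
  have hB : (fun s => (2⁻¹ : ℝ) • B s s) =O[𝓝 0] fun s => ‖s‖ ^ 2 := by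
    simp only [pow_two]
    exact (isBigO_bilinear B id id _).const_smul_left _
  have h1 : (fun s => y s - a - ℓ s) =o[𝓝 0] fun s => s := by
    refine ((hy.isBigO.sub hB).trans_isLittleO hsq).congr_left fun s => ?_
    abel
  have hℓ : ℓ =O[𝓝 0] fun s : X => s := ℓ.isBigO_id _
  have h2 : (fun s => y s - a) =O[𝓝 0] fun s => s := by
    refine (h1.isBigO.add hℓ).congr_left fun s => ?_
    abel
  have h3 : Filter.Tendsto (fun s => y s - a) (𝓝 0) (𝓝 0) := h2.trans_tendsto Filter.tendsto_id
  have h4 := ((isLittleO_taylor_two hk).comp_tendsto h3).trans_isBigO (h2.norm_norm.pow 2)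
  have h5 := (((fderiv ℝ k a).isBigO_comp _ _).trans_isLittleO hy :
    (fun s => fderiv ℝ k a (y s - a - ℓ s + (2⁻¹ : ℝ) • B s s)) =o[𝓝 0] fun s => ‖s‖ ^ 2)
  have h6 : (fun s => fderiv ℝ (fderiv ℝ k) a (y s - a - ℓ s) (y s - a)) =o[𝓝 0]
      fun s => ‖s‖ ^ 2 := by
    refine (isBigO_bilinear (fderiv ℝ (fderiv ℝ k) a) _ _ _).trans_isLittleO ?_
    simp only [pow_two]
    exact h1.norm_norm.mul_isBigO h2.norm_norm
  have h7 : (fun s => fderiv ℝ (fderiv ℝ k) a (ℓ s) (y s - a - ℓ s)) =o[𝓝 0]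
      fun s => ‖s‖ ^ 2 := by
    refine (isBigO_bilinear (fderiv ℝ (fderiv ℝ k) a) _ _ _).trans_isLittleO ?_
    simp only [pow_two]
    exact hℓ.norm_norm.mul_isLittleO h1.norm_norm
  refine ((h4.add h5).add ((h6.add h7).const_smul_left (2⁻¹ : ℝ))).congr_left fun s => ?_
  simp only [Function.comp_apply, add_sub_cancel, map_sub, map_add, map_smul, sub_apply, smul_sub,
    Pi.smul_apply, smul_add]
  abel

end Taylor

namespace RegularFoliation

variable {p q : ℕ} {M : Type*} [TopologicalSpace M] [ChartedSpace (Euc (p + q)) M]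
  {ι : Type*} {F : RegularFoliation p q M ι}

/-! ### Adapted lifts and their Christoffel symbols -/

variable {φ : OpenPartialHomeomorph M (Euc q × Euc p)}

/-- The local sections `p (∂/∂x^i)` have constant components in the coordinates. -/
theorem IsFoliationChart.normalDeriv_proj_coordField (hφ : F.IsFoliationChart φ) {y : M}
    (hy : y ∈ φ.source) (b : Euc q × Euc p) :
    F.normalDeriv (fun z => (φ z).1) y (F.proj y (coordField φ b y)) = b.1 := by
  rw [hφ.isTransverseChart.normalDeriv_proj hy, hφ.isSmoothChart.mvfderiv_fst_coordField hy]

/-- A leafwise vector is a combination of the `∂/∂y^a`. -/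
theorem IsFoliationChart.coordField_of_mem_tangent (hφ : F.IsFoliationChart φ) {y : M}
    (hy : y ∈ φ.source) {v : TangentSpace 𝓘(ℝ, Euc (p + q)) y} (hv : v ∈ F.tangent y) :
    coordField φ (0, (mvfderiv 𝓘(ℝ, Euc (p + q)) φ y v).2) y = v := by
  have h1 : (mvfderiv 𝓘(ℝ, Euc (p + q)) φ y v).1 = 0 := by
    have h2 := (hφ.isTransverseChart.mem_tangent y hy v).1 hv
    rw [mvfderiv_fderiv_comp (h := Prod.fst) differentiableAt_fst (hφ.isSmoothChart.mdiff hy),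
      fderiv_fst] at h2
    exact h2
  conv_rhs => rw [← hφ.isSmoothChart.coordField_mvfderiv hy v]
  rw [← h1]

variable [IsManifold 𝓘(ℝ, Euc (p + q)) ∞ M]

/-- Every frame has an adapted lift: the transverse chart `A⁻¹ ∘ f` of a Haefliger chart `f`, where
`A` represents the frame, extends to foliation coordinates. -/
theorem exists_isAdaptedLift (u : F.TransverseEmbedding) : ∃ φ, F.IsAdaptedLift φ u := by
  obtain ⟨α, hα⟩ := F.cover (u 0)
  let A := u.deriv₁Equiv hα
  have hf := (F.isTransverseChart_haefliger α).comp_equiv A.symm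
  obtain ⟨φ, hφ, hx, hφU, hφf⟩ := hf.exists_isFoliationChart hα
  refine ⟨φ, hφ, hx, fun e => ((hφ.isTransverseChart.proj_eq_iff hx).2 ?_).symm⟩
  rw [hφ.isSmoothChart.mvfderiv_fst_coordField hx, ← u.fderiv_comp_apply hφ.isTransverseChart hx]
  have h1 : (fun s => (φ (u s)).1) =ᶠ[𝓝 0] fun s => A.symm (F.f α (u s)) := by
    filter_upwards [u.smooth.continuous.continuousAt.preimage_mem_nhds
      (φ.open_source.mem_nhds hx)] with s hs using hφf _ hs
  rw [h1.fderiv_eq]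
  have h2 := fderiv_comp (0 : Euc q) (g := A.symm) A.symm.differentiableAt
    ((u.contDiffAt_haefliger hα).differentiableAt (by simp))
  rw [A.symm.fderiv] at h2
  exact (congrArg (fun L : Euc q →L[ℝ] Euc q => L e) h2).trans (A.symm_apply_apply e)

variable [T2Space M]

/-- The leafwise coordinate fields `∂/∂y^a`, extended to global sections of `Tℱ`. -/
theorem IsFoliationChart.exists_tangentSections (hφ : F.IsFoliationChart φ) {x : M}
    (hx : x ∈ φ.source) : ∃ S : Euc p →ₗ[ℝ] F.tangentSections, ∀ k, ∀ᶠ y in 𝓝 x,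
      ((S k).1 y : TangentSpace 𝓘(ℝ, Euc (p + q)) y) = coordField φ (0, k) y := by
  obtain ⟨Y, N, hN, hxN, hNφ, hY, hYt⟩ := hφ.exists_extension hx
  let Y₀ : Euc p →ₗ[ℝ] smoothFields (p + q) M := Y ∘ₗ LinearMap.inr ℝ (Euc q) (Euc p)
  refine ⟨{ toFun := fun k => ⟨fun y => ⟨(Y₀ k).1 y, hYt k y⟩, (Y₀ k).2⟩
            map_add' := fun k k' => ?_
            map_smul' := fun r k => ?_ }, fun k => ?_⟩
  · ext y : 3
    exact congrFun (congrArg Subtype.val (map_add Y₀ k k')) y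
  · ext y : 3
    exact congrFun (congrArg Subtype.val (map_smul Y₀ r k)) y
  · filter_upwards [hN.mem_nhds hxN] with y hy using hY y hy (0, k)

/-- The affine connection `∇^ν ⊕ ∇^ℱ` has Christoffel symbols, and those in the transverse
directions are the Christoffel symbols of `∇^ν`. -/
theorem IsFoliationChart.exists_isChristoffel (hφ : F.IsFoliationChart φ)
    (D : F.TorsionFreeBottConnection) (D' : F.TangentialConnection) :
    ∃ (G : M → (Euc q × Euc p) →ₗ[ℝ] (Euc q × Euc p) →ₗ[ℝ] (Euc q × Euc p))
      (Γ : M → Euc q →L[ℝ] Euc q →L[ℝ] Euc q), F.IsChristoffel D.1 D' φ G ∧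
      ContMDiffOn 𝓘(ℝ, Euc (p + q)) 𝓘(ℝ, Euc q →L[ℝ] Euc q →L[ℝ] Euc q) ∞ Γ φ.source ∧
      ∀ y ∈ φ.source, ∀ e e', G y (e, 0) (e', 0) = (Γ y e e', 0) := by
  obtain ⟨Γ, hΓs, hΓ⟩ := hφ.isTransverseChart.exists_christoffel D
  have hpt : ∀ y ∈ φ.source, ∃ L : Euc p →ₗ[ℝ] (Euc q × Euc p) →ₗ[ℝ] Euc p,
      ∀ k b, ∀ S : F.tangentSections,
        (∀ᶠ z in 𝓝 y, (S.1 z : TangentSpace 𝓘(ℝ, Euc (p + q)) z) = coordField φ (0, k) z) →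
        (D'.toFun S y (coordField φ b y) : TangentSpace 𝓘(ℝ, Euc (p + q)) y) =
          coordField φ (0, L k b) y := by
    intro y hy
    obtain ⟨S, hS⟩ := hφ.exists_tangentSections hy
    let c : (Euc q × Euc p) →ₗ[ℝ] TangentSpace 𝓘(ℝ, Euc (p + q)) y :=
      (mfderiv 𝓘(ℝ, Euc q × Euc p) 𝓘(ℝ, Euc (p + q)) φ.symm (φ y) :
        _ →L[ℝ] Euc (p + q)).toLinearMap
    let r : TangentSpace 𝓘(ℝ, Euc (p + q)) y →ₗ[ℝ] Euc p :=
      LinearMap.snd ℝ (Euc q) (Euc p) ∘ₗ (mvfderiv 𝓘(ℝ, Euc (p + q)) φ y).toLinearMap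
    let L : Euc p →ₗ[ℝ] (Euc q × Euc p) →ₗ[ℝ] Euc p := LinearMap.mk₂ ℝ
      (fun k b => r ((F.tangent y).subtype (KoszulConnection.derivAt D' y (S k) (c b))))
      (fun k k' b => by simp only [map_add, LinearMap.add_apply])
      (fun t k b => by simp only [map_smul, LinearMap.smul_apply])
      (fun k b b' => by simp only [map_add])
      (fun t k b => by simp only [map_smul])
    refine ⟨L, fun k b T hT => ?_⟩
    have h1 : D'.toFun T y = D'.toFun (S k) y :=
      TangentialConnection.congr_germ D' (by
        filter_upwards [hT, hS k] with z hz hz'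
        exact Subtype.ext (hz.trans hz'.symm))
    rw [h1]
    exact (hφ.coordField_of_mem_tangent hy (D'.toFun (S k) y (coordField φ b y)).2).symm
  choose! L hL using hpt
  let G : M → (Euc q × Euc p) →ₗ[ℝ] (Euc q × Euc p) →ₗ[ℝ] (Euc q × Euc p) := fun y =>
    LinearMap.mk₂ ℝ (fun b c => (Γ y b.1 c.1, L y c.2 b))
      (fun b b' c => by simp)
      (fun t b c => by simp)
      (fun b c c' => by simp)
      (fun t b c => by simp)
  have hG : ∀ y b c, G y b c = (Γ y b.1 c.1, L y c.2 b) := fun _ _ _ => rfl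
  refine ⟨G, Γ, fun y hy b => ⟨fun e => ⟨by simp [hG], fun s hs => ?_⟩,
    fun k => ⟨by simp [hG], fun S hS => ?_⟩⟩, hΓs, fun y _ e e' => by simp [hG]⟩
  · have h1 : (fun z => F.normalDeriv (fun z => (φ z).1) z (s.1 z)) =ᶠ[𝓝 y] fun _ => e := by
      filter_upwards [hs, φ.open_source.mem_nhds hy] with z hz hzφ
      rw [hz, hφ.normalDeriv_proj_coordField hzφ]
    have h2 : F.normalDeriv (fun z => (φ z).1) y (s.1 y) = e := h1.self_of_nhds
    refine hφ.isTransverseChart.normalDeriv_injective hy ?_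
    rw [(hΓ y hy).2, mvfderiv_congr h1, mvfderiv_const, hφ.normalDeriv_proj_coordField hy, h2,
      hφ.isSmoothChart.mvfderiv_fst_coordField hy, hG]
    exact zero_add _
  · rw [hL y hy k b S hS, hG]
    simp

/-- Christoffel symbols are continuous: covariant derivatives of smooth extensions of the coordinate
fields are smooth. -/
theorem IsChristoffel.continuousAt {D : F.NormalConnection} {D' : F.TangentialConnection}
    {G : M → (Euc q × Euc p) →ₗ[ℝ] (Euc q × Euc p) →ₗ[ℝ] (Euc q × Euc p)}
    (hG : F.IsChristoffel D D' φ G) (hφ : F.IsFoliationChart φ) {x : M} (hx : x ∈ φ.source)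
    (b c : Euc q × Euc p) : ContinuousAt (fun y => G y b c) x := by
  obtain ⟨Y, N, hN, hxN, hNφ, hY, hYt⟩ := hφ.exists_extension hx
  have hNm := hN.mem_nhds hxN
  have h1 : ContinuousAt (fun y => G y b (c.1, 0)) x := by
    let t : F.normalSections := ⟨fun y => D.toFun (F.projSection (Y (c.1, 0))) y ((Y b).1 y),
      D.smooth (Y b).1 (Y b).2 (F.projSection (Y (c.1, 0)))⟩
    have h2 : ContinuousAt (fun y => F.normalDeriv (fun z => (φ z).1) y (t.1 y)) x :=
      (hφ.isTransverseChart.mdiff_section t hx).continuousAt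
    refine (h2.prodMk (continuousAt_const (y := (0 : Euc p)))).congr ?_
    filter_upwards [hNm] with y hy
    have h3 := (hG y (hNφ hy) b).1 c.1
    refine Prod.ext ?_ h3.1.symm
    have h4 := h3.2 (F.projSection (Y (c.1, 0))) (by
      filter_upwards [hN.mem_nhds hy] with z hz
      exact congrArg (F.proj z) (hY z hz _))
    change F.normalDeriv (fun z => (φ z).1) y
      (D.toFun (F.projSection (Y (c.1, 0))) y ((Y b).1 y)) = _
    rw [hY y hy, h4, hφ.normalDeriv_proj_coordField (hNφ hy)]
  have h2 : ContinuousAt (fun y => G y b (0, c.2)) x := by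
    let S : F.tangentSections := ⟨fun y => ⟨(Y (0, c.2)).1 y, hYt c.2 y⟩, (Y (0, c.2)).2⟩
    have hS : SmoothFieldOn (fun y => (D'.toFun S y ((Y b).1 y) :
        TangentSpace 𝓘(ℝ, Euc (p + q)) y)) φ.source :=
      ContMDiffOn.mono (D'.smooth (Y b).1 (Y b).2 S) (Set.subset_univ _)
    have h3 := (contMDiffOn_mvfderiv_apply φ.open_source hφ.smooth hS).contMDiffAt
      (φ.open_source.mem_nhds hx)
    refine h3.continuousAt.congr ?_
    filter_upwards [hNm] with y hy
    have h4 := ((hG y (hNφ hy) b).2 c.2).2 S (by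
      filter_upwards [hN.mem_nhds hy] with z hz using hY z hz _)
    change mvfderiv 𝓘(ℝ, Euc (p + q)) φ y (D'.toFun S y ((Y b).1 y)) = _
    rw [hY y hy, h4, hφ.isSmoothChart.mvfderiv_self_coordField (hNφ hy)]
  refine (h1.add h2).congr (Filter.Eventually.of_forall fun y => ?_)
  change G y b (c.1, 0) + G y b (0, c.2) = G y b c
  rw [← map_add, Prod.mk_add_mk, add_zero, zero_add]

end RegularFoliation

namespace RegularFoliation

variable {p q : ℕ} {M : Type*} [TopologicalSpace M]
  {φ : OpenPartialHomeomorph M (Euc q × Euc p)}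

/-! ### The exponential map -/

/-- Christoffel symbols as a function of the coordinates. -/
def coordChristoffel (φ : OpenPartialHomeomorph M (Euc q × Euc p))
    (G : M → (Euc q × Euc p) →ₗ[ℝ] (Euc q × Euc p) →ₗ[ℝ] (Euc q × Euc p)) (z : Euc q × Euc p) :
    (Euc q × Euc p) →L[ℝ] (Euc q × Euc p) →L[ℝ] (Euc q × Euc p) :=
  LinearMap.toContinuousLinearMap
    ((LinearMap.toContinuousLinearMap : ((Euc q × Euc p) →ₗ[ℝ] (Euc q × Euc p)) ≃ₗ[ℝ] _).toLinearMap
      ∘ₗ G (φ.symm z))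

theorem coordChristoffel_apply (G : M → (Euc q × Euc p) →ₗ[ℝ] (Euc q × Euc p) →ₗ[ℝ] (Euc q × Euc p))
    (z b c : Euc q × Euc p) : coordChristoffel φ G z b c = G (φ.symm z) b c := rfl

theorem isGeodesic_iff {G : M → (Euc q × Euc p) →ₗ[ℝ] (Euc q × Euc p) →ₗ[ℝ] (Euc q × Euc p)} {x : M}
    {b : Euc q × Euc p} {z : ℝ → Euc q × Euc p} :
    IsGeodesic φ G x b z ↔ (∃ z', IsGeodesicPath (coordChristoffel φ G) (φ x) b z z') ∧
      ∀ t ∈ Set.Icc (0 : ℝ) 1, z t ∈ φ.target :=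
  ⟨fun ⟨z', h0, h0', h⟩ => ⟨⟨z', h0, h0', fun t ht => (h t ht).2.1, fun t ht => (h t ht).2.2⟩,
    fun t ht => (h t ht).1⟩,
    fun ⟨⟨z', h⟩, ht⟩ => ⟨z', h.init, h.init', fun t htt =>
      ⟨ht t htt, h.hasDeriv t htt, h.hasDeriv' t htt⟩⟩⟩

variable [ChartedSpace (Euc (p + q)) M] {ι : Type*} {F : RegularFoliation p q M ι}
  [IsManifold 𝓘(ℝ, Euc (p + q)) ∞ M] [T2Space M]

theorem IsChristoffel.continuousAt_coordChristoffel {D : F.NormalConnection}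
    {D' : F.TangentialConnection}
    {G : M → (Euc q × Euc p) →ₗ[ℝ] (Euc q × Euc p) →ₗ[ℝ] (Euc q × Euc p)}
    (hG : F.IsChristoffel D D' φ G) (hφ : F.IsFoliationChart φ) {x : M} (hx : x ∈ φ.source) :
    ContinuousAt (coordChristoffel φ G) (φ x) := by
  refine continuousAt_clm_apply.2 fun b => continuousAt_clm_apply.2 fun c => ?_
  have h1 : ContinuousAt (fun y => G y b c) (φ.symm (φ x)) := by
    rw [φ.left_inv hx]; exact hG.continuousAt hφ hx b c
  exact ContinuousAt.comp (g := fun y => G y b c) h1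
    (φ.symm.continuousAt (φ.map_source hx))

/-- The exponential map exists: geodesics with initial velocity in the span of the `e_i` are
geodesics of the Christoffel symbols of `∇^ν` in a slice `y = const`. -/
theorem IsFoliationChart.exists_isExponential (hφ : F.IsFoliationChart φ)
    (D : F.TorsionFreeBottConnection) (D' : F.TangentialConnection) {x : M} (hx : x ∈ φ.source) :
    ∃ w, F.IsExponential D.1 D' φ x w := by
  obtain ⟨G, Γ, hG, hΓ, hGΓ⟩ := hφ.exists_isChristoffel D D'
  -- the slice through `x`, and the Christoffel symbols on it
  let j : Euc q → Euc q × Euc p := fun e => (e, (φ x).2)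
  have hj : ContDiff ℝ ∞ j := contDiff_id.prodMk contDiff_const
  have hjx : j (φ x).1 ∈ φ.target := φ.map_source hx
  let H : Euc q → Euc q →L[ℝ] Euc q →L[ℝ] Euc q := fun e => Γ (φ.symm (j e))
  have hH : ContDiffAt ℝ ∞ H (φ x).1 := by
    have h1 := hφ.smooth_symm.contMDiffAt (φ.open_target.mem_nhds hjx)
    have h2 := hΓ.contMDiffAt (φ.open_source.mem_nhds (φ.map_target hjx))
    exact (ContMDiffAt.comp (φ x).1 (ContMDiffAt.comp (j (φ x).1) h2 h1)
      hj.contMDiff.contMDiffAt).contDiffAt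
  obtain ⟨δ₁, hδ₁, hex⟩ := exists_forall_exists_isGeodesicPath (hH.of_le (by simp))
  obtain ⟨δ₂, hδ₂, hbd⟩ := exists_forall_isGeodesicPath_norm_le hH.continuousAt
  obtain ⟨r, hr, hball⟩ := Metric.isOpen_iff.1 (φ.open_target.preimage hj.continuous) _ hjx
  have key : ∀ᶠ s in 𝓝 (0 : Euc q), ∃ z, IsGeodesic φ G x (s, 0) z := by
    have he := Real.exp_pos 2
    filter_upwards [Metric.ball_mem_nhds (0 : Euc q) (lt_min hδ₁ (lt_min hδ₂ (div_pos hr he)))]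
      with s hs
    rw [mem_ball_zero_iff, lt_min_iff, lt_min_iff, lt_div_iff₀ he] at hs
    obtain ⟨ζ, ζ', hζ⟩ := hex s hs.1
    have hmem : ∀ t ∈ Set.Icc (0 : ℝ) 1, j (ζ t) ∈ φ.target := fun t ht => hball (by
      rw [mem_ball_iff_norm]
      refine (hbd s ζ ζ' hs.2.1 hζ t ht).1.trans_lt ?_
      linarith [hs.2.2])
    refine ⟨fun t => j (ζ t), isGeodesic_iff.2 ⟨⟨fun t => (ζ' t, 0), ?_, ?_, fun t ht => ?_,
      fun t ht => ?_⟩, hmem⟩⟩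
    · exact Prod.ext hζ.init rfl
    · exact Prod.ext hζ.init' rfl
    · exact (hζ.hasDeriv t ht).prodMk (hasDerivWithinAt_const _ _ _)
    · refine ((hζ.hasDeriv' t ht).prodMk (hasDerivWithinAt_const t _ (0 : Euc p))).congr_deriv ?_
      rw [coordChristoffel_apply, hGΓ _ (φ.map_target (hmem t ht)), Prod.neg_mk, neg_zero]
  -- the value `x` at the `s` for which there is no geodesic is irrelevant to the germ
  classical
  refine ⟨fun s => if h : ∃ z, IsGeodesic φ G x (s, 0) z then φ.symm (h.choose 1) else x,
    G, hG, ?_⟩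
  filter_upwards [key] with s hs
  exact ⟨hs.choose, hs.choose_spec, dif_pos hs⟩

/-- The Christoffel symbols in a transverse chart `f` from those in foliation coordinates: in the
coordinates, `f` is a function `k` with `D²k(e, e') - Dk(G(e, e')) = -Γ(Dk e, Dk e')`. -/
theorem IsChristoffel.fderiv_fderiv_eq {D : F.NormalConnection} {D' : F.TangentialConnection}
    {G : M → (Euc q × Euc p) →ₗ[ℝ] (Euc q × Euc p) →ₗ[ℝ] (Euc q × Euc p)}
    (hG : F.IsChristoffel D D' φ G) (hφ : F.IsFoliationChart φ) {x : M} (hx : x ∈ φ.source)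
    {f : M → Euc q} {U : Set M} (hf : F.IsTransverseChart f U) (hxU : x ∈ U)
    {Γ : Euc q →L[ℝ] Euc q →L[ℝ] Euc q} (hΓ : HasChristoffelAt D f x Γ) (b : Euc q × Euc p)
    (e : Euc q) :
    fderiv ℝ (fderiv ℝ fun z => f (φ.symm z)) (φ x) b (e, 0) -
        fderiv ℝ (fun z => f (φ.symm z)) (φ x) (G x b (e, 0)) =
      -Γ (fderiv ℝ (fun z => f (φ.symm z)) (φ x) b)
        (fderiv ℝ (fun z => f (φ.symm z)) (φ x) (e, 0)) := by
  obtain ⟨Y, N, hN, hxN, hNφ, hY, -⟩ := hφ.exists_extension hx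
  have hdf : ∀ y ∈ φ.source, y ∈ U → ∀ c, mvfderiv 𝓘(ℝ, Euc (p + q)) f y (coordField φ c y) =
      fderiv ℝ (fun z => f (φ.symm z)) (φ y) c := fun y hy hyU c =>
    hφ.isSmoothChart.mvfderiv_coordField hy (hf.mdiff hyU) c
  let t : F.normalSections := F.projSection (Y (e, 0))
  have hS : (fun y => F.normalDeriv f y (t.1 y)) =ᶠ[𝓝 x]
      fun y => fderiv ℝ (fun z => f (φ.symm z)) (φ y) (e, 0) := by
    filter_upwards [hN.mem_nhds hxN, hf.isOpen.mem_nhds hxU] with y hy hyU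
    refine (hf.normalDeriv_proj hyU _).trans ?_
    rw [hY y hy, hdf y (hNφ hy) hyU]
  have hSd : mvfderiv 𝓘(ℝ, Euc (p + q)) (fun y => F.normalDeriv f y (t.1 y)) x (coordField φ b x) =
      fderiv ℝ (fderiv ℝ fun z => f (φ.symm z)) (φ x) b (e, 0) := by
    rw [hφ.isSmoothChart.mvfderiv_coordField hx (hf.mdiff_section t hxU)]
    have h1 : (fun z => F.normalDeriv f (φ.symm z) (t.1 (φ.symm z))) =ᶠ[𝓝 (φ x)]
        fun z => fderiv ℝ (fun z => f (φ.symm z)) z (e, 0) := by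
      have h2 : ContinuousAt φ.symm (φ x) := φ.symm.continuousAt (φ.map_source hx)
      have h3 := h2.eventually (by rw [φ.left_inv hx]; exact hS)
      filter_upwards [h3, φ.open_target.mem_nhds (φ.map_source hx)] with z hz hzt
      rw [φ.right_inv hzt] at hz
      exact hz
    rw [h1.fderiv_eq]
    have h4 : DifferentiableAt ℝ (fderiv ℝ fun z => f (φ.symm z)) (φ x) := by
      have h5 : ContDiffAt ℝ ∞ (fun z => f (φ.symm z)) (φ x) := by
        have h6 := hφ.smooth_symm.contMDiffAt (φ.open_target.mem_nhds (φ.map_source hx))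
        have h7 : ContMDiffAt 𝓘(ℝ, Euc (p + q)) 𝓘(ℝ, Euc q) ∞ f (φ.symm (φ x)) := by
          rw [φ.left_inv hx]; exact hf.smooth.contMDiffAt (hf.isOpen.mem_nhds hxU)
        exact (h7.comp _ h6).contDiffAt
      exact (h5.fderiv_right (m := 1)
        (by rw [one_add_one_eq_two]; exact two_le_infty)).differentiableAt (by simp)
    have h8 := (h4.hasFDerivAt.clm_apply (hasFDerivAt_const (e, (0 : Euc p)) (φ x))).fderiv
    rw [h8]
    simp
  have h1 := (hG x hx b).1 e |>.2 t (by
    filter_upwards [hN.mem_nhds hxN] with y hy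
    exact congrArg (F.proj y) (hY y hy _))
  have h2 := hΓ t (coordField φ b x)
  have h3 : F.normalDeriv f x (t.1 x) = fderiv ℝ (fun z => f (φ.symm z)) (φ x) (e, 0) :=
    hS.self_of_nhds
  rw [h1, hf.normalDeriv_proj hxU, hdf x hx hxU, hSd, hdf x hx hxU, h3] at h2
  rw [h2]
  abel

end RegularFoliation

namespace RegularFoliation

open Asymptotics

variable {p q : ℕ} {M : Type*} [TopologicalSpace M] [ChartedSpace (Euc (p + q)) M]
  {ι : Type*} {F : RegularFoliation p q M ι} {φ : OpenPartialHomeomorph M (Euc q × Euc p)}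
  [IsManifold 𝓘(ℝ, Euc (p + q)) ∞ M] [T2Space M]

/-! ### The transverse `2`-jet of the exponential map -/

/-- In foliation coordinates, the exponential map is `s ↦ φ(x) + s - ½ G(s, s) + o(‖s‖²)`. -/
theorem IsExponential.exists_expansion {D : F.NormalConnection} {D' : F.TangentialConnection}
    {x : M} {w : Euc q → M} (hφ : F.IsFoliationChart φ) (hx : x ∈ φ.source)
    (hw : F.IsExponential D D' φ x w) :
    ∃ G, F.IsChristoffel D D' φ G ∧ w 0 = x ∧ (∀ᶠ s in 𝓝 0, w s ∈ φ.source) ∧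
      (fun s => φ (w s) - φ x - (s, 0) + (2⁻¹ : ℝ) • G x (s, 0) (s, 0)) =o[𝓝 0]
        fun s => ‖s‖ ^ 2 := by
  obtain ⟨G, hG, hev⟩ := hw
  have hH := hG.continuousAt_coordChristoffel hφ hx
  have hnorm : ∀ s : Euc q, ‖(s, (0 : Euc p))‖ = ‖s‖ := fun s => by simp
  refine ⟨G, hG, ?_, ?_, isLittleO_iff.2 fun η hη => ?_⟩
  · obtain ⟨z, hz, hwz⟩ := hev.self_of_nhds
    obtain ⟨⟨z', hz'⟩, -⟩ := isGeodesic_iff.1 hz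
    obtain ⟨δ, hδ, hbd⟩ := exists_forall_isGeodesicPath_norm_le hH
    have h1 := (hbd (0, 0) z z' (by simpa using hδ) hz' 1 ⟨zero_le_one, le_rfl⟩).1
    rw [Prod.mk_zero_zero, norm_zero, mul_zero] at h1
    rw [hwz, sub_eq_zero.1 (norm_le_zero_iff.1 h1), φ.left_inv hx]
  · filter_upwards [hev] with s hs
    obtain ⟨z, hz, hwz⟩ := hs
    rw [hwz]
    exact φ.map_target ((isGeodesic_iff.1 hz).2 1 ⟨zero_le_one, le_rfl⟩)
  · obtain ⟨δ, hδ, hexp⟩ := exists_forall_isGeodesicPath_expansion hH hη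
    filter_upwards [hev, Metric.ball_mem_nhds (0 : Euc q) hδ] with s hs hsδ
    obtain ⟨z, hz, hwz⟩ := hs
    obtain ⟨⟨z', hz'⟩, hzt⟩ := isGeodesic_iff.1 hz
    have h1 := hexp (s, 0) z z' (by rw [hnorm]; exact mem_ball_zero_iff.1 hsδ) hz'
    rw [coordChristoffel_apply, φ.left_inv hx, hnorm] at h1
    rw [hwz, φ.right_inv (hzt 1 ⟨zero_le_one, le_rfl⟩), norm_pow, norm_norm]
    exact h1

/-- The exponential map through an adapted lift of a frame represents the value at that frame of
the section corresponding to `∇`: both have second derivatives given by minus the Christoffel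
symbols. -/
theorem Corresponds.hasTransverseTwoJet {σ : F.EquivariantSection} {D : F.NormalConnection}
    (h : Corresponds σ D) {u : F.TransverseEmbedding} (hφ : F.IsAdaptedLift φ u)
    {D' : F.TangentialConnection} {w : Euc q → M} (hw : F.IsExponential D D' φ (u 0) w) :
    F.HasTransverseTwoJet w (σ.toFun (u.jet 1)) := by
  intro v hv
  obtain ⟨hφc, hx, hφu⟩ := hφ
  obtain ⟨G, hG, hw0, hws, hwe⟩ := hw.exists_expansion hφc hx
  have hvu : v 0 = u 0 := σ.base_eq hv.symm
  refine ⟨hw0.trans hvu.symm, fun α hα => ?_⟩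
  have hα' : u 0 ∈ F.U α := hvu ▸ hα
  obtain ⟨Γ, hΓ, hΓv⟩ := h u v hv.symm α hα'
  have hf := F.isTransverseChart_haefliger α
  let k : Euc q × Euc p → Euc q := fun z => F.f α (φ.symm z)
  have hk : ContDiffAt ℝ 2 k (φ (u 0)) := by
    have h6 := hφc.smooth_symm.contMDiffAt (φ.open_target.mem_nhds (φ.map_source hx))
    have h7 : ContMDiffAt 𝓘(ℝ, Euc (p + q)) 𝓘(ℝ, Euc q) ∞ (F.f α) (φ.symm (φ (u 0))) := by
      rw [φ.left_inv hx]; exact hf.smooth.contMDiffAt (hf.isOpen.mem_nhds hα')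
    exact (h7.comp _ h6).contDiffAt.of_le two_le_infty
  let ℓ : Euc q →L[ℝ] Euc q × Euc p := ContinuousLinearMap.inl ℝ (Euc q) (Euc p)
  let B : Euc q →L[ℝ] Euc q →L[ℝ] Euc q × Euc p :=
    (coordChristoffel φ G (φ (u 0))).bilinearComp ℓ ℓ
  have hB : ∀ s, B s s = G (u 0) (s, 0) (s, 0) := fun s => by
    change G (φ.symm (φ (u 0))) (s, 0) (s, 0) = _
    rw [φ.left_inv hx]
  have hy : (fun s => φ (w s) - φ (u 0) - ℓ s + (2⁻¹ : ℝ) • B s s) =o[𝓝 0]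
      fun s => ‖s‖ ^ 2 := by
    simp only [hB]
    exact hwe
  have e1 := isLittleO_comp_expansion hk ℓ B hy
  have e2 := isLittleO_taylor_two ((v.contDiffAt_haefliger hα).of_le two_le_infty)
  have hk0 : k (φ (u 0)) = F.f α (v 0) := by rw [hvu]; exact congrArg (F.f α) (φ.left_inv hx)
  have hk1 : ∀ s, fderiv ℝ k (φ (u 0)) (s, 0) = v.deriv₁ α s := fun s => by
    rw [σ.deriv₁_eq hv.symm hα', ← u.normalDeriv_frame hα' s, ← hφu s,
      hf.normalDeriv_proj hα', hφc.isSmoothChart.mvfderiv_coordField hx (hf.mdiff hα')]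
  have hk2 : ∀ s, fderiv ℝ (fderiv ℝ k) (φ (u 0)) (ℓ s) (ℓ s) - fderiv ℝ k (φ (u 0)) (B s s) =
      v.deriv₂ α s s := fun s => by
    rw [hB, hΓv, ← σ.deriv₁_eq hv.symm hα', ← hk1 s]
    exact hG.fderiv_fderiv_eq hφc hx hf hα' hΓ (s, 0) s
  refine (e1.sub e2).congr' ?_ Filter.EventuallyEq.rfl
  filter_upwards [hws] with s hs
  have h1 : k (φ (w s)) = F.f α (w s) := congrArg (F.f α) (φ.left_inv hs)
  have h2 : fderiv ℝ k (φ (u 0)) (ℓ s) = v.deriv₁ α s := hk1 s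
  rw [h1, h2, hk2, hk0, zero_add]
  change F.f α (w s) - F.f α (v 0) - v.deriv₁ α s - (2⁻¹ : ℝ) • v.deriv₂ α s s -
    (F.f α (v s) - F.f α (v 0) - v.deriv₁ α s - (2⁻¹ : ℝ) • v.deriv₂ α s s) = _
  abel

theorem Corresponds.isExponentialSection {σ : F.EquivariantSection}
    {D : F.TorsionFreeBottConnection} (h : Corresponds σ D.1) : F.IsExponentialSection D.1 σ :=
  fun u => ⟨exists_isAdaptedLift u, fun _ hφ D' =>
    ⟨hφ.1.exists_isExponential D D' hφ.2.1, fun _ hw => h.hasTransverseTwoJet hφ hw⟩⟩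

end RegularFoliation

end

theorem mainTheorem9 {p q : ℕ} {M : Type*} [TopologicalSpace M] [T2Space M] [ParacompactSpace M]
    [ChartedSpace (Euc (p + q)) M] [IsManifold 𝓘(ℝ, Euc (p + q)) ∞ M] {ι : Type*}
    (F : RegularFoliation p q M ι) :
    ∃ Φ : F.EquivariantSection ≃ F.TorsionFreeBottConnection,
      (∀ σ : F.EquivariantSection, F.PullsBackToConnectionForm σ (Φ σ).1) ∧
      (∀ D : F.TorsionFreeBottConnection, F.IsExponentialSection D.1 (Φ.symm D)) := by
  refine ⟨F.sectionEquivConnection, fun σ => ?_, fun D => ?_⟩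
  · exact (RegularFoliation.corresponds_sectionEquivConnection σ).pullsBackToConnectionForm
  · exact (RegularFoliation.corresponds_sectionEquivConnection_symm D).isExponentialSection
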